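/- Let $T\in\mathbb N$ and $\theta_1,\dots,\theta_T\in[\pi/3,2\pi/3]$. Let $S_T(\theta)$ be the infinite vertical strip tiled, edge to edge, by $T$ vertical columns of rhombi of side length $1$ with vertical left and right sides, all rhombi of the $k$-th column from the left having upper-left angle $\theta_k$; it is embedded so that the origin is the midpoint of a vertical edge of the left boundary line. A self-avoiding walk in $S_T(\theta)$ is a simple curve that starts and ends at midpoints of edges, crosses edges only at their midpoints and at right angles (passing from one rhombus into the adjacent one), and meets each rhombus in one of the following ways: not at all; in one arc joining the midpoints of two adjacent sides; in one straight segment joining the midpoints of two opposite sides; or in two disjoint arcs around two opposite corners. (The curve consisting of a single midpoint is allowed.) A rhombus with upper-left angle $\theta$ contributes to the weight of the walk the factor $1$ if it is not traversed, $u_1(\theta)$ (resp. $u_2(\theta)$) for one arc around a corner of angle $\theta$ (resp. a corner of angle $\pi-\theta$; for $\theta=\pi/2$, the upper-left and lower-right corners count as the corners of angle $\theta$ and the other two as those of angle $\pi-\theta$), $v(\theta)$ for one straight segment, and $w_1(\theta)$ (resp. $w_2(\theta)$) for two arcs around the two corners of angle $\theta$ (resp. $\pi-\theta$), where, with $s=\tfrac{3\theta}{8}$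 and $d=\sin(\tfrac{5\pi}{4}+s)\,\sin(\tfrac{5\pi}{8}-s)$, $$u_1=\frac{\sin\frac{5\pi}{4}\,\sin(\frac{5\pi}{8}+s)}{d},\quad u_2=\frac{\sin\frac{5\pi}{4}\,\sin s}{d},\quad v=\frac{\sin(\frac{5\pi}{8}+s)\,\sin(-s)}{d},$$ $$w_1=\frac{\sin(\frac{5\pi}{8}+s)\,\sin(\frac{5\pi}{4}-s)}{d},\quad w_2=\frac{\sin(\frac{15\pi}{8}+s)\,\sin(-s)}{d}.$$ The weight $\mathrm w_\theta(\gamma)$ of a walk $\gamma$ is the product of these factors over all rhombi, and the 2-point function is $G_{S_T(\theta)}(a,b)=\sum_{\gamma:a\to b}\mathrm w_\theta(\gamma)$, the sum running over all self-avoiding walks in $S_T(\theta)$ from $a$ to $b$. Then for all midpoints $a,b$ of edges of the boundary of $S_T(\theta)$ (on the left or on the right), the 2-point function does not depend on the order of the angles: for every permutation $\sigma$ of $\{1,\dots,T\}$, the strips $S_T(\theta)$ and $S_T(\theta\circ\sigma)$ have the same boundary midpoints, the sums $G_{S_T(\theta)}(a,b)$ and $G_{S_T(\theta\circ\sigma)}(a,b)$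 are finite, and $$G_{S_T(\theta\circ\sigma)}(a,b)=G_{S_T(\theta)}(a,b).$$ -/

import Mathlib

open scoped Real

noncomputable section

namespace RhombicSAW

/-! ### The strip of rhombi

The strip consists of `T` columns, numbered from the left by `Fin T`; the rows are numbered
by `ℤ`.  The rhombus in column `k` and row `j` is `(k, j)`. -/

/-- The rhombi of a strip with `T` columns. -/
abbrev Rhombus (T : ℕ) : Type := Fin T × ℤ

/-- Edges of the tiling (equivalently, their midpoints). `vert k j` is the vertical edge in row `j`
on the `k`-th vertical line (so `vert 0 j` and `vert (Fin.last T) j` are the boundary edges);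
`horiz k j` is the bottom side of the rhombus `(k, j)`, which is the top side of `(k, j - 1)`. -/
inductive Edge (T : ℕ) : Type
  | vert (k : Fin (T + 1)) (j : ℤ) : Edge T
  | horiz (k : Fin T) (j : ℤ) : Edge T
  deriving DecidableEq

variable {T : ℕ}

/-- The left side of a rhombus. -/
def west (r : Rhombus T) : Edge T := .vert r.1.castSucc r.2
/-- The right side of a rhombus. -/
def east (r : Rhombus T) : Edge T := .vert r.1.succ r.2
/-- The bottom side of a rhombus. -/
def south (r : Rhombus T) : Edge T := .horiz r.1 r.2
/-- The top side of a rhombus. -/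
def north (r : Rhombus T) : Edge T := .horiz r.1 (r.2 + 1)

/-- The four sides of a rhombus. -/
def sides (r : Rhombus T) : Finset (Edge T) := {west r, north r, east r, south r}

/-! ### The embedding in the plane -/

/-- The unit vector along the top and bottom sides (left to right) of a rhombus whose upper-left
angle is `θ`: it is obtained by rotating the downward vector `-i` by `θ` counterclockwise. -/
def sideVec (θ : ℝ) : ℂ := -Complex.I * Complex.exp (θ * Complex.I)

/-- The midpoint of the edge in row `0` of the `k`-th vertical line, the midpoint of the edge in
row `0` of the left boundary being the origin. -/
def lineOrigin (θ : Fin T → ℝ) (k : Fin (T + 1)) : ℂ :=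
  ∑ l : Fin T with l.castSucc < k, sideVec (θ l)

/-- The midpoint, in the plane, of an edge of the strip with column angles `θ`. -/
def midpt (θ : Fin T → ℝ) : Edge T → ℂ
  | .vert k j => lineOrigin θ k + j * Complex.I
  | .horiz k j => lineOrigin θ k.castSucc + sideVec (θ k) / 2 + (j - 1 / 2) * Complex.I

/-- The midpoints of the boundary edges (on the left and on the right) of the strip. -/
def boundaryPoints (θ : Fin T → ℝ) : Set ℂ :=
  {z | ∃ j : ℤ, z = midpt θ (.vert 0 j) ∨ z = midpt θ (.vert (Fin.last T) j)}

/-! ### Self-avoiding walks -/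

/-- The walk, given by its list of successive mid-edges, goes from `e` to `f` or from `f` to `e`
in one step. -/
def Joins (γ : List (Edge T)) (e f : Edge T) : Prop := [e, f] <:+: γ ∨ [f, e] <:+: γ

/-- `γ` is the list of successive mid-edges of a self-avoiding walk in the strip. The walk goes
straight or along an arc from a side of a rhombus to another side of the same rhombus, passes
through each mid-edge at most once, enters a new rhombus whenever it crosses an edge, and does not
cross itself inside a rhombus. -/
structure IsSAW (γ : List (Edge T)) : Prop where
  ne_nil : γ ≠ []
  nodup : γ.Nodup
  step : γ.IsChain (fun e f => ∃ r : Rhombus T, e ∈ sides r ∧ f ∈ sides r)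
  crosses : ∀ (r : Rhombus T) (e f g : Edge T), [e, f, g] <:+: γ →
    ¬ (e ∈ sides r ∧ f ∈ sides r ∧ g ∈ sides r)
  noncrossing : ∀ r : Rhombus T, ¬ (Joins γ (west r) (east r) ∧ Joins γ (south r) (north r))

/-! ### Weights -/

/-- The common denominator of the weights. -/
def den (θ : ℝ) : ℝ := Real.sin (5 * π / 4 + 3 * θ / 8) * Real.sin (5 * π / 8 - 3 * θ / 8)

/-- One arc, around a corner of angle `θ`. -/
def u₁ (θ : ℝ) : ℝ := Real.sin (5 * π / 4) * Real.sin (5 * π / 8 + 3 * θ / 8) / den θ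
/-- One arc, around a corner of angle `π - θ`. -/
def u₂ (θ : ℝ) : ℝ := Real.sin (5 * π / 4) * Real.sin (3 * θ / 8) / den θ
/-- One straight segment, between opposite sides. -/
def v (θ : ℝ) : ℝ := Real.sin (5 * π / 8 + 3 * θ / 8) * Real.sin (-(3 * θ / 8)) / den θ
/-- Two arcs, around the two corners of angle `θ`. -/
def w₁ (θ : ℝ) : ℝ :=
  Real.sin (5 * π / 8 + 3 * θ / 8) * Real.sin (5 * π / 4 - 3 * θ / 8) / den θ
/-- Two arcs, around the two corners of angle `π - θ`. -/
def w₂ (θ : ℝ) : ℝ := Real.sin (15 * π / 8 + 3 * θ / 8) * Real.sin (-(3 * θ / 8)) / den θ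

open Classical in
/-- The weight that the walk `γ` gets from the rhombus `r` of upper-left (and lower-right)
angle `θ`. -/
def localWeight (θ : ℝ) (γ : List (Edge T)) (r : Rhombus T) : ℝ :=
  if Joins γ (west r) (north r) ∧ Joins γ (south r) (east r) then w₁ θ
  else if Joins γ (west r) (south r) ∧ Joins γ (north r) (east r) then w₂ θ
  else if Joins γ (west r) (north r) ∨ Joins γ (south r) (east r) then u₁ θ
  else if Joins γ (west r) (south r) ∨ Joins γ (north r) (east r) then u₂ θ
  else if Joins γ (west r) (east r) ∨ Joins γ (south r) (north r) then v θ
  else 1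

/-- The weight of a walk: the product over all rhombi of the local weights, of which only finitely
many differ from `1` (see `finite_mulSupport`). -/
def weight (θ : Fin T → ℝ) (γ : List (Edge T)) : ℝ :=
  ∏ᶠ r : Rhombus T, localWeight (θ r.1) γ r

/-- The self-avoiding walks from the point `a` to the point `b` in the strip with column
angles `θ`. -/
def walks (θ : Fin T → ℝ) (a b : ℂ) : Set (List (Edge T)) :=
  {γ | IsSAW γ ∧ (∃ e, γ.head? = some e ∧ midpt θ e = a) ∧
    ∃ f, γ.getLast? = some f ∧ midpt θ f = b}

/-- The 2-point function of the strip with column angles `θ`. -/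
def twoPoint (θ : Fin T → ℝ) (a b : ℂ) : ℝ := ∑' γ : walks θ a b, weight θ γ.1

theorem Joins.mem_left {γ : List (Edge T)} {e f : Edge T} (h : Joins γ e f) : e ∈ γ := by
  rcases h with h | h <;> exact h.subset (by simp)

theorem Joins.mem_right {γ : List (Edge T)} {e f : Edge T} (h : Joins γ e f) : f ∈ γ := by
  rcases h with h | h <;> exact h.subset (by simp)

theorem finite_mulSupport (θ : Fin T → ℝ) (γ : List (Edge T)) :
    (Function.mulSupport fun r : Rhombus T => localWeight (θ r.1) γ r).Finite := by
  have hW : Function.Injective (west : Rhombus T → Edge T) := by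
    rintro ⟨k, j⟩ ⟨k', j'⟩ h
    simpa [west] using h
  have hN : Function.Injective (north : Rhombus T → Edge T) := by
    rintro ⟨k, j⟩ ⟨k', j'⟩ h
    simpa [north] using h
  have hE : Function.Injective (east : Rhombus T → Edge T) := by
    rintro ⟨k, j⟩ ⟨k', j'⟩ h
    simpa [east] using h
  have hfin : {e : Edge T | e ∈ γ}.Finite := γ.finite_toSet
  refine (((hfin.preimage hW.injOn).union (hfin.preimage hN.injOn)).union
    (hfin.preimage hE.injOn)).subset ?_
  intro r hr
  by_contra hc
  simp only [Set.mem_union, Set.mem_preimage, Set.mem_ofPred_eq, not_or] at hc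
  obtain ⟨⟨h1, h2⟩, h3⟩ := hc
  have a1 : ∀ f, ¬ Joins γ (west r) f := fun f h => h1 h.mem_left
  have a2 : ∀ f, ¬ Joins γ (north r) f := fun f h => h2 h.mem_left
  have a3 : ∀ f, ¬ Joins γ f (north r) := fun f h => h2 h.mem_right
  have a4 : ∀ f, ¬ Joins γ f (east r) := fun f h => h3 h.mem_right
  exact hr (by simp [localWeight, a1, a2, a3, a4])

end RhombicSAW

end

/-!
The 2-point function is the limit, as `M` grows, of the partition functions `Z_M` of the walks in the rows
`-M, …, M - 1`, which increase with `M` because the weights are nonnegative. Hence it suffices to bound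
`Z_M` and to show that exchanging the angles of two adjacent columns does not change the limit.

Exchange of columns. A finite arrangement of rhombi has a partition function `partFun`: a sum over the
states of all rhombi, in which only those configurations count whose steps form exactly one walk from `a`
to `b` (`IsPath`). The weights have loop weight zero, and satisfy the Yang-Baxter equation
(`hexTable_sum`): three rhombi of angles `α`, `β`, `β - α` that form a hexagon can be replaced by those of
the hexagon turned by half a turn (`partFun_hexagon`). A rhombus of angle `β - α`, where `α` and `β` are the
angles of the two columns, is inserted between two rows and pushed from the bottom to the top of the
rectangle (`pushPartFun_succ`); below it the columns are in one order, above it in the other one. When the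
rhombus is at the top, two of its sides are dead ends, so it is not visited, or visited by one arc, which
joins the top sides of the two columns; similarly at the bottom. Thus the two values of `Z_M` differ by
`u₂ (β - α)` times the difference of two partition functions with one additional arc
(`rowsPartFun_swap`). That arc can be replaced by two arcs in the next row, so that the correction is at
most a constant times `Z_{M+1} - Z_M`, and it vanishes in the limit if `Z_M` is bounded
(`limit_rowsPartFun_swap`). The angle `β - α` need not lie in `[π/3, 2π/3]`; only `den (β - α) ≠ 0` is
used for it.

Boundedness. To a walk `γ` from the left boundary, with final heading `d`, the observable attaches the
complex number `obs θ γ`: the weight of `γ` times `exp (3iω/8)`, where `ω` is the total turning of `γ`. The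
sum of `obs` over the walks that are about to enter a given rhombus equals the sum over their continuations
by one step through that rhombus (`sum_obs_sub_contSum`). A walk that meets the rhombus for the first time
balances its three continuations (`arc_identity`). A walk that comes back to the rhombus has made a loop,
and is paired with the walk that follows the loop in the opposite direction (`Loop.obs_add`); a third visit
is impossible. Summing over all rhombi of the rectangle, the walks that leave it have total observable `1`
(`sum_obs_exits`). As these walks have turned by `0` on the right, by `±π` on the left, and by the angle
that a simple curve must have on the top and bottom sides, all their phases have real part at least
`cos (3π/8) > 0`, which bounds `Z_M`. The case of two points on the right follows by a half-turn of the
strip.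

The topological input is the value of the turning of a simple curve that comes back to a rhombus, or
reaches the boundary. It is obtained by counting crossings: for a walk on the square lattice which turns by
at most a right angle at each step and does not meet or cross itself, the integer heading (which counts
quarter-turns without reduction modulo 4) is determined by the signed number of crossings of the walk with
the horizontal half-line to the left of its end (`DartWalk.level_eq_zero`). This is proved by induction on
the length, from the conservation of the flux of the walk through the four sides of a rhombus.
-/

open scoped Real

noncomputable section

namespace RhombicSAW

variable {T : ℕ}

/-! ### Consecutive vertices of a list -/

theorem pair_infix_cons {α : Type*} (x : α) (l : List α) (e f : α) :
    [e, f] <:+: x :: l ↔ (x = e ∧ l.head? = some f) ∨ [e, f] <:+: l := by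
  rw [List.infix_cons_iff]
  cases l with
  | nil => simp
  | cons y l => simp [eq_comm]

theorem pair_infix_append {α : Type*} (l₁ l₂ : List α) (e f : α) :
    [e, f] <:+: l₁ ++ l₂ ↔ [e, f] <:+: l₁ ∨ [e, f] <:+: l₂ ∨
      (l₁.getLast? = some e ∧ l₂.head? = some f) := by
  induction l₁ with
  | nil => simp
  | cons x l ih =>
    rw [List.cons_append, pair_infix_cons, pair_infix_cons, ih]
    cases l with
    | nil => simp; tauto
    | cons y l => simp [List.getLast?_cons_cons]; tauto

theorem Joins.symm {γ : List (Edge T)} {e f : Edge T} (h : Joins γ e f) : Joins γ f e := h.elim .inr .inl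

theorem joins_comm {γ : List (Edge T)} {e f : Edge T} : Joins γ e f ↔ Joins γ f e :=
  ⟨Joins.symm, Joins.symm⟩

@[simp] theorem not_joins_nil (e f : Edge T) : ¬ Joins [] e f := by
  simp [Joins]

@[simp] theorem not_joins_singleton (x e f : Edge T) : ¬ Joins [x] e f := by
  simp [Joins, pair_infix_cons]

theorem joins_cons_cons (x y : Edge T) (l : List (Edge T)) (e f : Edge T) :
    Joins (x :: y :: l) e f ↔ (e = x ∧ f = y ∨ e = y ∧ f = x) ∨ Joins (y :: l) e f := by
  unfold Joins
  rw [pair_infix_cons x, pair_infix_cons x]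
  simp only [List.head?_cons, Option.some.injEq]
  constructor
  · rintro ((⟨rfl, rfl⟩ | h) | (⟨rfl, rfl⟩ | h)) <;> tauto
  · rintro ((⟨rfl, rfl⟩ | ⟨rfl, rfl⟩) | (h | h)) <;> tauto

/-- The steps of a list, cut at one of its vertices. -/
theorem joins_append_cons (l₁ : List (Edge T)) (x : Edge T) (l₂ : List (Edge T)) (e f : Edge T) :
    Joins (l₁ ++ x :: l₂) e f ↔ Joins (l₁ ++ [x]) e f ∨ Joins (x :: l₂) e f := by
  induction l₁ with
  | nil => simp
  | cons y l ih =>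
    cases l with
    | nil => simp [joins_cons_cons]
    | cons z l =>
      simp only [List.cons_append, joins_cons_cons] at ih ⊢
      rw [ih]; tauto

theorem joins_reverse (γ : List (Edge T)) (e f : Edge T) : Joins γ.reverse e f ↔ Joins γ e f := by
  have h : ∀ e f : Edge T, [e, f] <:+: γ.reverse ↔ [f, e] <:+: γ := fun e f => by
    rw [← List.reverse_infix]; simp
  simp [Joins, h, or_comm]

theorem joins_map {T' : ℕ} {μ : Edge T → Edge T'} (hμ : μ.Injective) (γ : List (Edge T)) (e f : Edge T) :
    Joins (γ.map μ) (μ e) (μ f) ↔ Joins γ e f := by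
  induction γ with
  | nil => simp
  | cons x l ih =>
    cases l with
    | nil => simp
    | cons y l =>
      simp only [List.map_cons, joins_cons_cons, hμ.eq_iff] at ih ⊢
      rw [ih]

theorem joins_append_left {l₁ : List (Edge T)} (l₂ : List (Edge T)) {e f : Edge T} (h : Joins l₁ e f) :
    Joins (l₁ ++ l₂) e f := by
  rcases h with h | h
  · exact .inl (h.trans (List.prefix_append _ _).isInfix)
  · exact .inr (h.trans (List.prefix_append _ _).isInfix)

/-- A vertex occurring in a list of pairwise distinct vertices follows or precedes its neighbours. -/
theorem joins_mid_iff {l₁ l₂ : List (Edge T)} {x v y : Edge T} (h : (l₁ ++ x :: v :: y :: l₂).Nodup)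
    (w : Edge T) : Joins (l₁ ++ x :: v :: y :: l₂) v w ↔ w = x ∨ w = y := by
  have h1 : ¬ Joins (l₁ ++ [x]) v w := fun hj => by
    have := hj.mem_left
    simp [List.nodup_append] at h this
    grind
  have h2 : ¬ Joins (y :: l₂) v w := fun hj => by
    have := hj.mem_left
    simp [List.nodup_append] at h this
    grind
  have hxv : v ≠ x := by simp [List.nodup_append] at h; grind
  have hyv : v ≠ y := by simp [List.nodup_append] at h; grind
  rw [joins_append_cons, joins_cons_cons, joins_cons_cons]
  simp only [h1, h2, hxv, hyv]; simp

theorem exists_mid_of_mem {γ : List (Edge T)} {a b v : Edge T} (ha : γ.head? = some a)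
    (hb : γ.getLast? = some b) (hv : v ∈ γ) (hva : v ≠ a) (hvb : v ≠ b) :
    ∃ l₁ x y l₂, γ = l₁ ++ x :: v :: y :: l₂ := by
  obtain ⟨s, t, rfl⟩ := List.append_of_mem hv
  rcases List.eq_nil_or_concat s with rfl | ⟨s, x, rfl⟩
  · simp at ha; exact absurd ha hva
  · cases t with
    | nil => simp at hb; exact absurd hb hvb
    | cons y t => exact ⟨s, x, y, t, by simp⟩

theorem Joins.exists_split {γ : List (Edge T)} {x y : Edge T} (h : Joins γ x y) :
    (∃ l₁ l₂, γ = l₁ ++ x :: y :: l₂) ∨ ∃ l₁ l₂, γ = l₁ ++ y :: x :: l₂ := by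
  rcases h with ⟨s, t, h⟩ | ⟨s, t, h⟩
  · exact .inl ⟨s, t, by simp [← h]⟩
  · exact .inr ⟨s, t, by simp [← h]⟩

theorem Joins.ne {γ : List (Edge T)} (hγ : γ.Nodup) {x y : Edge T} (h : Joins γ x y) : x ≠ y := by
  rcases h.exists_split with ⟨l₁, l₂, rfl⟩ | ⟨l₁, l₂, rfl⟩ <;>
  · rintro rfl; simp [List.nodup_append] at hγ

/-- Removing a vertex from the inside of a walk. -/
theorem joins_remove {l₁ l₂ : List (Edge T)} {x v y : Edge T} (h : (l₁ ++ x :: v :: y :: l₂).Nodup)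
    (e f : Edge T) :
    Joins (l₁ ++ x :: y :: l₂) e f ↔
      (e = x ∧ f = y ∨ e = y ∧ f = x) ∨
        (Joins (l₁ ++ x :: v :: y :: l₂) e f ∧ e ≠ v ∧ f ≠ v) := by
  have h1 : ∀ w, ¬ Joins (l₁ ++ [x]) v w := fun w hj => by
    have := hj.mem_left
    simp [List.nodup_append] at h this
    grind
  have h2 : ∀ w, ¬ Joins (y :: l₂) v w := fun w hj => by
    have := hj.mem_left
    simp [List.nodup_append] at h this
    grind
  have h3 : ∀ w, ¬ Joins (l₁ ++ [x]) w v := fun w hj => h1 w hj.symm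
  have h4 : ∀ w, ¬ Joins (y :: l₂) w v := fun w hj => h2 w hj.symm
  rw [joins_append_cons l₁ x (y :: l₂), joins_cons_cons, joins_append_cons l₁ x (v :: y :: l₂),
    joins_cons_cons, joins_cons_cons]
  by_cases he : e = v
  · subst he
    have hxv : e ≠ x := by simp [List.nodup_append] at h; grind
    have hyv : e ≠ y := by simp [List.nodup_append] at h; grind
    simp [h1, h2, hxv, hyv]
  by_cases hf : f = v
  · subst hf
    have hxv : f ≠ x := by simp [List.nodup_append] at h; grind
    have hyv : f ≠ y := by simp [List.nodup_append] at h; grind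
    simp [h3, h4, hxv, hyv]
  simp [he, hf]; tauto

/-! ### Relations that are the steps of a walk -/

/-- The relation `R` consists of the steps of a walk from `a` to `b`, with pairwise distinct
vertices. -/
def IsPath (a b : Edge T) (R : Edge T → Edge T → Prop) : Prop :=
  ∃ γ : List (Edge T), γ.Nodup ∧ γ.head? = some a ∧ γ.getLast? = some b ∧
    ∀ e f, Joins γ e f ↔ R e f

theorem IsPath.congr {a b : Edge T} {R S : Edge T → Edge T → Prop} (h : ∀ e f, R e f ↔ S e f) :
    IsPath a b R ↔ IsPath a b S := by
  have : R = S := by ext; exact h _ _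
  rw [this]

theorem IsPath.map {T' : ℕ} (μ : Edge T ≃ Edge T') {a b : Edge T} {R : Edge T' → Edge T' → Prop}
    (h : IsPath a b fun e f => R (μ e) (μ f)) : IsPath (μ a) (μ b) R := by
  obtain ⟨γ, h1, h2, h3, h4⟩ := h
  refine ⟨γ.map μ, h1.map μ.injective, by simp [h2], by simp [h3], fun e f => ?_⟩
  obtain ⟨e, rfl⟩ := μ.surjective e
  obtain ⟨f, rfl⟩ := μ.surjective f
  rw [joins_map μ.injective, h4]

theorem isPath_map {T' : ℕ} (μ : Edge T ≃ Edge T') {a b : Edge T} {R : Edge T' → Edge T' → Prop} :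
    IsPath (μ a) (μ b) R ↔ IsPath a b fun e f => R (μ e) (μ f) := by
  refine ⟨fun h => ?_, fun h => h.map μ⟩
  have := IsPath.map μ.symm (a := μ a) (b := μ b) (R := fun e f => R (μ e) (μ f)) (by simpa using h)
  simpa using this

theorem IsPath.irrefl {a b : Edge T} {R : Edge T → Edge T → Prop} (h : IsPath a b R) {x y : Edge T}
    (hxy : R x y) : x ≠ y := by
  obtain ⟨γ, h1, h2, h3, h4⟩ := h
  exact ((h4 _ _).2 hxy).ne h1

/-- An inner vertex of a walk has exactly two neighbours, which are not neighbours of each other. -/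
theorem IsPath.neighbours {a b : Edge T} {R : Edge T → Edge T → Prop} (h : IsPath a b R) {v w : Edge T}
    (hv : R v w) (hva : v ≠ a) (hvb : v ≠ b) :
    ∃ x y, x ≠ y ∧ (∀ z, R v z ↔ z = x ∨ z = y) ∧ ¬ R x y := by
  obtain ⟨γ, h1, h2, h3, h4⟩ := h
  obtain ⟨l₁, x, y, l₂, rfl⟩ := exists_mid_of_mem h2 h3 ((h4 _ _).2 hv).mem_left hva hvb
  refine ⟨x, y, ?_, fun z => by rw [← h4, joins_mid_iff h1], ?_⟩
  · rintro rfl; simp [List.nodup_append] at h1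
  rw [← h4, joins_append_cons, joins_cons_cons, joins_cons_cons]
  have e1 : ¬ Joins (l₁ ++ [x]) x y := fun hj => by
    have := hj.mem_right
    simp [List.nodup_append] at h1 this
    grind
  have e2 : ¬ Joins (y :: l₂) x y := fun hj => by
    have := hj.mem_left
    simp [List.nodup_append] at h1 this
    grind
  simp [List.nodup_append] at h1
  simp only [e1, e2]
  grind

/-- Contracting a vertex inside a walk. -/
theorem isPath_contract {a b v x y : Edge T} {R : Edge T → Edge T → Prop}
    (hva : v ≠ a) (hvb : v ≠ b) (hR : ∀ z, ¬ R v z) (hR' : ∀ z, ¬ R z v) (hxy : x ≠ y)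
    (hxv : x ≠ v) (hyv : y ≠ v) (h1 : ¬ R x y) (h2 : ¬ R y x) :
    IsPath a b (fun e f => ((e = v ∧ f = x ∨ e = x ∧ f = v) ∨ (e = v ∧ f = y ∨ e = y ∧ f = v)) ∨ R e f) ↔
      IsPath a b (fun e f => (e = x ∧ f = y ∨ e = y ∧ f = x) ∨ R e f) := by
  constructor
  · rintro ⟨γ, hn, ha, hb, hj⟩
    have hv : v ∈ γ := ((hj v x).2 (by simp)).mem_left
    obtain ⟨l₁, x', y', l₂, rfl⟩ := exists_mid_of_mem ha hb hv hva hvb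
    have hm := fun w => joins_mid_iff hn w
    have hx : x = x' ∨ x = y' := (hm x).1 ((hj v x).2 (by simp))
    have hy : y = x' ∨ y = y' := (hm y).1 ((hj v y).2 (by simp))
    refine ⟨l₁ ++ x' :: y' :: l₂, ?_, ?_, ?_, fun e f => ?_⟩
    · simp [List.nodup_append] at hn ⊢; grind
    · cases l₁ <;> simpa using ha
    · simpa [List.getLast?_append, List.getLast?_cons_cons] using hb
    · rw [joins_remove hn, hj]
      have h3 := hR e; have h4 := hR f; have h5 := hR' e; have h6 := hR' f
      grind
  · rintro ⟨γ, hn, ha, hb, hj⟩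
    have hv : v ∉ γ := by
      intro hv
      obtain ⟨l₁, x', y', l₂, rfl⟩ := exists_mid_of_mem ha hb hv hva hvb
      have := (hj v x').1 ((joins_mid_iff hn _).2 (.inl rfl))
      have := hR x'
      grind
    obtain ⟨x', y', hxy', l₁, l₂, rfl⟩ : ∃ x' y', (x' = x ∧ y' = y ∨ x' = y ∧ y' = x) ∧
        ∃ l₁ l₂, γ = l₁ ++ x' :: y' :: l₂ := by
      rcases ((hj x y).2 (by simp)).exists_split with ⟨l₁, l₂, h⟩ | ⟨l₁, l₂, h⟩
      · exact ⟨x, y, by simp, l₁, l₂, h⟩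
      · exact ⟨y, x, by simp, l₁, l₂, h⟩
    have hn' : (l₁ ++ x' :: v :: y' :: l₂).Nodup := by
      simp [List.nodup_append] at hn hv ⊢; grind
    refine ⟨l₁ ++ x' :: v :: y' :: l₂, hn', ?_, ?_, fun e f => ?_⟩
    · cases l₁ <;> simpa using ha
    · simpa [List.getLast?_append, List.getLast?_cons_cons] using hb
    · have hrem := joins_remove hn' e f
      rw [hj] at hrem
      have hm := joins_mid_iff hn'
      by_cases he : e = v
      · subst he; rw [hm f]; have := hR f; grind
      by_cases hf : f = v
      · subst hf; rw [joins_comm, hm e]; have := hR' e; grind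
      have h5 : ¬ Joins (l₁ ++ x' :: v :: y' :: l₂) x' y' := by
        rw [joins_append_cons, joins_cons_cons, joins_cons_cons]
        have e1 : ¬ Joins (l₁ ++ [x']) x' y' := fun hj => by
          have := hj.mem_right
          simp [List.nodup_append] at hn this
          grind
        have e2 : ¬ Joins (y' :: l₂) x' y' := fun hj => by
          have := hj.mem_left
          simp [List.nodup_append] at hn this
          grind
        simp only [e1, e2]
        grind
      have h6 := fun h => h5 (joins_comm.1 h)
      simp only [he, hf, ne_eq, not_false_eq_true, and_true, false_and, and_false, or_false, false_or] at hrem ⊢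
      grind

/-! ### Partition functions of general arrangements of rhombi -/

/-- The ways in which a walk can meet a rhombus. The letters are the sides that are joined: `wn` is
the arc from west to north, `wnse` the pair of arcs from west to north and from south to east. -/
inductive RState : Type
  | O | wn | se | ws | ne | we | sn | wnse | wsne
  deriving DecidableEq

instance : Fintype RState :=
  ⟨{.O, .wn, .se, .ws, .ne, .we, .sn, .wnse, .wsne}, fun s => by cases s <;> decide⟩

/-- The pairs of sides that are joined, where the sides west, north, east, south are numbered
`0, 1, 2, 3`. -/
def RState.pairs : RState → List (Fin 4 × Fin 4)
  | .O => []
  | .wn => [(0, 1)]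
  | .se => [(3, 2)]
  | .ws => [(0, 3)]
  | .ne => [(1, 2)]
  | .we => [(0, 2)]
  | .sn => [(3, 1)]
  | .wnse => [(0, 1), (3, 2)]
  | .wsne => [(0, 3), (1, 2)]

/-- The effect on the states of a rotation of the rhombus by a half-turn. -/
def RState.rot : RState → RState
  | .O => .O
  | .wn => .se
  | .se => .wn
  | .ws => .ne
  | .ne => .ws
  | .we => .we
  | .sn => .sn
  | .wnse => .wnse
  | .wsne => .wsne

theorem RState.rot_rot (s : RState) : s.rot.rot = s := by cases s <;> rfl

/-- The rotation of states as a permutation. -/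
def RState.rotEquiv : RState ≃ RState := ⟨RState.rot, RState.rot, RState.rot_rot, RState.rot_rot⟩

/-- The weight of a state of a rhombus of upper-left angle `θ`. -/
def RState.wt (θ : ℝ) : RState → ℝ
  | .O => 1
  | .wn => u₁ θ
  | .se => u₁ θ
  | .ws => u₂ θ
  | .ne => u₂ θ
  | .we => v θ
  | .sn => v θ
  | .wnse => w₁ θ
  | .wsne => w₂ θ

theorem RState.wt_rot (θ : ℝ) (s : RState) : s.rot.wt θ = s.wt θ := by cases s <;> rfl

/-- The steps made by the states `c` of rhombi `i : ι` whose sides are `side i`. -/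
def stepRel {ι : Type*} (side : ι → Fin 4 → Edge T) (c : ι → RState) (e f : Edge T) : Prop :=
  ∃ i, ∃ p ∈ (c i).pairs, e = side i p.1 ∧ f = side i p.2 ∨ e = side i p.2 ∧ f = side i p.1

open Classical in
/-- The indicator of `IsPath a b R`. -/
def pathInd (a b : Edge T) (R : Edge T → Edge T → Prop) : ℝ := if IsPath a b R then 1 else 0

theorem pathInd_congr {T' : ℕ} {a b : Edge T} {R : Edge T → Edge T → Prop} {a' b' : Edge T'}
    {R' : Edge T' → Edge T' → Prop} (h : IsPath a b R ↔ IsPath a' b' R') :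
    pathInd a b R = pathInd a' b' R' := by
  unfold pathInd; by_cases h' : IsPath a b R
  · rw [if_pos h', if_pos (h.1 h')]
  · rw [if_neg h', if_neg (h'.imp h.2)]

theorem pathInd_nonneg (a b : Edge T) (R : Edge T → Edge T → Prop) : 0 ≤ pathInd a b R := by
  unfold pathInd; split_ifs <;> norm_num

instance instFintypeStates {ι : Type*} [Fintype ι] : Fintype (ι → RState) := by
  classical exact inferInstance

/-- The partition function of the walks from `a` to `b` in an arrangement of finitely many rhombi
`i : ι` with sides `side i`, the states of which have the weights `wt i`. -/
def partFun {ι : Type*} [Fintype ι] (side : ι → Fin 4 → Edge T) (wt : ι → RState → ℝ)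
    (a b : Edge T) : ℝ :=
  ∑ c : ι → RState, (∏ i, wt i (c i)) * pathInd a b (stepRel side c)

section
variable {ι κ l : Type*} [Fintype ι] [Fintype κ] [Fintype l]

theorem partFun_relabel {T' : ℕ} (μ : Edge T ≃ Edge T') (side : ι → Fin 4 → Edge T)
    (wt : ι → RState → ℝ) (a b : Edge T) :
    partFun (fun i s => μ (side i s)) wt (μ a) (μ b) = partFun side wt a b := by
  unfold partFun
  refine Finset.sum_congr rfl fun c _ => ?_
  rw [pathInd_congr (isPath_map μ)]
  simp only [stepRel, μ.injective.eq_iff]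
  rfl

theorem partFun_reindex (φ : ι ≃ κ) (side : κ → Fin 4 → Edge T) (wt : κ → RState → ℝ)
    (a b : Edge T) : partFun (fun i => side (φ i)) (fun i => wt (φ i)) a b = partFun side wt a b := by
  classical
  unfold partFun
  refine Fintype.sum_equiv (φ.arrowCongr (Equiv.refl _)) _ _ fun c => ?_
  congr 1
  · refine Fintype.prod_equiv φ _ _ fun i => ?_
    simp [Equiv.arrowCongr]
  · refine pathInd_congr (IsPath.congr fun e f => ?_)
    simp [stepRel, Equiv.arrowCongr, φ.surjective.exists]

theorem mem_pairs_rot (s : RState) (f : Fin 4 → Edge T) (x y : Edge T) :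
    (∃ p ∈ s.rot.pairs, x = f p.1 ∧ y = f p.2 ∨ x = f p.2 ∧ y = f p.1) ↔
      ∃ p ∈ s.pairs, x = f (p.1 + 2) ∧ y = f (p.2 + 2) ∨ x = f (p.2 + 2) ∧ y = f (p.1 + 2) := by
  cases s <;> simp [RState.pairs, RState.rot] <;> grind

/-- Rhombi whose weights are invariant under a half-turn can be turned. -/
theorem partFun_rot (side : ι → Fin 4 → Edge T) (wt : ι → RState → ℝ)
    (hwt : ∀ i s, wt i (RState.rot s) = wt i s) (a b : Edge T) :
    partFun (fun i s => side i (s + 2)) wt a b = partFun side wt a b := by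
  classical
  unfold partFun
  refine Fintype.sum_equiv ((Equiv.refl ι).arrowCongr RState.rotEquiv) _ _ fun c => ?_
  congr 1
  · exact Finset.prod_congr rfl fun i _ => (hwt i _).symm
  · refine pathInd_congr (IsPath.congr fun e f => ?_)
    unfold stepRel
    refine exists_congr fun i => ?_
    exact (mem_pairs_rot (c i) (side i) e f).symm

theorem partFun_sum (side : κ ⊕ l → Fin 4 → Edge T) (wt : κ ⊕ l → RState → ℝ) (a b : Edge T) :
    partFun side wt a b = ∑ c : κ → RState, (∏ i, wt (.inl i) (c i)) *
      ∑ d : l → RState, (∏ i, wt (.inr i) (d i)) *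
        pathInd a b (fun e f => stepRel (fun i => side (.inr i)) d e f ∨
          stepRel (fun i => side (.inl i)) c e f) := by
  unfold partFun
  simp_rw [Finset.mul_sum]
  rw [← Fintype.sum_prod_type']
  refine Fintype.sum_equiv (Equiv.sumArrowEquivProdArrow κ l RState) _ _ fun c => ?_
  rw [Fintype.prod_sum_type, mul_assoc]
  congr 2
  refine pathInd_congr (IsPath.congr fun e f => ?_)
  simp [stepRel, or_comm]

end

/-! ### The Yang-Baxter identities for the weights -/

/-- The weights of the states, multiplied by their common denominator and by a constant, written in
terms of a primitive 16th root of unity `k` and of `z = exp (3iθ/8)`. -/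
def RState.num (k z : ℂ) : RState → ℂ
  | .O => (k ^ 4 * z ^ 2 - 1) * (k ^ 6 * z ^ 2 - 1)
  | .wn => z * (k ^ 4 - 1) * (k ^ 6 - z ^ 2)
  | .se => z * (k ^ 4 - 1) * (k ^ 6 - z ^ 2)
  | .ws => z * k ^ 3 * (k ^ 4 - 1) * (z ^ 2 - 1)
  | .ne => z * k ^ 3 * (k ^ 4 - 1) * (z ^ 2 - 1)
  | .we => k ^ 2 * (k ^ 6 - z ^ 2) * (z ^ 2 - 1)
  | .sn => k ^ 2 * (k ^ 6 - z ^ 2) * (z ^ 2 - 1)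
  | .wnse => (k ^ 6 - z ^ 2) * (k ^ 4 - z ^ 2)
  | .wsne => -k ^ 4 * (k ^ 2 - z ^ 2) * (z ^ 2 - 1)

/-- The 16th root of unity `exp (iπ/8)`. -/
def root16 : ℂ := Complex.exp (π / 8 * Complex.I)

theorem root16_pow : root16 ^ 8 = -1 := by
  rw [root16, ← Complex.exp_nat_mul, ← Complex.exp_pi_mul_I]
  congr 1; push_cast; ring

/-- The number `exp (3iθ/8)`. -/
def unitPhase (θ : ℝ) : ℂ := Complex.exp (3 * θ / 8 * Complex.I)

theorem unitPhase_add (θ φ : ℝ) : unitPhase (θ + φ) = unitPhase θ * unitPhase φ := by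
  rw [unitPhase, unitPhase, unitPhase, ← Complex.exp_add]
  congr 1; push_cast; ring

theorem root16_ne : root16 ≠ 0 := Complex.exp_ne_zero _
theorem unitPhase_ne (θ : ℝ) : unitPhase θ ≠ 0 := Complex.exp_ne_zero _

theorem sin_eq_root16 (n : ℕ) (m : ℤ) (θ x : ℝ) (h : x = n * (π / 8) + m * (3 * θ / 8)) :
    (Real.sin x : ℂ) = -(root16 ^ n * unitPhase θ ^ m - (root16 ^ n * unitPhase θ ^ m)⁻¹) * Complex.I / 2 := by
  have e : root16 ^ n * unitPhase θ ^ m = Complex.exp (x * Complex.I) := by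
    rw [root16, unitPhase, ← Complex.exp_nat_mul, ← Complex.exp_int_mul, ← Complex.exp_add, h]
    congr 1; push_cast; ring
  rw [e, Complex.ofReal_sin, Complex.sin, ← Complex.exp_neg, neg_mul]
  ring

/-- The numerators of the weights are, up to the factor `-4 k ^ 13 z ^ 2`, the values of
`RState.num`. -/
theorem sin_mul_sin_eq (n n' : ℕ) (m m' : ℤ) (θ x y : ℝ) (hx : x = n * (π / 8) + m * (3 * θ / 8))
    (hy : y = n' * (π / 8) + m' * (3 * θ / 8)) :
    ((Real.sin x * Real.sin y : ℝ) : ℂ) * (-4 * root16 ^ 13 * unitPhase θ ^ 2) =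
      (root16 ^ n * unitPhase θ ^ m - (root16 ^ n * unitPhase θ ^ m)⁻¹) *
        (root16 ^ n' * unitPhase θ ^ m' - (root16 ^ n' * unitPhase θ ^ m')⁻¹) *
          (root16 ^ 13 * unitPhase θ ^ 2) := by
  rw [Complex.ofReal_mul, sin_eq_root16 n m θ x hx, sin_eq_root16 n' m' θ y hy]
  linear_combination (exp := 1) -(root16 ^ n * unitPhase θ ^ m - (root16 ^ n * unitPhase θ ^ m)⁻¹) *
        (root16 ^ n' * unitPhase θ ^ m' - (root16 ^ n' * unitPhase θ ^ m')⁻¹) *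
          (root16 ^ 13 * unitPhase θ ^ 2) * Complex.I_sq

theorem den_eq (θ : ℝ) : (den θ : ℂ) * (-4 * root16 ^ 13 * unitPhase θ ^ 2) =
    RState.num root16 (unitPhase θ) .O := by
  have hk := root16_pow
  have hk0 := root16_ne
  have hz := unitPhase_ne θ
  rw [den, sin_mul_sin_eq 10 5 1 (-1) θ _ _ (by push_cast; ring) (by push_cast; ring)]
  simp only [RState.num, zpow_one, zpow_neg]
  field_simp
  grind

theorem RState.wt_mul_num (θ : ℝ) (h : den θ ≠ 0) (s : RState) :
    (s.wt θ : ℂ) * RState.num root16 (unitPhase θ) .O = RState.num root16 (unitPhase θ) s := by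
  have hk := root16_pow
  have hk0 := root16_ne
  have hz := unitPhase_ne θ
  have hd : (den θ : ℂ) ≠ 0 := by exact_mod_cast h
  have key : ∀ x y : ℝ, ((x * y / den θ : ℝ) : ℂ) * RState.num root16 (unitPhase θ) .O =
      ((x * y : ℝ) : ℂ) * (-4 * root16 ^ 13 * unitPhase θ ^ 2) := fun x y => by
    rw [← den_eq]; push_cast; field_simp
  have hu₁ : (u₁ θ : ℂ) * RState.num root16 (unitPhase θ) .O = RState.num root16 (unitPhase θ) .wn := by
    rw [u₁, key, sin_mul_sin_eq 10 5 0 1 θ _ _ (by push_cast; ring) (by push_cast; ring)]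
    simp only [RState.num, zpow_one, zpow_zero]
    field_simp
    grind
  have hu₂ : (u₂ θ : ℂ) * RState.num root16 (unitPhase θ) .O = RState.num root16 (unitPhase θ) .ws := by
    rw [u₂, key, sin_mul_sin_eq 10 0 0 1 θ _ _ (by push_cast; ring) (by push_cast; ring)]
    simp only [RState.num, zpow_one, zpow_zero]
    field_simp
    grind
  have hv : (v θ : ℂ) * RState.num root16 (unitPhase θ) .O = RState.num root16 (unitPhase θ) .we := by
    rw [v, key, sin_mul_sin_eq 5 0 1 (-1) θ _ _ (by push_cast; ring) (by push_cast; ring)]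
    simp only [RState.num, zpow_one, zpow_neg]
    field_simp
    grind
  cases s with
  | O => simp [RState.wt]
  | wn => exact hu₁
  | se => exact hu₁
  | ws => exact hu₂
  | ne => exact hu₂
  | we => exact hv
  | sn => exact hv
  | wnse =>
    rw [RState.wt, w₁, key, sin_mul_sin_eq 5 10 1 (-1) θ _ _ (by push_cast; ring) (by push_cast; ring)]
    simp only [RState.num, zpow_one, zpow_neg]
    field_simp
    grind
  | wsne =>
    rw [RState.wt, w₂, key, sin_mul_sin_eq 15 0 1 (-1) θ _ _ (by push_cast; ring) (by push_cast; ring)]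
    simp only [RState.num, zpow_one, zpow_neg]
    field_simp
    grind

/-- The states of three rhombi. -/
abbrev HexState : Type := RState × RState × RState

/-- The total weight of a list of states of three rhombi of angles `α`, `β` and `β - α`. -/
def weightSum (α β : ℝ) (L : List HexState) : ℝ :=
  (L.map fun t => t.1.wt α * t.2.1.wt β * t.2.2.wt (β - α)).sum

/-- The analogue of `weightSum` for the polynomials `RState.num`. -/
def numSum (k z x : ℂ) (L : List HexState) : ℂ :=
  (L.map fun t => t.1.num k z * t.2.1.num k (z * x) * t.2.2.num k x).sum

theorem weightSum_mul (α β : ℝ) (hα : den α ≠ 0) (hβ : den β ≠ 0) (hφ : den (β - α) ≠ 0)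
    (L : List HexState) :
    (weightSum α β L : ℂ) * (RState.num root16 (unitPhase α) .O * RState.num root16 (unitPhase β) .O *
      RState.num root16 (unitPhase (β - α)) .O) =
      numSum root16 (unitPhase α) (unitPhase (β - α)) L := by
  have hz : unitPhase β = unitPhase α * unitPhase (β - α) := by
    rw [← unitPhase_add, add_sub_cancel]
  induction L with
  | nil => simp [weightSum, numSum]
  | cons t L ih =>
    simp only [weightSum, numSum, List.map_cons, List.sum_cons] at ih ⊢
    rw [← ih, ← hz, ← RState.wt_mul_num α hα t.1, ← RState.wt_mul_num β hβ t.2.1,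
      ← RState.wt_mul_num (β - α) hφ t.2.2]
    push_cast
    ring

/-- An identity between weights follows from the corresponding identity between polynomials, modulo
`k ^ 8 + 1`. -/
theorem weightSum_eq {α β : ℝ} (hα : den α ≠ 0) (hβ : den β ≠ 0) (hφ : den (β - α) ≠ 0)
    (L L' : List HexState) (h : ∀ k z x : ℂ, k ^ 8 = -1 → numSum k z x L = numSum k z x L') :
    weightSum α β L = weightSum α β L' := by
  have hne : ∀ θ, den θ ≠ 0 → RState.num root16 (unitPhase θ) .O ≠ 0 := fun θ hθ => by
    rw [← den_eq]
    have := unitPhase_ne θ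
    have := root16_ne
    have : (den θ : ℂ) ≠ 0 := by exact_mod_cast hθ
    simp_all
  have := h root16 (unitPhase α) (unitPhase (β - α)) root16_pow
  rw [← weightSum_mul α β hα hβ hφ, ← weightSum_mul α β hα hβ hφ] at this
  exact_mod_cast mul_right_cancel₀ (mul_ne_zero (mul_ne_zero (hne _ hα) (hne _ hβ)) (hne _ hφ)) this

/-- A list of pairs of sides of a hexagon, made of three rhombi, that are joined inside. -/
abbrev Pairing : Type := List (Fin 9 × Fin 9)

/-- The states of the three rhombi that are consistent along the three inner sides and contain no
closed loop; for each of them, the pairs of sides `0, …, 5` of the hexagon that it joins, and the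
result of a half-turn on these pairs. -/
def hexTable : List (HexState × Pairing × Pairing) :=
  [((.O, .O, .O), [], []), ((.O, .O, .ne), [(4, 5)], [(1, 2)]),
   ((.O, .se, .O), [(2, 3)], [(0, 5)]), ((.O, .se, .ne), [(2, 3), (4, 5)], [(0, 5), (1, 2)]),
   ((.O, .ne, .se), [(3, 4)], [(0, 1)]), ((.O, .ne, .sn), [(3, 5)], [(0, 2)]),
   ((.O, .sn, .se), [(2, 4)], [(1, 5)]), ((.O, .sn, .sn), [(2, 5)], [(2, 5)]),
   ((.wn, .O, .wn), [(0, 5)], [(2, 3)]), ((.wn, .O, .we), [(0, 4)], [(1, 3)]),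
   ((.wn, .se, .wn), [(0, 5), (2, 3)], [(0, 5), (2, 3)]),
   ((.wn, .se, .we), [(0, 4), (2, 3)], [(0, 5), (1, 3)]), ((.wn, .ne, .ws), [(0, 3)], [(0, 3)]),
   ((.wn, .ne, .wnse), [(0, 5), (3, 4)], [(0, 1), (2, 3)]),
   ((.wn, .ne, .wsne), [(0, 3), (4, 5)], [(0, 3), (1, 2)]), ((.wn, .sn, .ws), [(0, 2)], [(3, 5)]),
   ((.wn, .sn, .wnse), [(0, 5), (2, 4)], [(1, 5), (2, 3)]),
   ((.wn, .sn, .wsne), [(0, 2), (4, 5)], [(1, 2), (3, 5)]), ((.se, .wn, .se), [(1, 4)], [(1, 4)]),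
   ((.se, .wn, .sn), [(1, 5)], [(2, 4)]), ((.se, .ws, .O), [(1, 2)], [(4, 5)]),
   ((.se, .ws, .ne), [(1, 2), (4, 5)], [(1, 2), (4, 5)]), ((.se, .we, .O), [(1, 3)], [(0, 4)]),
   ((.se, .we, .ne), [(1, 3), (4, 5)], [(0, 4), (1, 2)]),
   ((.se, .wnse, .se), [(1, 4), (2, 3)], [(0, 5), (1, 4)]),
   ((.se, .wnse, .sn), [(1, 5), (2, 3)], [(0, 5), (2, 4)]),
   ((.se, .wsne, .se), [(1, 2), (3, 4)], [(0, 1), (4, 5)]),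
   ((.se, .wsne, .sn), [(1, 2), (3, 5)], [(0, 2), (4, 5)]), ((.ws, .O, .O), [(0, 1)], [(3, 4)]),
   ((.ws, .O, .ne), [(0, 1), (4, 5)], [(1, 2), (3, 4)]),
   ((.ws, .se, .O), [(0, 1), (2, 3)], [(0, 5), (3, 4)]),
   ((.ws, .se, .ne), [(0, 1), (2, 3), (4, 5)], [(0, 5), (1, 2), (3, 4)]),
   ((.ws, .ne, .se), [(0, 1), (3, 4)], [(0, 1), (3, 4)]),
   ((.ws, .ne, .sn), [(0, 1), (3, 5)], [(0, 2), (3, 4)]),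
   ((.ws, .sn, .se), [(0, 1), (2, 4)], [(1, 5), (3, 4)]),
   ((.ws, .sn, .sn), [(0, 1), (2, 5)], [(2, 5), (3, 4)]), ((.ne, .wn, .wnse), [(4, 5)], [(1, 2)]),
   ((.ne, .ws, .wn), [(2, 5)], [(2, 5)]), ((.ne, .ws, .we), [(2, 4)], [(1, 5)]),
   ((.ne, .we, .wn), [(3, 5)], [(0, 2)]), ((.ne, .we, .we), [(3, 4)], [(0, 1)]),
   ((.ne, .wnse, .wnse), [(2, 3), (4, 5)], [(0, 5), (1, 2)]),
   ((.ne, .wsne, .ws), [(2, 3)], [(0, 5)]),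
   ((.ne, .wsne, .wnse), [(2, 5), (3, 4)], [(0, 1), (2, 5)]),
   ((.ne, .wsne, .wsne), [(2, 3), (4, 5)], [(0, 5), (1, 2)]),
   ((.we, .wn, .se), [(0, 4)], [(1, 3)]), ((.we, .wn, .sn), [(0, 5)], [(2, 3)]),
   ((.we, .ws, .O), [(0, 2)], [(3, 5)]), ((.we, .ws, .ne), [(0, 2), (4, 5)], [(1, 2), (3, 5)]),
   ((.we, .we, .O), [(0, 3)], [(0, 3)]), ((.we, .we, .ne), [(0, 3), (4, 5)], [(0, 3), (1, 2)]),
   ((.we, .wnse, .se), [(0, 4), (2, 3)], [(0, 5), (1, 3)]),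
   ((.we, .wnse, .sn), [(0, 5), (2, 3)], [(0, 5), (2, 3)]),
   ((.we, .wsne, .se), [(0, 2), (3, 4)], [(0, 1), (3, 5)]),
   ((.we, .wsne, .sn), [(0, 2), (3, 5)], [(0, 2), (3, 5)]), ((.sn, .O, .wn), [(1, 5)], [(2, 4)]),
   ((.sn, .O, .we), [(1, 4)], [(1, 4)]), ((.sn, .se, .wn), [(1, 5), (2, 3)], [(0, 5), (2, 4)]),
   ((.sn, .se, .we), [(1, 4), (2, 3)], [(0, 5), (1, 4)]), ((.sn, .ne, .ws), [(1, 3)], [(0, 4)]),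
   ((.sn, .ne, .wnse), [(1, 5), (3, 4)], [(0, 1), (2, 4)]),
   ((.sn, .ne, .wsne), [(1, 3), (4, 5)], [(0, 4), (1, 2)]), ((.sn, .sn, .ws), [(1, 2)], [(4, 5)]),
   ((.sn, .sn, .wnse), [(1, 5), (2, 4)], [(1, 5), (2, 4)]),
   ((.sn, .sn, .wsne), [(1, 2), (4, 5)], [(1, 2), (4, 5)]),
   ((.wnse, .wn, .ws), [(0, 1)], [(3, 4)]),
   ((.wnse, .wn, .wnse), [(0, 5), (1, 4)], [(1, 4), (2, 3)]),
   ((.wnse, .wn, .wsne), [(0, 1), (4, 5)], [(1, 2), (3, 4)]),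
   ((.wnse, .ws, .wn), [(0, 5), (1, 2)], [(2, 3), (4, 5)]),
   ((.wnse, .ws, .we), [(0, 4), (1, 2)], [(1, 3), (4, 5)]),
   ((.wnse, .we, .wn), [(0, 5), (1, 3)], [(0, 4), (2, 3)]),
   ((.wnse, .we, .we), [(0, 4), (1, 3)], [(0, 4), (1, 3)]),
   ((.wnse, .wnse, .ws), [(0, 1), (2, 3)], [(0, 5), (3, 4)]),
   ((.wnse, .wnse, .wnse), [(0, 5), (1, 4), (2, 3)], [(0, 5), (1, 4), (2, 3)]),
   ((.wnse, .wnse, .wsne), [(0, 1), (2, 3), (4, 5)], [(0, 5), (1, 2), (3, 4)]),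
   ((.wnse, .wsne, .ws), [(0, 3), (1, 2)], [(0, 3), (4, 5)]),
   ((.wnse, .wsne, .wnse), [(0, 5), (1, 2), (3, 4)], [(0, 1), (2, 3), (4, 5)]),
   ((.wnse, .wsne, .wsne), [(0, 3), (1, 2), (4, 5)], [(0, 3), (1, 2), (4, 5)]),
   ((.wsne, .wn, .wnse), [(0, 1), (4, 5)], [(1, 2), (3, 4)]),
   ((.wsne, .ws, .wn), [(0, 1), (2, 5)], [(2, 5), (3, 4)]),
   ((.wsne, .ws, .we), [(0, 1), (2, 4)], [(1, 5), (3, 4)]),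
   ((.wsne, .we, .wn), [(0, 1), (3, 5)], [(0, 2), (3, 4)]),
   ((.wsne, .we, .we), [(0, 1), (3, 4)], [(0, 1), (3, 4)]),
   ((.wsne, .wnse, .wnse), [(0, 1), (2, 3), (4, 5)], [(0, 5), (1, 2), (3, 4)]),
   ((.wsne, .wsne, .ws), [(0, 1), (2, 3)], [(0, 5), (3, 4)]),
   ((.wsne, .wsne, .wnse), [(0, 1), (2, 5), (3, 4)], [(0, 1), (2, 5), (3, 4)]),
   ((.wsne, .wsne, .wsne), [(0, 1), (2, 3), (4, 5)], [(0, 5), (1, 2), (3, 4)])]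

/-- The Yang-Baxter equation: the weights with which the sides of the hexagon are joined in a given
way are invariant under a half-turn of the hexagon. -/
theorem hexTable_sum {α β : ℝ} (hα : den α ≠ 0) (hβ : den β ≠ 0) (hφ : den (β - α) ≠ 0)
    (G : Pairing → ℝ) :
    (hexTable.map fun x => x.1.1.wt α * x.1.2.1.wt β * x.1.2.2.wt (β - α) * G x.2.1).sum =
      (hexTable.map fun x => x.1.1.wt α * x.1.2.1.wt β * x.1.2.2.wt (β - α) * G x.2.2).sum := by
  have h0 := weightSum_eq hα hβ hφ [(.ws, .O, .O), (.wnse, .wn, .ws)]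
    [(.O, .ne, .se), (.ne, .we, .we)] fun k z x h => by
      simp only [numSum, RState.num, List.map, List.sum_cons, List.sum_nil]; grind
  have h1 := weightSum_eq hα hβ hφ [(.wn, .sn, .ws), (.we, .ws, .O)]
    [(.O, .ne, .sn), (.ne, .we, .wn)] fun k z x h => by
      simp only [numSum, RState.num, List.map, List.sum_cons, List.sum_nil]; grind
  have h2 := weightSum_eq hα hβ hφ [(.wn, .O, .we), (.we, .wn, .se)]
    [(.se, .we, .O), (.sn, .ne, .ws)] fun k z x h => by
      simp only [numSum, RState.num, List.map, List.sum_cons, List.sum_nil]; grind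
  have h3 := weightSum_eq hα hβ hφ [(.wn, .O, .wn), (.we, .wn, .sn)]
    [(.O, .se, .O), (.ne, .wsne, .ws)] fun k z x h => by
      simp only [numSum, RState.num, List.map, List.sum_cons, List.sum_nil]; grind
  have h4 := weightSum_eq hα hβ hφ [(.se, .ws, .O), (.sn, .sn, .ws)]
    [(.O, .O, .ne), (.ne, .wn, .wnse)] fun k z x h => by
      simp only [numSum, RState.num, List.map, List.sum_cons, List.sum_nil]; grind
  have h5 := weightSum_eq hα hβ hφ [(.se, .wn, .sn), (.sn, .O, .wn)]
    [(.O, .sn, .se), (.ne, .ws, .we)] fun k z x h => by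
      simp only [numSum, RState.num, List.map, List.sum_cons, List.sum_nil]; grind
  have h6 := weightSum_eq hα hβ hφ [(.ws, .se, .O), (.wnse, .wnse, .ws), (.wsne, .wsne, .ws)]
    [(.wn, .ne, .wnse)] fun k z x h => by
      simp only [numSum, RState.num, List.map, List.sum_cons, List.sum_nil]; grind
  have h7 := weightSum_eq hα hβ hφ [(.ws, .sn, .se), (.wsne, .ws, .we)]
    [(.sn, .ne, .wnse)] fun k z x h => by
      simp only [numSum, RState.num, List.map, List.sum_cons, List.sum_nil]; grind
  have h8 := weightSum_eq hα hβ hφ [(.ws, .sn, .sn), (.wsne, .ws, .wn)]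
    [(.ne, .wsne, .wnse)] fun k z x h => by
      simp only [numSum, RState.num, List.map, List.sum_cons, List.sum_nil]; grind
  have h9 := weightSum_eq hα hβ hφ [(.ws, .ne, .sn), (.wsne, .we, .wn)]
    [(.we, .wsne, .se)] fun k z x h => by
      simp only [numSum, RState.num, List.map, List.sum_cons, List.sum_nil]; grind
  have h10 := weightSum_eq hα hβ hφ [(.ws, .O, .ne), (.wnse, .wn, .wsne), (.wsne, .wn, .wnse)]
    [(.se, .wsne, .se)] fun k z x h => by
      simp only [numSum, RState.num, List.map, List.sum_cons, List.sum_nil]; grind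
  have h11 := weightSum_eq hα hβ hφ [(.wn, .sn, .wsne), (.we, .ws, .ne)]
    [(.se, .wsne, .sn)] fun k z x h => by
      simp only [numSum, RState.num, List.map, List.sum_cons, List.sum_nil]; grind
  have h12 := weightSum_eq hα hβ hφ [(.wnse, .wsne, .ws)]
    [(.wn, .ne, .wsne), (.we, .we, .ne)] fun k z x h => by
      simp only [numSum, RState.num, List.map, List.sum_cons, List.sum_nil]; grind
  have h13 := weightSum_eq hα hβ hφ [(.wnse, .ws, .we)]
    [(.se, .we, .ne), (.sn, .ne, .wsne)] fun k z x h => by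
      simp only [numSum, RState.num, List.map, List.sum_cons, List.sum_nil]; grind
  have h14 := weightSum_eq hα hβ hφ [(.wn, .se, .we), (.we, .wnse, .se)]
    [(.wnse, .we, .wn)] fun k z x h => by
      simp only [numSum, RState.num, List.map, List.sum_cons, List.sum_nil]; grind
  have h15 := weightSum_eq hα hβ hφ [(.wnse, .ws, .wn)]
    [(.O, .se, .ne), (.ne, .wnse, .wnse), (.ne, .wsne, .wsne)] fun k z x h => by
      simp only [numSum, RState.num, List.map, List.sum_cons, List.sum_nil]; grind
  have h16 := weightSum_eq hα hβ hφ [(.wnse, .wn, .wnse)]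
    [(.se, .wnse, .se), (.sn, .se, .we)] fun k z x h => by
      simp only [numSum, RState.num, List.map, List.sum_cons, List.sum_nil]; grind
  have h17 := weightSum_eq hα hβ hφ [(.wn, .sn, .wnse)]
    [(.se, .wnse, .sn), (.sn, .se, .wn)] fun k z x h => by
      simp only [numSum, RState.num, List.map, List.sum_cons, List.sum_nil]; grind
  have h18 := weightSum_eq hα hβ hφ [(.ws, .se, .ne), (.wnse, .wnse, .wsne), (.wsne, .wnse, .wnse), (.wsne, .wsne, .wsne)]
    [(.wnse, .wsne, .wnse)] fun k z x h => by
      simp only [numSum, RState.num, List.map, List.sum_cons, List.sum_nil]; grind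
  simp only [weightSum, List.map, List.sum_cons, List.sum_nil] at *
  simp only [hexTable, List.map, List.sum_cons, List.sum_nil]
  linear_combination h0 * (G [(0, 1)] - G [(3, 4)]) +
    h1 * (G [(0, 2)] - G [(3, 5)]) +
    h2 * (G [(0, 4)] - G [(1, 3)]) +
    h3 * (G [(0, 5)] - G [(2, 3)]) +
    h4 * (G [(1, 2)] - G [(4, 5)]) +
    h5 * (G [(1, 5)] - G [(2, 4)]) +
    h6 * (G [(0, 1), (2, 3)] - G [(0, 5), (3, 4)]) +
    h7 * (G [(0, 1), (2, 4)] - G [(1, 5), (3, 4)]) +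
    h8 * (G [(0, 1), (2, 5)] - G [(2, 5), (3, 4)]) +
    h9 * (G [(0, 1), (3, 5)] - G [(0, 2), (3, 4)]) +
    h10 * (G [(0, 1), (4, 5)] - G [(1, 2), (3, 4)]) +
    h11 * (G [(0, 2), (4, 5)] - G [(1, 2), (3, 5)]) +
    h12 * (G [(0, 3), (1, 2)] - G [(0, 3), (4, 5)]) +
    h13 * (G [(0, 4), (1, 2)] - G [(1, 3), (4, 5)]) +
    h14 * (G [(0, 4), (2, 3)] - G [(0, 5), (1, 3)]) +
    h15 * (G [(0, 5), (1, 2)] - G [(2, 3), (4, 5)]) +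
    h16 * (G [(0, 5), (1, 4)] - G [(1, 4), (2, 3)]) +
    h17 * (G [(0, 5), (2, 4)] - G [(1, 5), (2, 3)]) +
    h18 * (G [(0, 1), (2, 3), (4, 5)] - G [(0, 5), (1, 2), (3, 4)])

/-! ### Connections inside a hexagon -/

/-- The symmetric relation given by a list of pairs of labels, the label `n` standing for `f n`. -/
def pairRel (f : Fin 9 → Edge T) (L : Pairing) (e g : Edge T) : Prop :=
  ∃ p ∈ L, e = f p.1 ∧ g = f p.2 ∨ e = f p.2 ∧ g = f p.1

/-- The pairs in the list that contain `n`. -/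
def incident (n : Fin 9) (L : Pairing) : Pairing := L.filter fun p => p.1 = n ∨ p.2 = n

/-- The pairs in the list that do not contain `n`. -/
def avoiding (n : Fin 9) (L : Pairing) : Pairing := L.filter fun p => ¬ (p.1 = n ∨ p.2 = n)

/-- The element other than `n` of a pair that contains `n`. -/
def partner (n : Fin 9) (p : Fin 9 × Fin 9) : Fin 9 := if p.1 = n then p.2 else p.1

/-- Eliminates the inner side `n` from a list of connections: the two connections at `n`, if there
are any, are replaced by a single one. The result is `none` if the connections cannot be part of a
walk, because `n` is a dead end or is on a closed loop. -/
def eliminate (n : Fin 9) (L : Pairing) : Option Pairing :=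
  match incident n L with
  | [] => some L
  | [p, q] =>
    if partner n p = partner n q ∨ partner n p = n ∨ partner n q = n ∨
        (partner n p, partner n q) ∈ L ∨ (partner n q, partner n p) ∈ L then none
    else some ((partner n p, partner n q) :: avoiding n L)
  | _ => none

theorem pairRel_split (f : Fin 9 → Edge T) (n : Fin 9) (L : Pairing) (e g : Edge T) :
    pairRel f L e g ↔ pairRel f (incident n L) e g ∨ pairRel f (avoiding n L) e g := by
  simp only [pairRel, incident, avoiding, List.mem_filter, decide_eq_true_eq]
  constructor
  · rintro ⟨p, hp, h⟩
    by_cases hn : p.1 = n ∨ p.2 = n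
    · exact .inl ⟨p, ⟨hp, hn⟩, h⟩
    · exact .inr ⟨p, ⟨hp, hn⟩, h⟩
  · rintro (⟨p, ⟨hp, -⟩, h⟩ | ⟨p, ⟨hp, -⟩, h⟩) <;> exact ⟨p, hp, h⟩

theorem pairRel_cons (f : Fin 9 → Edge T) (p : Fin 9 × Fin 9) (L : Pairing) (e g : Edge T) :
    pairRel f (p :: L) e g ↔ (e = f p.1 ∧ g = f p.2 ∨ e = f p.2 ∧ g = f p.1) ∨ pairRel f L e g := by
  simp [pairRel]

theorem not_pairRel_avoiding {f : Fin 9 → Edge T} (hf : f.Injective) (n : Fin 9) (L : Pairing)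
    (e : Edge T) : ¬ pairRel f (avoiding n L) (f n) e ∧ ¬ pairRel f (avoiding n L) e (f n) := by
  simp only [pairRel, avoiding, List.mem_filter, decide_eq_true_eq]
  constructor <;>
  · rintro ⟨p, ⟨-, hp⟩, ⟨h1, h2⟩ | ⟨h1, h2⟩⟩
    · first | exact hp (.inl (hf h1).symm) | exact hp (.inr (hf h2).symm)
    · first | exact hp (.inr (hf h1).symm) | exact hp (.inl (hf h2).symm)

theorem pair_of_incident {n : Fin 9} {L : Pairing} {p : Fin 9 × Fin 9} (hp : p ∈ incident n L) :
    p ∈ L ∧ (p = (n, partner n p) ∨ p = (partner n p, n)) := by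
  simp only [incident, List.mem_filter, decide_eq_true_eq] at hp
  refine ⟨hp.1, ?_⟩
  obtain ⟨p1, p2⟩ := p
  simp only [partner]
  split_ifs with h
  · left; simp [← h]
  · right; simp; tauto

theorem pairRel_of_incident {f : Fin 9 → Edge T} {n : Fin 9} {L : Pairing} {p : Fin 9 × Fin 9}
    (hp : p ∈ incident n L) : pairRel f L (f n) (f (partner n p)) := by
  obtain ⟨h1, h2⟩ := pair_of_incident hp
  refine ⟨p, h1, ?_⟩
  rcases h2 with h2 | h2
  · left; rw [h2]; simp [partner]
  · right
    have e1 : p.1 = partner n p := congrArg Prod.fst h2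
    have e2 : p.2 = n := congrArg Prod.snd h2
    rw [e2, e1]; simp

theorem pair_eq_iff_of_incident {f : Fin 9 → Edge T} {n : Fin 9} {L : Pairing} {p : Fin 9 × Fin 9}
    (hp : p ∈ incident n L) {e g : Edge T} : (e = f p.1 ∧ g = f p.2 ∨ e = f p.2 ∧ g = f p.1) ↔
      (e = f n ∧ g = f (partner n p) ∨ e = f (partner n p) ∧ g = f n) := by
  rcases (pair_of_incident hp).2 with h | h
  · have t1 : p.1 = n := congrArg Prod.fst h
    have t2 : p.2 = partner n p := congrArg Prod.snd h
    generalize partner n p = m at t2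
    rw [t1, t2]
  · have t1 : p.1 = partner n p := congrArg Prod.fst h
    have t2 : p.2 = n := congrArg Prod.snd h
    generalize partner n p = m at t1
    rw [t1, t2, or_comm]

theorem not_pairRel_nil (f : Fin 9 → Edge T) (e g : Edge T) : ¬ pairRel f [] e g := by
  simp [pairRel]

/-- Elimination of a side that is not met outside does not change whether there is a walk. -/
theorem isPath_eliminate {f : Fin 9 → Edge T} (hf : f.Injective) {a b : Edge T}
    {R : Edge T → Edge T → Prop} {n : Fin 9} (hna : f n ≠ a) (hnb : f n ≠ b)
    (hR : ∀ z, ¬ R (f n) z ∧ ¬ R z (f n)) (hR' : ∀ m m', m ≠ m' → ¬ R (f m) (f m'))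
    (L : Pairing) (hL : (incident n L).length ≤ 2) :
    IsPath a b (fun e g => pairRel f L e g ∨ R e g) ↔
      ∃ L', eliminate n L = some L' ∧ IsPath a b (fun e g => pairRel f L' e g ∨ R e g) := by
  have hinc : ∀ w, pairRel f L (f n) w ↔ ∃ p ∈ incident n L, w = f (partner n p) := by
    intro w
    constructor
    · rintro ⟨p, hp, ⟨h1, h2⟩ | ⟨h1, h2⟩⟩
      · have := hf h1
        exact ⟨p, by simp [incident, hp, this], by simp [partner, this, h2]⟩
      · have := hf h1
        refine ⟨p, by simp [incident, hp, this], ?_⟩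
        rw [h2, partner]
        split_ifs with h
        · rw [h, this]
        · rfl
    · rintro ⟨p, hp, rfl⟩
      exact pairRel_of_incident hp
  have hnbr : IsPath a b (fun e g => pairRel f L e g ∨ R e g) → ∀ p ∈ incident n L,
      ∃ x y, x ≠ y ∧ (∀ z, (∃ p ∈ incident n L, z = f (partner n p)) ↔ z = x ∨ z = y) ∧
        ¬ pairRel f L x y := fun h p hp => by
    obtain ⟨x, y, hxy, h1, h2⟩ := h.neighbours (.inl (pairRel_of_incident hp)) hna hnb
    refine ⟨x, y, hxy, fun z => ?_, fun h => h2 (.inl h)⟩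
    rw [← hinc, ← h1]
    simp [(hR z).1]
  unfold eliminate
  match hi : incident n L with
  | [] => simp
  | [p] =>
    refine ⟨fun h => ?_, fun ⟨_, h, _⟩ => by simp at h⟩
    exfalso
    obtain ⟨x, y, hxy, h1, h2⟩ := hnbr h p (by simp [hi])
    simp only [hi, List.mem_singleton, exists_eq_left] at h1
    exact hxy (((h1 x).2 (.inl rfl)).trans ((h1 y).2 (.inr rfl)).symm)
  | p :: q :: r :: M => simp [hi] at hL
  | [p, q] =>
    have hp : p ∈ incident n L := by simp [hi]
    have hq : q ∈ incident n L := by simp [hi]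
    dsimp only
    split_ifs with hc
    · refine ⟨fun h => ?_, fun ⟨_, h, _⟩ => by simp at h⟩
      exfalso
      obtain ⟨x, y, hxy, h1, h2⟩ := hnbr h p hp
      have hxn : ∀ p ∈ incident n L, partner n p ≠ n := fun p hp he =>
        h.irrefl (.inl (pairRel_of_incident hp)) (by rw [he])
      simp only [hi, List.mem_cons, List.not_mem_nil, or_false, exists_eq_or_imp, exists_eq_left] at h1
      have hx := (h1 x).2 (.inl rfl)
      have hy := (h1 y).2 (.inr rfl)
      have hxy' : x = f (partner n p) ∧ y = f (partner n q) ∨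
          x = f (partner n q) ∧ y = f (partner n p) := by
        rcases hx with hx | hx <;> rcases hy with hy | hy
        · exact absurd (hx.trans hy.symm) hxy
        · exact .inl ⟨hx, hy⟩
        · exact .inr ⟨hx, hy⟩
        · exact absurd (hx.trans hy.symm) hxy
      rcases hc with hc | hc | hc | hc | hc
      · rw [hc, or_self] at hxy'; exact hxy (hxy'.1.trans hxy'.2.symm)
      · exact hxn _ hp hc
      · exact hxn _ hq hc
      · exact h2 ⟨_, hc, hxy'⟩
      · exact h2 ⟨_, hc, hxy'.symm⟩
    · simp only [not_or] at hc
      obtain ⟨c1, c2, c3, c4, c5⟩ := hc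
      simp only [Option.some.injEq, exists_eq_left']
      have e1 : ∀ e g, (pairRel f L e g ∨ R e g) ↔
          ((e = f n ∧ g = f (partner n p) ∨ e = f (partner n p) ∧ g = f n) ∨
            (e = f n ∧ g = f (partner n q) ∨ e = f (partner n q) ∧ g = f n)) ∨
              (pairRel f (avoiding n L) e g ∨ R e g) := fun e g => by
        rw [pairRel_split f n L, hi, pairRel_cons, pairRel_cons, pair_eq_iff_of_incident hp,
          pair_eq_iff_of_incident hq]
        simp only [not_pairRel_nil, or_false, or_assoc]
      have e2 : ∀ e g, (pairRel f ((partner n p, partner n q) :: avoiding n L) e g ∨ R e g) ↔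
          (e = f (partner n p) ∧ g = f (partner n q) ∨ e = f (partner n q) ∧ g = f (partner n p)) ∨
              (pairRel f (avoiding n L) e g ∨ R e g) := fun e g => by
        rw [pairRel_cons, or_assoc]
      rw [IsPath.congr e1, IsPath.congr e2]
      have hav : ∀ m m', (m, m') ∉ L → (m', m) ∉ L → ¬ pairRel f (avoiding n L) (f m) (f m') := by
        rintro m m' h1 h2 ⟨⟨p1, p2⟩, hp, ⟨h3, h4⟩ | ⟨h3, h4⟩⟩ <;>
        · have t1 := hf h3
          have t2 := hf h4
          simp only at t1 t2
          simp only [avoiding, List.mem_filter] at hp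
          subst t1 t2
          tauto
      refine isPath_contract hna hnb (fun z => not_or.2 ⟨(not_pairRel_avoiding hf n L z).1, (hR z).1⟩)
        (fun z => not_or.2 ⟨(not_pairRel_avoiding hf n L z).2, (hR z).2⟩)
        (hf.ne c1) (hf.ne c2) (hf.ne c3)
        (not_or.2 ⟨hav _ _ c4 c5, hR' _ _ c1⟩) (not_or.2 ⟨hav _ _ c5 c4, hR' _ _ (Ne.symm c1)⟩)

/-- The normal form of a list of unordered pairs. -/
def Pairing.normalize (L : Pairing) : Pairing :=
  (L.map fun p => if p.1 < p.2 then p else p.swap).insertionSort fun p q => p.1 ≤ q.1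

theorem pairRel_normalize (f : Fin 9 → Edge T) (L : Pairing) (e g : Edge T) :
    pairRel f L.normalize e g ↔ pairRel f L e g := by
  simp only [pairRel, Pairing.normalize, (List.perm_insertionSort _ _).mem_iff, List.mem_map]
  constructor
  · rintro ⟨_, ⟨p, hp, rfl⟩, h⟩
    refine ⟨p, hp, ?_⟩
    split_ifs at h
    · exact h
    · simpa using h.symm
  · rintro ⟨p, hp, h⟩
    refine ⟨_, ⟨p, hp, rfl⟩, ?_⟩
    split_ifs
    · exact h
    · simpa using h.symm

/-- The connections between the sides `0, …, 5` of the hexagon that result from a list of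
connections between its sides and the inner sides `6, 7, 8`. -/
def connect (L : Pairing) : Option Pairing :=
  (((eliminate 6 L).bind (eliminate 7)).bind (eliminate 8)).map Pairing.normalize

/-- The sides west, north, east, south of the three rhombi in the hexagon, when the inserted rhombus
is at the top. -/
def hexTop : Fin 3 → Fin 4 → Fin 9 := ![![0, 7, 6, 1], ![6, 8, 3, 2], ![7, 5, 4, 8]]

/-- The sides west, north, east, south of the three rhombi in the hexagon, when the inserted rhombus
is at the bottom. -/
def hexBot : Fin 3 → Fin 4 → Fin 9 := ![![0, 5, 6, 7], ![6, 4, 3, 8], ![1, 7, 8, 2]]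

/-- The connections made by the states of three rhombi with sides `H`. -/
def hexPairs (H : Fin 3 → Fin 4 → Fin 9) (t : HexState) : Pairing :=
  t.1.pairs.map (Prod.map (H 0) (H 0)) ++ (t.2.1.pairs.map (Prod.map (H 1) (H 1)) ++
    t.2.2.pairs.map (Prod.map (H 2) (H 2)))

/-- The states of a rhombus, in a list. -/
def allStates : List RState := [.O, .wn, .se, .ws, .ne, .we, .sn, .wnse, .wsne]

/-- The states of three rhombi, in a list. -/
def allHexStates : List HexState := allStates ×ˢ (allStates ×ˢ allStates)

theorem hexTable_top : hexTable.map (fun x => (x.1, x.2.1)) =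
    allHexStates.filterMap fun t => (connect (hexPairs hexTop t)).map fun P => (t, P) := by
  decide +kernel

theorem hexTable_bot : hexTable.map (fun x => (x.1, x.2.2)) =
    allHexStates.filterMap fun t =>
      (connect (hexPairs hexBot (t.2.1.rot, t.1.rot, t.2.2.rot))).map fun P => (t, P) := by
  decide +kernel

theorem sum_hexState (F : HexState → ℝ) : ∑ t, F t = (allHexStates.map F).sum := by
  have h1 : ∀ g : RState → ℝ, ∑ s, g s = (allStates.map g).sum := fun g => rfl
  have h2 : ∀ (L L' : List RState) (g : RState × RState → ℝ),
      ((L ×ˢ L').map g).sum = (L.map fun s => (L'.map fun t => g (s, t)).sum).sum := by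
    intro L L' g
    induction L with
    | nil => simp
    | cons x L ih => simp [ih, List.product_cons, Function.comp_def]
  have h3 : ∀ (L : List RState) (L' : List (RState × RState)) (g : HexState → ℝ),
      ((L ×ˢ L').map g).sum = (L.map fun s => (L'.map fun t => g (s, t)).sum).sum := by
    intro L L' g
    induction L with
    | nil => simp
    | cons x L ih => simp [ih, List.product_cons, Function.comp_def]
  rw [Fintype.sum_prod_type, h1, allHexStates, h3]
  simp_rw [Fintype.sum_prod_type, h1, h2]

/-- Sums over the states of three rhombi, as functions of the connections they make. -/
theorem sum_connect (F : HexState → ℝ) (g : HexState → Option Pairing) (G : Pairing → ℝ) :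
    ∑ t, F t * (g t).elim 0 G =
      ((allHexStates.filterMap fun t => (g t).map fun P => (t, P)).map fun x => F x.1 * G x.2).sum := by
  rw [sum_hexState]
  induction allHexStates with
  | nil => simp
  | cons t L ih =>
    rw [List.map_cons, List.sum_cons, ih, List.filterMap_cons]
    cases h : g t <;> simp

theorem sum_fin_three (F : (Fin 3 → RState) → ℝ) :
    ∑ d, F d = ∑ t : HexState, F ![t.1, t.2.1, t.2.2] := by
  refine Fintype.sum_equiv (⟨fun d => (d 0, d 1, d 2), fun t => ![t.1, t.2.1, t.2.2],
    fun d => by ext i; fin_cases i <;> rfl, fun t => rfl⟩ : (Fin 3 → RState) ≃ HexState) _ _ fun d => ?_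
  congr 1
  ext i; fin_cases i <;> rfl

theorem stepRel_hex (f : Fin 9 → Edge T) (H : Fin 3 → Fin 4 → Fin 9) (t : HexState) (e g : Edge T) :
    stepRel (fun i s => f (H i s)) ![t.1, t.2.1, t.2.2] e g ↔ pairRel f (hexPairs H t) e g := by
  simp only [stepRel, pairRel, hexPairs, List.mem_append, List.mem_map, Fin.exists_fin_succ]
  simp only [or_and_right, exists_or, exists_exists_and_eq_and, Prod.map]
  simp

theorem isPath_connect {f : Fin 9 → Edge T} (hf : f.Injective) {a b : Edge T}
    {R : Edge T → Edge T → Prop}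
    (hab : ∀ n, 6 ≤ n → f n ≠ a ∧ f n ≠ b ∧ ∀ z, ¬ R (f n) z ∧ ¬ R z (f n))
    (hR : ∀ m m', m ≠ m' → ¬ R (f m) (f m'))
    (L : Pairing) (h6 : (incident 6 L).length ≤ 2)
    (h7 : ∀ L' ∈ eliminate 6 L, (incident 7 L').length ≤ 2)
    (h8 : ∀ L' ∈ (eliminate 6 L).bind (eliminate 7), (incident 8 L').length ≤ 2) :
    IsPath a b (fun e g => pairRel f L e g ∨ R e g) ↔
      ∃ P, connect L = some P ∧ IsPath a b (fun e g => pairRel f P e g ∨ R e g) := by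
  have H := fun n (hn : (6 : Fin 9) ≤ n) L => isPath_eliminate hf (hab n hn).1 (hab n hn).2.1 (hab n hn).2.2 hR L
  have norm : ∀ L : Pairing, IsPath a b (fun e g => pairRel f L.normalize e g ∨ R e g) ↔
      IsPath a b (fun e g => pairRel f L e g ∨ R e g) := fun L =>
    IsPath.congr fun e g => by rw [pairRel_normalize]
  rw [H 6 (by decide) L h6, connect]
  cases hL6 : eliminate 6 L with
  | none => simp
  | some L1 =>
    rw [hL6] at h7 h8
    simp only [Option.bind_some, Option.some.injEq, exists_eq_left']
    rw [H 7 (by decide) L1 (h7 L1 rfl)]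
    simp only [Option.bind_some] at h8
    cases hL7 : eliminate 7 L1 with
    | none => simp
    | some L2 =>
      simp only [Option.bind_some, Option.some.injEq, exists_eq_left']
      rw [H 8 (by decide) L2 (h8 L2 hL7)]
      cases hL8 : eliminate 8 L2 with
      | none => simp
      | some L3 => simp [norm]

/-- In a consistent hexagon at most two connections meet at each inner side. -/
def DegreeLeTwo (L : Pairing) : Prop :=
  (incident 6 L).length ≤ 2 ∧ (∀ L' ∈ eliminate 6 L, (incident 7 L').length ≤ 2) ∧
    ∀ L' ∈ (eliminate 6 L).bind (eliminate 7), (incident 8 L').length ≤ 2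

instance (L : Pairing) : Decidable (DegreeLeTwo L) := by
  unfold DegreeLeTwo; infer_instance

theorem degreeLeTwo_hexTop : ∀ t, DegreeLeTwo (hexPairs hexTop t) := by
  decide +kernel

theorem degreeLeTwo_hexBot : ∀ t, DegreeLeTwo (hexPairs hexBot t) := by
  decide +kernel

theorem pathInd_connect {f : Fin 9 → Edge T} (hf : f.Injective) {a b : Edge T}
    {R : Edge T → Edge T → Prop}
    (hab : ∀ n, 6 ≤ n → f n ≠ a ∧ f n ≠ b ∧ ∀ z, ¬ R (f n) z ∧ ¬ R z (f n))
    (hR : ∀ m m', m ≠ m' → ¬ R (f m) (f m'))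
    (L : Pairing) (hL : DegreeLeTwo L) :
    pathInd a b (fun e g => pairRel f L e g ∨ R e g) =
      (connect L).elim 0 fun P => pathInd a b (fun e g => pairRel f P e g ∨ R e g) := by
  have h := isPath_connect hf hab hR L hL.1 hL.2.1 hL.2.2
  cases hc : connect L with
  | none => simp [pathInd, h, hc]
  | some P =>
    simp only [Option.elim_some]
    exact pathInd_congr (by rw [h, hc]; simp)

/-- Flipping the three rhombi of a hexagon does not change the partition function. -/
theorem partFun_hexagon {κ : Type*} [Fintype κ] (side : κ → Fin 4 → Edge T) (wt : κ → RState → ℝ)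
    {f : Fin 9 → Edge T} (hf : f.Injective) {a b : Edge T}
    (hin : ∀ n, 6 ≤ n → f n ≠ a ∧ f n ≠ b ∧ ∀ i s, side i s ≠ f n)
    (hout : ∀ i s s' m m', side i s = f m → side i s' = f m' → m = m')
    {α β : ℝ} (hα : den α ≠ 0) (hβ : den β ≠ 0) (hφ : den (β - α) ≠ 0) :
    partFun (Sum.elim side fun i s => f (hexTop i s))
        (Sum.elim wt ![RState.wt α, RState.wt β, RState.wt (β - α)]) a b =
      partFun (Sum.elim side fun i s => f (hexBot i s))
        (Sum.elim wt ![RState.wt β, RState.wt α, RState.wt (β - α)]) a b := by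
  classical
  rw [partFun_sum, partFun_sum]
  refine Finset.sum_congr rfl fun c _ => ?_
  congr 1
  simp only [Sum.elim_inl, Sum.elim_inr]
  set R := stepRel side c with hRdef
  have hab : ∀ n, 6 ≤ n → f n ≠ a ∧ f n ≠ b ∧ ∀ z, ¬ R (f n) z ∧ ¬ R z (f n) := by
    refine fun n hn => ⟨(hin n hn).1, (hin n hn).2.1, fun z => ⟨?_, ?_⟩⟩ <;>
    · rintro ⟨i, p, -, ⟨h1, h2⟩ | ⟨h1, h2⟩⟩
      · first | exact (hin n hn).2.2 _ _ h1.symm | exact (hin n hn).2.2 _ _ h2.symm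
      · first | exact (hin n hn).2.2 _ _ h1.symm | exact (hin n hn).2.2 _ _ h2.symm
  have hR : ∀ m m', m ≠ m' → ¬ R (f m) (f m') := by
    rintro m m' hm ⟨i, p, -, ⟨h1, h2⟩ | ⟨h1, h2⟩⟩ <;> exact hm (hout i _ _ _ _ h1.symm h2.symm)
  set G : Pairing → ℝ := fun P => pathInd a b (fun e g => pairRel f P e g ∨ R e g) with hG
  have key : ∀ (H : Fin 3 → Fin 4 → Fin 9), (∀ t, DegreeLeTwo (hexPairs H t)) → ∀ t : HexState,
      pathInd a b (fun e g => stepRel (fun i s => f (H i s)) ![t.1, t.2.1, t.2.2] e g ∨ R e g) =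
        (connect (hexPairs H t)).elim 0 G := fun H hH t => by
    rw [← pathInd_connect hf hab hR _ (hH t)]
    exact pathInd_congr (IsPath.congr fun e g => by rw [stepRel_hex])
  rw [sum_fin_three, sum_fin_three]
  simp only [key _ degreeLeTwo_hexTop, key _ degreeLeTwo_hexBot]
  have e3 := hexTable_sum hα hβ hφ G
  have e4 : ∀ (F : HexState → ℝ) (g : HexState × Pairing × Pairing → HexState × Pairing),
      (hexTable.map fun x => F (g x).1 * G (g x).2).sum = ((hexTable.map g).map fun x => F x.1 * G x.2).sum :=
    fun F g => by rw [List.map_map]; rfl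
  have e5 := e4 (fun t => t.1.wt α * t.2.1.wt β * t.2.2.wt (β - α)) fun x => (x.1, x.2.1)
  have e6 := e4 (fun t => t.1.wt α * t.2.1.wt β * t.2.2.wt (β - α)) fun x => (x.1, x.2.2)
  rw [hexTable_top, ← sum_connect fun t => t.1.wt α * t.2.1.wt β * t.2.2.wt (β - α)] at e5
  rw [hexTable_bot, ← sum_connect fun t => t.1.wt α * t.2.1.wt β * t.2.2.wt (β - α)] at e6
  refine Eq.trans ?_ ((e5.symm.trans (e3.trans e6)).trans ?_)
  · refine Finset.sum_congr rfl fun t _ => ?_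
    simp [Fin.prod_univ_three]
  · refine Fintype.sum_equiv (⟨fun t => (t.2.1.rot, t.1.rot, t.2.2.rot),
      fun t => (t.2.1.rot, t.1.rot, t.2.2.rot), fun t => by simp [RState.rot_rot],
      fun t => by simp [RState.rot_rot]⟩ : HexState ≃ HexState) _ _ fun t => ?_
    simp [Fin.prod_univ_three, RState.wt_rot, mul_comm (t.1.wt α)]

/-! ### Signs of the weights -/

theorem sin_neg_of_mem {x : ℝ} (h1 : π < x) (h2 : x < 2 * π) : Real.sin x < 0 := by
  have := Real.sin_pos_of_pos_of_lt_pi (x := x - π) (by linarith) (by linarith)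
  rw [Real.sin_sub_pi] at this
  linarith

theorem den_neg {θ : ℝ} (h1 : -(2 * π / 3) < θ) (h2 : θ < π) : den θ < 0 := by
  have := Real.pi_pos
  exact mul_neg_of_neg_of_pos (sin_neg_of_mem (by linarith) (by linarith))
    (Real.sin_pos_of_pos_of_lt_pi (by linarith) (by linarith))

theorem u₁_pos {θ : ℝ} (h : θ ∈ Set.Icc (π / 3) (2 * π / 3)) : 0 < u₁ θ := by
  have := Real.pi_pos
  obtain ⟨h1, h2⟩ := h
  refine div_pos_of_neg_of_neg (mul_neg_of_neg_of_pos (sin_neg_of_mem (by linarith) (by linarith))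
    (Real.sin_pos_of_pos_of_lt_pi (by linarith) (by linarith))) (den_neg (by linarith) (by linarith))

theorem u₂_pos {θ : ℝ} (h : θ ∈ Set.Icc (π / 3) (2 * π / 3)) : 0 < u₂ θ := by
  have := Real.pi_pos
  obtain ⟨h1, h2⟩ := h
  refine div_pos_of_neg_of_neg (mul_neg_of_neg_of_pos (sin_neg_of_mem (by linarith) (by linarith))
    (Real.sin_pos_of_pos_of_lt_pi (by linarith) (by linarith))) (den_neg (by linarith) (by linarith))

theorem RState.wt_nonneg {θ : ℝ} (h : θ ∈ Set.Icc (π / 3) (2 * π / 3)) (s : RState) : 0 ≤ s.wt θ := by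
  have hu₁ := (u₁_pos h).le
  have hu₂ := (u₂_pos h).le
  have := Real.pi_pos
  obtain ⟨h1, h2⟩ := h
  have hd := (den_neg (θ := θ) (by linarith) (by linarith)).le
  have hs : Real.sin (-(3 * θ / 8)) ≤ 0 :=
    Real.sin_nonpos_of_nonpos_of_neg_pi_le (by linarith) (by linarith)
  have h5 : 0 ≤ Real.sin (5 * π / 8 + 3 * θ / 8) :=
    Real.sin_nonneg_of_nonneg_of_le_pi (by linarith) (by linarith)
  have hv : 0 ≤ v θ := div_nonneg_of_nonpos (mul_nonpos_of_nonneg_of_nonpos h5 hs) hd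
  have hw₁ : 0 ≤ w₁ θ := by
    refine div_nonneg_of_nonpos (mul_nonpos_of_nonneg_of_nonpos h5 ?_) hd
    rw [show 5 * π / 4 - 3 * θ / 8 = (π / 4 - 3 * θ / 8) + π by ring, Real.sin_add_pi, neg_nonpos]
    exact Real.sin_nonneg_of_nonneg_of_le_pi (by linarith) (by linarith)
  have hw₂ : 0 ≤ w₂ θ := by
    refine div_nonneg_of_nonpos (mul_nonpos_of_nonneg_of_nonpos ?_ hs) hd
    rw [show 15 * π / 8 + 3 * θ / 8 = (3 * θ / 8 - π / 8) + 2 * π by ring, Real.sin_add_two_pi]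
    exact Real.sin_nonneg_of_nonneg_of_le_pi (by linarith) (by linarith)
  cases s <;> simp only [RState.wt] <;> first | assumption | norm_num

theorem RState.wt_O (θ : ℝ) : RState.O.wt θ = 1 := rfl

/-! ### Partition functions of rows of rhombi -/

/-- The sides west, north, east, south of a rhombus. -/
def side4 (r : Rhombus T) : Fin 4 → Edge T := ![west r, north r, east r, south r]

/-- The partition function of the part of the strip consisting of the rows in `S`. -/
def rowsPartFun (θ : Fin T → ℝ) (S : Finset ℤ) (a b : Edge T) : ℝ :=
  partFun (fun i : Fin T × S => side4 (i.1, i.2.1)) (fun i => RState.wt (θ i.1)) a b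

/-- The partition function of the rows in `S`, to which one arc from `x` to `y` is added. -/
def capPartFun (θ : Fin T → ℝ) (S : Finset ℤ) (x y a b : Edge T) : ℝ :=
  ∑ c : Fin T × S → RState, (∏ i, RState.wt (θ i.1) (c i)) *
    pathInd a b fun e g => (e = x ∧ g = y ∨ e = y ∧ g = x) ∨
      stepRel (fun i : Fin T × S => side4 (i.1, i.2.1)) c e g

/-- Adding a row to a set of rows, at the level of indices. -/
def insertRow (T : ℕ) {S : Finset ℤ} {y : ℤ} (hy : y ∉ S) :
    (Fin T × S) ⊕ Fin T ≃ Fin T × (insert y S : Finset ℤ) :=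
  Equiv.ofBijective (Sum.elim (fun i => (i.1, ⟨i.2.1, Finset.mem_insert_of_mem i.2.2⟩))
    fun l => (l, ⟨y, Finset.mem_insert_self _ _⟩)) <| by
    constructor
    · rintro (⟨l, z, hz⟩ | l) (⟨l', z', hz'⟩ | l') h <;> simp at h ⊢
      · exact h
      · exact hy (h.2 ▸ hz)
      · exact hy (h.2 ▸ hz')
      · exact h
    · rintro ⟨l, z, hz⟩
      rcases Finset.mem_insert.1 hz with rfl | hz'
      · exact ⟨.inr l, rfl⟩
      · exact ⟨.inl (l, ⟨z, hz'⟩), rfl⟩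

theorem rowsPartFun_insert (θ : Fin T → ℝ) {S : Finset ℤ} {y : ℤ} (hy : y ∉ S) (a b : Edge T) :
    rowsPartFun θ (insert y S) a b = ∑ c : Fin T × S → RState, (∏ i, RState.wt (θ i.1) (c i)) *
      ∑ d : Fin T → RState, (∏ l, RState.wt (θ l) (d l)) *
        pathInd a b fun e g => stepRel (fun l => side4 (l, y)) d e g ∨
          stepRel (fun i : Fin T × S => side4 (i.1, i.2.1)) c e g := by
  rw [rowsPartFun, ← partFun_reindex (insertRow T hy), partFun_sum]
  rfl

/-- A row of rhombi that contains only one arc, through the side between two adjacent rhombi. -/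
theorem stepRel_single {p q : Fin T} (hpq : p ≠ q) {y : ℤ} {s t : RState} {x z w : Edge T}
    (hs : ∀ e g, (∃ r ∈ s.pairs, e = side4 (p, y) r.1 ∧ g = side4 (p, y) r.2 ∨
      e = side4 (p, y) r.2 ∧ g = side4 (p, y) r.1) ↔ (e = w ∧ g = x ∨ e = x ∧ g = w))
    (ht : ∀ e g, (∃ r ∈ t.pairs, e = side4 (q, y) r.1 ∧ g = side4 (q, y) r.2 ∨
      e = side4 (q, y) r.2 ∧ g = side4 (q, y) r.1) ↔ (e = w ∧ g = z ∨ e = z ∧ g = w)) (e g : Edge T) :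
    stepRel (fun l => side4 (l, y)) (fun l => if l = p then s else if l = q then t else .O) e g ↔
      (e = w ∧ g = x ∨ e = x ∧ g = w) ∨ (e = w ∧ g = z ∨ e = z ∧ g = w) := by
  rw [← hs, ← ht]
  constructor
  · rintro ⟨l, r, hr, h⟩
    dsimp only at hr
    split_ifs at hr with h1 h2
    · subst h1; exact .inl ⟨r, hr, h⟩
    · subst h2; exact .inr ⟨r, hr, h⟩
    · simp [RState.pairs] at hr
  · rintro (⟨r, hr, h⟩ | ⟨r, hr, h⟩)
    · exact ⟨p, r, by simpa using hr, h⟩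
    · exact ⟨q, r, by simpa [hpq.symm] using hr, h⟩

theorem side4_eq_vert {r : Rhombus T} {s : Fin 4} {k : Fin (T + 1)} {j : ℤ} (h : side4 r s = .vert k j) :
    r.2 = j := by
  fin_cases s <;> simp [side4, west, north, east, south] at h <;> exact h.2

theorem side4_eq_horiz {r : Rhombus T} {s : Fin 4} {k : Fin T} {j : ℤ} (h : side4 r s = .horiz k j) :
    r.1 = k := by
  fin_cases s <;> simp [side4, west, north, east, south] at h <;> exact h.1

section
variable {θ : Fin T → ℝ} (hθ : ∀ k, θ k ∈ Set.Icc (π / 3) (2 * π / 3))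
include hθ

theorem capPartFun_nonneg (S : Finset ℤ) (x y a b : Edge T) : 0 ≤ capPartFun θ S x y a b :=
  Finset.sum_nonneg fun _ _ => mul_nonneg (Finset.prod_nonneg fun _ _ => RState.wt_nonneg (hθ _) _)
    (pathInd_nonneg _ _ _)

theorem rowsPartFun_le_insert {S : Finset ℤ} {y : ℤ} (hy : y ∉ S) (a b : Edge T) :
    rowsPartFun θ S a b ≤ rowsPartFun θ (insert y S) a b := by
  classical
  rw [rowsPartFun_insert θ hy, rowsPartFun, partFun]
  refine Finset.sum_le_sum fun c _ => ?_
  refine mul_le_mul_of_nonneg_left ?_ (Finset.prod_nonneg fun _ _ => RState.wt_nonneg (hθ _) _)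
  refine le_trans ?_ (Finset.single_le_sum (fun d _ => mul_nonneg
    (Finset.prod_nonneg fun _ _ => RState.wt_nonneg (hθ _) _) (pathInd_nonneg _ _ _))
    (Finset.mem_univ fun _ => RState.O))
  simp only [RState.wt, Finset.prod_const_one, one_mul]
  exact le_of_eq (pathInd_congr (IsPath.congr fun e g => by simp [stepRel, RState.pairs]))

/-- An arc added to the rows in `S` along their boundary can be replaced by two arcs in a new row. -/
theorem rowsPartFun_add_capPartFun_le {S : Finset ℤ} {y h : ℤ} (hy : y ∉ S) {p q : Fin T}
    (hpq : p.succ = q.castSucc) {s t : RState} (hs0 : s ≠ .O)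
    {a b : Edge T} (ha : a ≠ .vert p.succ y) (hb : b ≠ .vert p.succ y)
    (hs : ∀ e g, (∃ r ∈ s.pairs, e = side4 (p, y) r.1 ∧ g = side4 (p, y) r.2 ∨
      e = side4 (p, y) r.2 ∧ g = side4 (p, y) r.1) ↔
      (e = .vert p.succ y ∧ g = .horiz p h ∨ e = .horiz p h ∧ g = .vert p.succ y))
    (ht : ∀ e g, (∃ r ∈ t.pairs, e = side4 (q, y) r.1 ∧ g = side4 (q, y) r.2 ∨
      e = side4 (q, y) r.2 ∧ g = side4 (q, y) r.1) ↔
      (e = .vert p.succ y ∧ g = .horiz q h ∨ e = .horiz q h ∧ g = .vert p.succ y)) :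
    rowsPartFun θ S a b + s.wt (θ p) * t.wt (θ q) * capPartFun θ S (.horiz p h) (.horiz q h) a b ≤
      rowsPartFun θ (insert y S) a b := by
  classical
  have hne : p ≠ q := by
    rintro rfl
    have := congrArg Fin.val hpq
    simp at this
  rw [rowsPartFun_insert θ hy, rowsPartFun, partFun, capPartFun, Finset.mul_sum, ← Finset.sum_add_distrib]
  refine Finset.sum_le_sum fun c _ => ?_
  rw [mul_left_comm, ← mul_add]
  refine mul_le_mul_of_nonneg_left ?_ (Finset.prod_nonneg fun _ _ => RState.wt_nonneg (hθ _) _)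
  set d₁ : Fin T → RState := fun l => if l = p then s else if l = q then t else .O with hd₁
  have hd : (fun _ => RState.O) ≠ d₁ := fun h => hs0 (by simpa [hd₁] using (congrFun h p).symm)
  refine le_trans ?_ (Finset.sum_le_sum_of_subset_of_nonneg
    (Finset.subset_univ {(fun _ => RState.O), d₁}) fun d _ _ => mul_nonneg
      (Finset.prod_nonneg fun _ _ => RState.wt_nonneg (hθ _) _) (pathInd_nonneg _ _ _))
  rw [Finset.sum_pair hd]
  simp only [RState.wt_O, Finset.prod_const_one, one_mul]
  have hprod : ∏ l, RState.wt (θ l) (d₁ l) = s.wt (θ p) * t.wt (θ q) := by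
    rw [← Finset.prod_subset (Finset.subset_univ {p, q}), Finset.prod_pair hne]
    · simp [hd₁, hne.symm]
    · intro l _ hl
      simp only [Finset.mem_insert, Finset.mem_singleton, not_or] at hl
      simp [hd₁, hl, RState.wt_O]
  rw [hprod]
  refine add_le_add (le_of_eq (pathInd_congr (IsPath.congr fun e g => by simp [stepRel, RState.pairs])))
    (mul_le_mul_of_nonneg_left (le_of_eq (pathInd_congr ?_))
      (mul_nonneg (RState.wt_nonneg (hθ _) _) (RState.wt_nonneg (hθ _) _)))
  symm
  have hv : ∀ z i s, side4 ((i : Fin T × S).1, i.2.1) s = z → z ≠ .vert p.succ y := by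
    rintro z i s rfl h
    exact hy (side4_eq_vert h ▸ i.2.2)
  have hR : ∀ x x', x = .vert p.succ y ∨ x' = .vert p.succ y →
      ¬ stepRel (fun i : Fin T × S => side4 (i.1, i.2.1)) c x x' := by
    rintro x x' hx ⟨i, r, -, ⟨h1, h2⟩ | ⟨h1, h2⟩⟩ <;> rcases hx with hx | hx
    all_goals first | exact hv _ _ _ h1.symm hx | exact hv _ _ _ h2.symm hx
  have hR' : ∀ k l h', k ≠ l → ¬ stepRel (fun i : Fin T × S => side4 (i.1, i.2.1)) c
      (.horiz k h') (.horiz l h') := by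
    rintro k l h' hkl ⟨i, r, -, ⟨h1, h2⟩ | ⟨h1, h2⟩⟩ <;>
      exact hkl ((side4_eq_horiz h1.symm).symm.trans (side4_eq_horiz h2.symm))
  rw [← isPath_contract (v := .vert p.succ y) ha.symm hb.symm (fun z => hR _ _ (.inl rfl))
    (fun z => hR _ _ (.inr rfl)) (by simpa using hne) (by simp) (by simp) (hR' _ _ _ hne)
    (hR' _ _ _ hne.symm)]
  exact IsPath.congr fun e g => by rw [stepRel_single hne hs ht]

end

/-! ### Pushing a rhombus through two adjacent columns -/

/-- The sides of the rhombi of the strip when an additional rhombus is inserted in the columns `p`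
and `q`, below row `j`. In these two columns the horizontal edges at height `j` are doubled, and the
horizontal edges above are renumbered accordingly. -/
def pushSide (p q : Fin T) (j : ℤ) (r : Rhombus T) : Fin 4 → Edge T :=
  if (r.1 = p ∨ r.1 = q) ∧ j ≤ r.2 then ![west r, .horiz r.1 (r.2 + 2), east r, .horiz r.1 (r.2 + 1)]
  else side4 r

/-- The sides of the inserted rhombus: lower left, upper left, upper right, lower right. -/
def insertedSide (p q : Fin T) (j : ℤ) : Fin 4 → Edge T :=
  ![.horiz p j, .horiz p (j + 1), .horiz q (j + 1), .horiz q j]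

/-- The angles of the columns `p` and `q` are exchanged above the inserted rhombus. -/
def pushAngle (θ : Fin T → ℝ) (p q : Fin T) (j : ℤ) (r : Rhombus T) : ℝ :=
  if j ≤ r.2 then θ (Equiv.swap p q r.1) else θ r.1

/-- The partition function of the rows in `S` with an additional rhombus inserted below row `j`. -/
def pushPartFun (θ : Fin T → ℝ) (p q : Fin T) (S : Finset ℤ) (j : ℤ) (a b : Edge T) : ℝ :=
  partFun (Sum.elim (fun i : Fin T × S => pushSide p q j (i.1, i.2.1)) fun _ : Unit => insertedSide p q j)
    (Sum.elim (fun i => RState.wt (pushAngle θ p q j (i.1, i.2.1))) fun _ => RState.wt (θ q - θ p)) a b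

/-- The hexagon formed by the inserted rhombus and the rhombi of row `y` in the columns `p`, `q`. -/
def hexLabel (p q : Fin T) (y : ℤ) : Fin 9 → Edge T :=
  ![.vert p.castSucc y, .horiz p y, .horiz q y, .vert q.succ y, .horiz q (y + 2), .horiz p (y + 2),
    .vert p.succ y, .horiz p (y + 1), .horiz q (y + 1)]

theorem hexLabel_injective {p q : Fin T} (hpq : p.succ = q.castSucc) (y : ℤ) :
    (hexLabel p q y).Injective := by
  have h := congrArg Fin.val hpq
  simp only [Fin.val_succ, Fin.val_castSucc] at h
  intro m m' hm
  fin_cases m <;> fin_cases m' <;> simp [hexLabel, Fin.ext_iff] at hm ⊢ <;> omega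

/-- How the sides of the rhombi outside the hexagon meet the sides of the hexagon. -/
theorem pushSide_eq_hexLabel {p q : Fin T} (hpq : p.succ = q.castSucc) {y j : ℤ} {r : Rhombus T}
    (hj : j = y ∨ j = y + 1) (hp : r ≠ (p, y)) (hq : r ≠ (q, y)) {s : Fin 4} {m : Fin 9}
    (h : pushSide p q j r s = hexLabel p q y m) :
    (m = 0 ∧ r.2 = y ∧ r.1.val + 1 = p) ∨ (m = 3 ∧ r.2 = y ∧ r.1.val = q + 1) ∨
      (m = 1 ∧ r.2 < y ∧ r.1 = p) ∨ (m = 2 ∧ r.2 < y ∧ r.1 = q) ∨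
        (m = 4 ∧ y < r.2 ∧ r.1 = q) ∨ (m = 5 ∧ y < r.2 ∧ r.1 = p) := by
  have h0 := congrArg Fin.val hpq
  obtain ⟨l, z⟩ := r
  simp only [Fin.val_succ, Fin.val_castSucc] at h0
  simp only [ne_eq, Prod.mk.injEq, not_and, Fin.ext_iff] at hp hq ⊢
  unfold pushSide at h
  split_ifs at h with h1 <;> simp only [Fin.ext_iff] at h1 <;>
  fin_cases s <;> fin_cases m <;>
  simp [hexLabel, side4, west, east, north, south, Fin.ext_iff] at h ⊢ <;> omega

/-- The rhombi of the rows in `S` with the inserted rhombus, with those that form a hexagon listed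
separately. -/
def splitHex {p q : Fin T} (hpq : p ≠ q) {S : Finset ℤ} {y : ℤ} (hy : y ∈ S) :
    {i : Fin T × S // i ≠ (p, ⟨y, hy⟩) ∧ i ≠ (q, ⟨y, hy⟩)} ⊕ Fin 3 ≃ (Fin T × S) ⊕ Unit :=
  Equiv.ofBijective (Sum.elim (fun i => .inl i.1) ![.inl (p, ⟨y, hy⟩), .inl (q, ⟨y, hy⟩), .inr ()]) <| by
    constructor
    · rintro (⟨i, hi1, hi2⟩ | m) (⟨i', hi1', hi2'⟩ | m') h
      · simpa using h
      · fin_cases m' <;> simp at h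
        · exact absurd h hi1
        · exact absurd h hi2
      · fin_cases m <;> simp at h
        · exact absurd h.symm hi1'
        · exact absurd h.symm hi2'
      · fin_cases m <;> fin_cases m' <;> simp [hpq, hpq.symm] at h ⊢
    · rintro (i | ⟨⟩)
      · by_cases h1 : i = (p, ⟨y, hy⟩)
        · exact ⟨.inr 0, by simp [h1]⟩
        by_cases h2 : i = (q, ⟨y, hy⟩)
        · exact ⟨.inr 1, by simp [h2]⟩
        exact ⟨.inl ⟨i, h1, h2⟩, rfl⟩
      · exact ⟨.inr 2, rfl⟩

theorem splitHex_zero {p q : Fin T} (hpq : p ≠ q) {S : Finset ℤ} {y : ℤ} (hy : y ∈ S) :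
    splitHex hpq hy (.inr 0) = .inl (p, ⟨y, hy⟩) := rfl

theorem splitHex_one {p q : Fin T} (hpq : p ≠ q) {S : Finset ℤ} {y : ℤ} (hy : y ∈ S) :
    splitHex hpq hy (.inr 1) = .inl (q, ⟨y, hy⟩) := rfl

theorem splitHex_two {p q : Fin T} (hpq : p ≠ q) {S : Finset ℤ} {y : ℤ} (hy : y ∈ S) :
    splitHex hpq hy (.inr 2) = .inr () := rfl

theorem pushPartFun_succ (θ : Fin T → ℝ) {p q : Fin T} (hpq : p.succ = q.castSucc) {S : Finset ℤ} {y : ℤ}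
    (hy : y ∈ S) {a b : Edge T} (ha : ∀ j, a ≠ .vert p.succ j) (hb : ∀ j, b ≠ .vert p.succ j)
    (ha' : ∀ l j, a ≠ .horiz l j) (hb' : ∀ l j, b ≠ .horiz l j)
    (hp : den (θ p) ≠ 0) (hq : den (θ q) ≠ 0) (hd : den (θ q - θ p) ≠ 0) :
    pushPartFun θ p q S (y + 1) a b = pushPartFun θ p q S y a b := by
  have h0 := congrArg Fin.val hpq
  simp only [Fin.val_succ, Fin.val_castSucc] at h0
  have hne : p ≠ q := by rintro rfl; omega
  have hout : ∀ i : {i : Fin T × S // i ≠ (p, ⟨y, hy⟩) ∧ i ≠ (q, ⟨y, hy⟩)},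
      (i.1.1, i.1.2.1) ≠ (p, y) ∧ (i.1.1, i.1.2.1) ≠ (q, y) := by
    rintro ⟨⟨l, z, hz⟩, h1, h2⟩
    simpa using And.intro h1 h2
  have hsame : ∀ r : Rhombus T, r ≠ (p, y) → r ≠ (q, y) → pushSide p q (y + 1) r = pushSide p q y r ∧
      pushAngle θ p q (y + 1) r = pushAngle θ p q y r := by
    rintro ⟨l, z⟩ h1 h2
    simp only [ne_eq, Prod.mk.injEq, not_and] at h1 h2
    unfold pushSide pushAngle
    dsimp only
    rcases lt_trichotomy z y with hz | hz | hz
    · simp [not_le.2 hz, show ¬ y + 1 ≤ z by omega]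
    · have hlp : l ≠ p := fun h => h1 h hz
      have hlq : l ≠ q := fun h => h2 h hz
      simp [hlp, hlq, Equiv.swap_apply_of_ne_of_ne]
    · simp [hz.le, show y + 1 ≤ z by omega]
  have key := partFun_hexagon
    (κ := {i : Fin T × S // i ≠ (p, ⟨y, hy⟩) ∧ i ≠ (q, ⟨y, hy⟩)})
    (fun i => pushSide p q y (i.1.1, i.1.2.1))
    (fun i => RState.wt (pushAngle θ p q y (i.1.1, i.1.2.1)))
    (hexLabel_injective hpq y) (a := a) (b := b) ?_ ?_ hp hq hd
  · rw [pushPartFun, pushPartFun, ← partFun_reindex (splitHex hne hy),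
      ← partFun_reindex (splitHex hne hy) _ (Sum.elim (fun i => RState.wt (pushAngle θ p q y (i.1, i.2.1))) _)]
    convert key using 2
    · ext i s
      rcases i with i | i
      · exact congrFun (hsame _ (hout i).1 (hout i).2).1 s
      · obtain rfl | rfl | rfl : i = 0 ∨ i = 1 ∨ i = 2 := by fin_cases i <;> simp
        all_goals fin_cases s <;>
          simp [splitHex_zero, splitHex_one, splitHex_two, pushSide, side4, insertedSide, hexLabel, hexTop, west, east, north, south, hpq, add_assoc]
    · ext i s
      rcases i with i | i
      · exact congrArg (fun x => RState.wt x s) (hsame _ (hout i).1 (hout i).2).2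
      · obtain rfl | rfl | rfl : i = 0 ∨ i = 1 ∨ i = 2 := by fin_cases i <;> simp
        all_goals simp [splitHex_zero, splitHex_one, splitHex_two, pushAngle]
    · ext i s
      rcases i with i | i
      · rfl
      · obtain rfl | rfl | rfl : i = 0 ∨ i = 1 ∨ i = 2 := by fin_cases i <;> simp
        all_goals fin_cases s <;>
          simp [splitHex_zero, splitHex_one, splitHex_two, pushSide, side4, insertedSide, hexLabel, hexBot, west, east, north, south, hpq]
    · ext i s
      rcases i with i | i
      · rfl
      · obtain rfl | rfl | rfl : i = 0 ∨ i = 1 ∨ i = 2 := by fin_cases i <;> simp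
        all_goals simp [splitHex_zero, splitHex_one, splitHex_two, pushAngle]
  · intro n hn
    refine ⟨?_, ?_, fun i s h => ?_⟩
    · fin_cases n <;> simp at hn <;> first | exact (ha _).symm | exact (ha' _ _).symm
    · fin_cases n <;> simp at hn <;> first | exact (hb _).symm | exact (hb' _ _).symm
    · rcases pushSide_eq_hexLabel hpq (.inl rfl) (hout i).1 (hout i).2 h with h | h | h | h | h | h <;>
      · rw [h.1] at hn; exact absurd hn (by decide)
  · intro i s s' m m' h h'
    have h1 := pushSide_eq_hexLabel hpq (.inl rfl) (hout i).1 (hout i).2 h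
    have h2 := pushSide_eq_hexLabel hpq (.inl rfl) (hout i).1 (hout i).2 h'
    simp only [Fin.ext_iff] at h1 h2 ⊢
    simp at h1 h2
    omega

theorem pushPartFun_eq (θ : Fin T → ℝ) {p q : Fin T} (hpq : p.succ = q.castSucc)
    {a b : Edge T} (ha : ∀ j, a ≠ .vert p.succ j) (hb : ∀ j, b ≠ .vert p.succ j)
    (ha' : ∀ l j, a ≠ .horiz l j) (hb' : ∀ l j, b ≠ .horiz l j)
    (hp : den (θ p) ≠ 0) (hq : den (θ q) ≠ 0) (hd : den (θ q - θ p) ≠ 0) (m : ℤ) (n : ℕ) (S : Finset ℤ)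
    (hS : Finset.Ico m (m + n) ⊆ S) : pushPartFun θ p q S (m + n) a b = pushPartFun θ p q S m a b := by
  induction n with
  | zero => simp
  | succ n ih =>
    rw [← ih ((Finset.Ico_subset_Ico_right (by push_cast; omega)).trans hS)]
    have : m + n ∈ S := hS (by simp)
    rw [← pushPartFun_succ θ hpq this ha hb ha' hb' hp hq hd]
    push_cast; ring_nf

theorem not_isPath_of_dead_end {a b v w : Edge T} {R : Edge T → Edge T → Prop} (hva : v ≠ a) (hvb : v ≠ b)
    (hvw : R v w) (hR : ∀ z, R v z → z = w) : ¬ IsPath a b R := by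
  intro h
  obtain ⟨x, y, hxy, h1, -⟩ := h.neighbours hvw hva hvb
  exact hxy ((hR _ ((h1 x).2 (.inl rfl))).trans (hR _ ((h1 y).2 (.inr rfl))).symm)

/-- Inserting a rhombus two sides of which are on the boundary: only the states in which these sides
are not used contribute. -/
theorem partFun_insert_boundary {ι : Type*} [Fintype ι] (side : ι → Fin 4 → Edge T)
    (wt : ι → RState → ℝ) (g : Fin 4 → Edge T) (θ : ℝ) {a b : Edge T} (hg : g.Injective) {s₁ s₂ : Fin 4}
    (h₁ : g s₁ ≠ a ∧ g s₁ ≠ b ∧ ∀ i s, side i s ≠ g s₁) (h₂ : g s₂ ≠ a ∧ g s₂ ≠ b ∧ ∀ i s, side i s ≠ g s₂)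
    {t : RState} (ht : t = .ws ∧ s₁ = 1 ∧ s₂ = 2 ∨ t = .ne ∧ s₁ = 0 ∧ s₂ = 3) {x y : Edge T}
    (hxy : ∀ e f, (∃ p ∈ t.pairs, e = g p.1 ∧ f = g p.2 ∨ e = g p.2 ∧ f = g p.1) ↔
      (e = x ∧ f = y ∨ e = y ∧ f = x)) :
    partFun (Sum.elim side fun _ : Unit => g) (Sum.elim wt fun _ => RState.wt θ) a b =
      partFun side wt a b + u₂ θ * ∑ c : ι → RState, (∏ i, wt i (c i)) *
        pathInd a b fun e f => (e = x ∧ f = y ∨ e = y ∧ f = x) ∨ stepRel side c e f := by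
  rw [partFun_sum, partFun, Finset.mul_sum, ← Finset.sum_add_distrib]
  refine Finset.sum_congr rfl fun c _ => ?_
  rw [mul_left_comm, ← mul_add]
  congr 1
  have hsum : ∀ F : (Unit → RState) → ℝ, ∑ d, F d = ∑ t : RState, F fun _ => t := fun F =>
    Fintype.sum_equiv (Equiv.funUnique Unit RState) _ _ fun d => by congr 1
  rw [hsum]
  have hrel : ∀ t e f, stepRel (fun _ : Unit => g) (fun _ => t) e f ↔
      ∃ p ∈ t.pairs, e = g p.1 ∧ f = g p.2 ∨ e = g p.2 ∧ f = g p.1 := fun t e f => by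
    simp [stepRel]
  have hdead : ∀ (t' : RState) (s : Fin 4), (g s ≠ a ∧ g s ≠ b ∧ ∀ i s', side i s' ≠ g s) →
      (∃ s', (∃ p ∈ t'.pairs, s = p.1 ∧ s' = p.2 ∨ s = p.2 ∧ s' = p.1) ∧
        ∀ z, (∃ p ∈ t'.pairs, s = p.1 ∧ z = p.2 ∨ s = p.2 ∧ z = p.1) → z = s') →
      pathInd a b (fun e f => stepRel (fun _ : Unit => g) (fun _ => t') e f ∨ stepRel side c e f) = 0 := by
    rintro t' s ⟨h1, h2, h3⟩ ⟨s', ⟨p, hp, hps⟩, hu⟩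
    refine if_neg (not_isPath_of_dead_end (w := g s') h1 h2 (.inl ((hrel _ _ _).2 ⟨p, hp, ?_⟩)) ?_)
    · rintro z (hz | ⟨i, p, -, ⟨hz, -⟩ | ⟨hz, -⟩⟩)
      · obtain ⟨p, hp, ⟨e1, rfl⟩ | ⟨e1, rfl⟩⟩ := (hrel _ _ _).1 hz
        · rw [hu p.2 ⟨p, hp, .inl ⟨hg e1, rfl⟩⟩]
        · rw [hu p.1 ⟨p, hp, .inr ⟨hg e1, rfl⟩⟩]
      · exact absurd hz.symm (h3 _ _)
      · exact absurd hz.symm (h3 _ _)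
    · rcases hps with ⟨rfl, rfl⟩ | ⟨rfl, rfl⟩ <;> simp
  have hempty : pathInd a b (fun e f => stepRel (fun _ : Unit => g) (fun _ => .O) e f ∨ stepRel side c e f) =
      pathInd a b (stepRel side c) :=
    pathInd_congr (IsPath.congr fun e f => by rw [hrel]; simp [RState.pairs])
  have hcap : pathInd a b (fun e f => stepRel (fun _ : Unit => g) (fun _ => t) e f ∨ stepRel side c e f) =
      pathInd a b fun e f => (e = x ∧ f = y ∨ e = y ∧ f = x) ∨ stepRel side c e f :=
    pathInd_congr (IsPath.congr fun e f => by rw [hrel, hxy])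
  have hzero : ∀ t' : RState, t' ≠ .O → t' ≠ t →
      pathInd a b (fun e f => stepRel (fun _ : Unit => g) (fun _ => t') e f ∨ stepRel side c e f) = 0 := by
    intro t' h0 ht'
    have dec1 : ∀ t' : RState, t' ≠ .O → t' ≠ .ws → ∃ s : Fin 4, (s = 1 ∨ s = 2) ∧
      ∃ s', (∃ p ∈ t'.pairs, s = p.1 ∧ s' = p.2 ∨ s = p.2 ∧ s' = p.1) ∧
        ∀ z, (∃ p ∈ t'.pairs, s = p.1 ∧ z = p.2 ∨ s = p.2 ∧ z = p.1) → z = s' := by decide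
    have dec2 : ∀ t' : RState, t' ≠ .O → t' ≠ .ne → ∃ s : Fin 4, (s = 0 ∨ s = 3) ∧
      ∃ s', (∃ p ∈ t'.pairs, s = p.1 ∧ s' = p.2 ∨ s = p.2 ∧ s' = p.1) ∧
        ∀ z, (∃ p ∈ t'.pairs, s = p.1 ∧ z = p.2 ∨ s = p.2 ∧ z = p.1) → z = s' := by decide
    rcases ht with ⟨rfl, rfl, rfl⟩ | ⟨rfl, rfl, rfl⟩
    · obtain ⟨s, rfl | rfl, hs⟩ := dec1 t' h0 ht'
      · exact hdead t' _ h₁ hs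
      · exact hdead t' _ h₂ hs
    · obtain ⟨s, rfl | rfl, hs⟩ := dec2 t' h0 ht'
      · exact hdead t' _ h₁ hs
      · exact hdead t' _ h₂ hs
  have htO : t ≠ .O := by rcases ht with ⟨rfl, -⟩ | ⟨rfl, -⟩ <;> decide
  have hwt : RState.wt θ t = u₂ θ := by rcases ht with ⟨rfl, -⟩ | ⟨rfl, -⟩ <;> rfl
  rw [← Finset.sum_subset (Finset.subset_univ {RState.O, t})]
  · rw [Finset.sum_pair htO.symm]
    simp only [Sum.elim_inr, Sum.elim_inl, Finset.univ_unique, Finset.prod_singleton]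
    rw [hempty, hcap, hwt, RState.wt_O, one_mul]
  · intro t' _ ht'
    simp only [Finset.mem_insert, Finset.mem_singleton, not_or] at ht'
    simp only [Sum.elim_inr, Sum.elim_inl]
    rw [hzero t' ht'.1 ht'.2, mul_zero]

theorem insertedSide_injective {p q : Fin T} (hpq : p ≠ q) (j : ℤ) : (insertedSide p q j).Injective := by
  intro s s' h
  fin_cases s <;> fin_cases s' <;> simp [insertedSide, hpq, hpq.symm] at h ⊢

theorem insertedSide_ws (p q : Fin T) (j : ℤ) (e f : Edge T) :
    (∃ r ∈ RState.ws.pairs, e = insertedSide p q j r.1 ∧ f = insertedSide p q j r.2 ∨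
      e = insertedSide p q j r.2 ∧ f = insertedSide p q j r.1) ↔
      (e = .horiz p j ∧ f = .horiz q j ∨ e = .horiz q j ∧ f = .horiz p j) := by
  simp [RState.pairs, insertedSide]

theorem insertedSide_ne (p q : Fin T) (j : ℤ) (e f : Edge T) :
    (∃ r ∈ RState.ne.pairs, e = insertedSide p q j r.1 ∧ f = insertedSide p q j r.2 ∨
      e = insertedSide p q j r.2 ∧ f = insertedSide p q j r.1) ↔
      (e = .horiz p (j + 1) ∧ f = .horiz q (j + 1) ∨ e = .horiz q (j + 1) ∧ f = .horiz p (j + 1)) := by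
  simp [RState.pairs, insertedSide]

theorem side4_ne_horiz {l : Fin T} {z : ℤ} (k : Fin T) {j : ℤ} (h : j < z ∨ z + 1 < j) (s : Fin 4) :
    side4 (l, z) s ≠ .horiz k j := by
  fin_cases s <;> simp [side4, west, east, north, south] <;> omega

/-- With the inserted rhombus above all rows. -/
theorem pushPartFun_top (θ : Fin T → ℝ) {p q : Fin T} (hpq : p ≠ q) {a b : Edge T}
    (ha : ∀ l j, a ≠ .horiz l j) (hb : ∀ l j, b ≠ .horiz l j) {j : ℤ} {S : Finset ℤ}
    (hS : ∀ y ∈ S, y < j) :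
    pushPartFun θ p q S j a b = rowsPartFun θ S a b +
      u₂ (θ q - θ p) * capPartFun θ S (.horiz p j) (.horiz q j) a b := by
  have e1 : (fun i : Fin T × S => pushSide p q j (i.1, i.2.1)) = fun i => side4 (i.1, i.2.1) := by
    ext1 ⟨l, y, hy⟩
    simp [pushSide, hS y hy]
  have e2 : (fun i : Fin T × S => RState.wt (pushAngle θ p q j (i.1, i.2.1))) = fun i => RState.wt (θ i.1) := by
    ext1 ⟨l, y, hy⟩
    simp [pushAngle, not_le.2 (hS y hy)]
  rw [pushPartFun, e1, e2]
  refine partFun_insert_boundary (s₁ := 1) (s₂ := 2) _ _ _ _ (insertedSide_injective hpq j) ⟨(ha _ _).symm, (hb _ _).symm, ?_⟩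
    ⟨(ha _ _).symm, (hb _ _).symm, ?_⟩ (.inl ⟨rfl, rfl, rfl⟩) (insertedSide_ws p q j)
  all_goals
    rintro ⟨l, y, hy⟩ s
    exact side4_ne_horiz _ (.inr (by have := hS y hy; dsimp only; omega)) s

/-- Moving the horizontal edges in the columns `p` and `q` up by one. -/
def shiftEquiv (p q : Fin T) : Edge T ≃ Edge T where
  toFun
    | .vert k j => .vert k j
    | .horiz k j => if k = p ∨ k = q then .horiz k (j + 1) else .horiz k j
  invFun
    | .vert k j => .vert k j
    | .horiz k j => if k = p ∨ k = q then .horiz k (j - 1) else .horiz k j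
  left_inv e := by
    cases e with
    | vert k j => rfl
    | horiz k j => by_cases h : k = p ∨ k = q <;> simp [h]
  right_inv e := by
    cases e with
    | vert k j => rfl
    | horiz k j => by_cases h : k = p ∨ k = q <;> simp [h]

/-- With the inserted rhombus below all rows. -/
theorem pushPartFun_bot (θ : Fin T → ℝ) {p q : Fin T} (hpq : p ≠ q) {a b : Edge T}
    (ha : ∀ l j, a ≠ .horiz l j) (hb : ∀ l j, b ≠ .horiz l j) {j : ℤ} {S : Finset ℤ}
    (hS : ∀ y ∈ S, j ≤ y) :
    pushPartFun θ p q S j a b = rowsPartFun (θ ∘ Equiv.swap p q) S a b +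
      u₂ (θ q - θ p) * capPartFun (θ ∘ Equiv.swap p q) S (.horiz p j) (.horiz q j) a b := by
  have hfix : ∀ e : Edge T, (∀ l j, e ≠ .horiz l j) → shiftEquiv p q e = e := by
    rintro (⟨k, j⟩ | ⟨k, j⟩) h
    · rfl
    · exact absurd rfl (h k j)
  have e1 : (Sum.elim (fun i : Fin T × S => pushSide p q j (i.1, i.2.1)) fun _ : Unit => insertedSide p q j) =
      fun i s => shiftEquiv p q (Sum.elim (fun i : Fin T × S => side4 (i.1, i.2.1))
        (fun _ : Unit => insertedSide p q (j - 1)) i s) := by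
    ext1 i
    ext1 s
    rcases i with ⟨l, y, hy⟩ | i
    · by_cases h : l = p ∨ l = q <;> fin_cases s <;>
        simp [pushSide, hS y hy, h, shiftEquiv, side4, west, east, north, south, add_assoc]
    · fin_cases s <;> simp [insertedSide, shiftEquiv]
  have e2 : (fun i : Fin T × S => RState.wt (pushAngle θ p q j (i.1, i.2.1))) =
      fun i => RState.wt ((θ ∘ Equiv.swap p q) i.1) := by
    ext1 ⟨l, y, hy⟩
    simp [pushAngle, hS y hy]
  rw [pushPartFun, e1, e2]
  conv_lhs => rw [← hfix a ha, ← hfix b hb]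
  rw [partFun_relabel]
  have e3 := insertedSide_ne p q (j - 1)
  rw [sub_add_cancel] at e3
  refine partFun_insert_boundary (s₁ := 0) (s₂ := 3) _ _ _ _ (insertedSide_injective hpq _) ⟨(ha _ _).symm, (hb _ _).symm, ?_⟩
    ⟨(ha _ _).symm, (hb _ _).symm, ?_⟩ (.inr ⟨rfl, rfl, rfl⟩) e3
  all_goals
    rintro ⟨l, y, hy⟩ s
    exact side4_ne_horiz _ (.inl (by have := hS y hy; dsimp only; omega)) s

/-- The effect on the partition function of exchanging the angles of two adjacent columns, up to
terms that come from the top and the bottom. -/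
theorem rowsPartFun_swap (θ : Fin T → ℝ) {p q : Fin T} (hpq : p.succ = q.castSucc)
    {a b : Edge T} (ha : ∀ j, a ≠ .vert p.succ j) (hb : ∀ j, b ≠ .vert p.succ j)
    (ha' : ∀ l j, a ≠ .horiz l j) (hb' : ∀ l j, b ≠ .horiz l j)
    (hp : den (θ p) ≠ 0) (hq : den (θ q) ≠ 0) (hd : den (θ q - θ p) ≠ 0) (m : ℤ) (n : ℕ) :
    rowsPartFun θ (Finset.Ico m (m + n)) a b + u₂ (θ q - θ p) *
        capPartFun θ (Finset.Ico m (m + n)) (.horiz p (m + n)) (.horiz q (m + n)) a b =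
      rowsPartFun (θ ∘ Equiv.swap p q) (Finset.Ico m (m + n)) a b + u₂ (θ q - θ p) *
        capPartFun (θ ∘ Equiv.swap p q) (Finset.Ico m (m + n)) (.horiz p m) (.horiz q m) a b := by
  have hne : p ≠ q := by
    rintro rfl
    have := congrArg Fin.val hpq
    simp at this
  rw [← pushPartFun_top θ hne ha' hb' (fun y hy => (Finset.mem_Ico.1 hy).2),
    ← pushPartFun_bot θ hne ha' hb' (fun y hy => (Finset.mem_Ico.1 hy).1)]
  exact pushPartFun_eq θ hpq ha hb ha' hb' hp hq hd m n _ subset_rfl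

section
variable {θ : Fin T → ℝ} (hθ : ∀ k, θ k ∈ Set.Icc (π / 3) (2 * π / 3))
include hθ

theorem capPartFun_top_le {p q : Fin T} (hpq : p.succ = q.castSucc) {a b : Edge T}
    (ha : ∀ j, a ≠ .vert p.succ j) (hb : ∀ j, b ≠ .vert p.succ j) {S : Finset ℤ} {y : ℤ} (hy : y ∉ S) :
    rowsPartFun θ S a b + u₁ (θ p) * u₂ (θ q) * capPartFun θ S (.horiz p y) (.horiz q y) a b ≤
      rowsPartFun θ (insert y S) a b := by
  refine rowsPartFun_add_capPartFun_le hθ hy hpq (s := .se) (t := .ws) (by decide) (ha y) (hb y) ?_ ?_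
  · intro e g
    simp [RState.pairs, side4, south, east]; tauto
  · intro e g
    simp [RState.pairs, side4, south, west, hpq]

theorem capPartFun_bot_le {p q : Fin T} (hpq : p.succ = q.castSucc) {a b : Edge T}
    (ha : ∀ j, a ≠ .vert p.succ j) (hb : ∀ j, b ≠ .vert p.succ j) {S : Finset ℤ} {y : ℤ} (hy : y ∉ S) :
    rowsPartFun θ S a b + u₂ (θ p) * u₁ (θ q) * capPartFun θ S (.horiz p (y + 1)) (.horiz q (y + 1)) a b ≤
      rowsPartFun θ (insert y S) a b := by
  refine rowsPartFun_add_capPartFun_le hθ hy hpq (s := .ne) (t := .wn) (by decide) (ha y) (hb y) ?_ ?_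
  · intro e g
    simp [RState.pairs, side4, north, east]; tauto
  · intro e g
    simp [RState.pairs, side4, north, west, hpq]

end

/-! ### Exchanging two columns in the infinite strip -/

open Filter Topology

/-- The rows `-M, …, M - 1`. -/
def box (M : ℕ) : Finset ℤ := Finset.Ico (-M) M

theorem box_succ (M : ℕ) : box (M + 1) = insert (-(M : ℤ) - 1) (insert (M : ℤ) (box M)) := by
  ext y; simp [box]; omega

theorem not_mem_box (M : ℕ) : (M : ℤ) ∉ box M := by simp [box]

theorem not_mem_box' (M : ℕ) : -(M : ℤ) - 1 ∉ box M := by simp [box]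

theorem box_succ' (M : ℕ) : box (M + 1) = insert (M : ℤ) (insert (-(M : ℤ) - 1) (box M)) := by
  ext y; simp [box]; omega

theorem rowsPartFun_box_mono {θ : Fin T → ℝ} (hθ : ∀ k, θ k ∈ Set.Icc (π / 3) (2 * π / 3)) (a b : Edge T) :
    Monotone fun M => rowsPartFun θ (box M) a b := by
  refine monotone_nat_of_le_succ fun M => ?_
  rw [box_succ]
  refine (rowsPartFun_le_insert hθ (not_mem_box M) a b).trans (rowsPartFun_le_insert hθ ?_ a b)
  simp [box]

/-- A sequence of nonnegative terms dominated by the increments of a convergent sequence. -/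
theorem tendsto_zero_of_mul_le_increment {z f : ℕ → ℝ} {A c : ℝ} (hz : Tendsto z atTop (𝓝 A)) (hc : 0 < c)
    (h0 : ∀ M, 0 ≤ f M) (h : ∀ M, z M + c * f M ≤ z (M + 1)) : Tendsto f atTop (𝓝 0) := by
  have h1 : Tendsto (fun M => (z (M + 1) - z M) / c) atTop (𝓝 0) := by
    simpa using (((tendsto_add_atTop_iff_nat 1).2 hz).sub hz).div_const c
  refine squeeze_zero h0 (fun M => ?_) h1
  rw [le_div_iff₀ hc]
  linarith [h M]

/-- In the limit of the infinite strip, two adjacent columns can be exchanged. -/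
theorem limit_rowsPartFun_swap {θ : Fin T → ℝ} (hθ : ∀ k, θ k ∈ Set.Icc (π / 3) (2 * π / 3)) {p q : Fin T}
    (hpq : p.succ = q.castSucc) {a b : Edge T} (ha : ∀ j, a ≠ .vert p.succ j)
    (hb : ∀ j, b ≠ .vert p.succ j) (ha' : ∀ l j, a ≠ .horiz l j) (hb' : ∀ l j, b ≠ .horiz l j)
    {A A' : ℝ} (hA : Tendsto (fun M => rowsPartFun θ (box M) a b) atTop (𝓝 A))
    (hA' : Tendsto (fun M => rowsPartFun (θ ∘ Equiv.swap p q) (box M) a b) atTop (𝓝 A')) : A = A' := by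
  have hθ' : ∀ k, (θ ∘ Equiv.swap p q) k ∈ Set.Icc (π / 3) (2 * π / 3) := fun k => hθ _
  have hπ := Real.pi_pos
  have hden : ∀ k, den (θ k) ≠ 0 := fun k =>
    (den_neg (by linarith [(hθ k).1]) (by linarith [(hθ k).2])).ne
  have hd : den (θ q - θ p) ≠ 0 :=
    (den_neg (by linarith [(hθ q).1, (hθ p).2]) (by linarith [(hθ q).2, (hθ p).1])).ne
  -- the corrections at the top and at the bottom are dominated by the growth of the partition functions
  have key : ∀ M : ℕ, rowsPartFun θ (box M) a b + u₂ (θ q - θ p) *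
        capPartFun θ (box M) (.horiz p M) (.horiz q M) a b =
      rowsPartFun (θ ∘ Equiv.swap p q) (box M) a b + u₂ (θ q - θ p) *
        capPartFun (θ ∘ Equiv.swap p q) (box M) (.horiz p (-M)) (.horiz q (-M)) a b := fun M => by
    have := rowsPartFun_swap θ hpq ha hb ha' hb' (hden p) (hden q) hd (-M) (2 * M)
    rw [show (-(M : ℤ) + (2 * M : ℕ)) = M by push_cast; ring] at this
    exact this
  have hN : ∀ M : ℕ, -(M : ℤ) - 1 ∉ insert (M : ℤ) (box M) := fun M => by simp [box]
  have hN' : ∀ M : ℕ, (M : ℤ) ∉ insert (-(M : ℤ) - 1) (box M) := fun M => by simp [box]; omega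
  have h1 : Tendsto (fun M : ℕ => capPartFun θ (box M) (.horiz p M) (.horiz q M) a b) atTop (𝓝 0) := by
    refine tendsto_zero_of_mul_le_increment hA (mul_pos (u₁_pos (hθ p)) (u₂_pos (hθ q)))
      (fun M => capPartFun_nonneg hθ _ _ _ _ _) fun M => ?_
    refine (capPartFun_top_le hθ hpq ha hb (not_mem_box M)).trans ?_
    rw [box_succ]
    exact rowsPartFun_le_insert hθ (hN M) a b
  have h2 : Tendsto (fun M : ℕ => capPartFun (θ ∘ Equiv.swap p q) (box M) (.horiz p (-M)) (.horiz q (-M)) a b)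
      atTop (𝓝 0) := by
    refine tendsto_zero_of_mul_le_increment hA' (mul_pos (u₂_pos (hθ' p)) (u₁_pos (hθ' q)))
      (fun M => capPartFun_nonneg hθ' _ _ _ _ _) fun M => ?_
    have := capPartFun_bot_le hθ' hpq ha hb (not_mem_box' M)
    rw [sub_add_cancel] at this
    refine this.trans ?_
    rw [box_succ']
    exact rowsPartFun_le_insert hθ' (hN' M) a b
  have h3 := hA.add (h1.const_mul (u₂ (θ q - θ p)))
  have h4 := hA'.add (h2.const_mul (u₂ (θ q - θ p)))
  rw [mul_zero, add_zero] at h3 h4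
  exact tendsto_nhds_unique (h3.congr key) h4

/-! ### Walks and states of rhombi -/

theorem vert_mem_sides {k : Fin (T + 1)} {j : ℤ} {r : Rhombus T} :
    .vert k j ∈ sides r ↔ j = r.2 ∧ (k.val = r.1.val ∨ k.val = r.1.val + 1) := by
  simp [sides, west, north, east, south, Fin.ext_iff]; tauto

theorem horiz_mem_sides {k : Fin T} {j : ℤ} {r : Rhombus T} :
    .horiz k j ∈ sides r ↔ k.val = r.1.val ∧ (j = r.2 ∨ j = r.2 + 1) := by
  simp [sides, west, north, east, south, Fin.ext_iff]; tauto

/-- Two rhombi have at most one side in common. -/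
theorem rhombus_unique {r r' : Rhombus T} {e f : Edge T} (hef : e ≠ f) (he : e ∈ sides r)
    (hf : f ∈ sides r) (he' : e ∈ sides r') (hf' : f ∈ sides r') : r = r' := by
  obtain ⟨k, j⟩ := r
  obtain ⟨k', j'⟩ := r'
  rcases e with ⟨a, b⟩ | ⟨a, b⟩ <;> rcases f with ⟨c, d⟩ | ⟨c, d⟩ <;>
  simp only [vert_mem_sides, horiz_mem_sides, ne_eq, Edge.vert.injEq, Edge.horiz.injEq, Fin.ext_iff,
    Prod.mk.injEq] at * <;> omega

theorem mem_sides_iff {r : Rhombus T} {e : Edge T} : e ∈ sides r ↔ ∃ i, side4 r i = e := by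
  simp [sides, side4, Fin.exists_fin_succ, eq_comm]

theorem side4_mem (r : Rhombus T) (i : Fin 4) : side4 r i ∈ sides r := mem_sides_iff.2 ⟨i, rfl⟩

theorem side4_injective (r : Rhombus T) : (side4 r).Injective := by
  intro i j h
  fin_cases i <;> fin_cases j <;> simp [side4, west, north, east, south, Fin.ext_iff] at h ⊢

/-- The walk `γ` meets the rhombus `r` in the state `s`. -/
def Meets (γ : List (Edge T)) (r : Rhombus T) (s : RState) : Prop :=
  ∀ i j : Fin 4, Joins γ (side4 r i) (side4 r j) ↔ (i, j) ∈ s.pairs ∨ (j, i) ∈ s.pairs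

theorem Meets.unique {γ : List (Edge T)} {r : Rhombus T} {s t : RState} (hs : Meets γ r s)
    (ht : Meets γ r t) : s = t := by
  have h : ∀ i j, ((i, j) ∈ s.pairs ∨ (j, i) ∈ s.pairs) ↔ ((i, j) ∈ t.pairs ∨ (j, i) ∈ t.pairs) :=
    fun i j => (hs i j).symm.trans (ht i j)
  have h01 := h 0 1
  have h02 := h 0 2
  have h03 := h 0 3
  have h12 := h 1 2
  have h13 := h 1 3
  have h23 := h 2 3
  clear h hs ht
  cases s <;> cases t <;> first | rfl | (simp [RState.pairs] at h01 h02 h03 h12 h13 h23)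

theorem Meets.localWeight {γ : List (Edge T)} {r : Rhombus T} {s : RState} (hs : Meets γ r s) (θ : ℝ) :
    localWeight θ γ r = s.wt θ := by
  have h1 : Joins γ (west r) (north r) ↔ _ := hs 0 1
  have h2 : Joins γ (south r) (east r) ↔ _ := hs 3 2
  have h3 : Joins γ (west r) (south r) ↔ _ := hs 0 3
  have h4 : Joins γ (north r) (east r) ↔ _ := hs 1 2
  have h5 : Joins γ (west r) (east r) ↔ _ := hs 0 2
  have h6 : Joins γ (south r) (north r) ↔ _ := hs 3 1
  rw [RhombicSAW.localWeight]
  simp only [h1, h2, h3, h4, h5, h6]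
  cases s <;> simp [RState.pairs, RState.wt]

/-- A vertex with two neighbours in a walk is between them. -/
theorem infix_of_joins {γ : List (Edge T)} (hγ : γ.Nodup) {x y z : Edge T} (hxy : Joins γ x y)
    (hxz : Joins γ x z) (hyz : y ≠ z) : [y, x, z] <:+: γ ∨ [z, x, y] <:+: γ := by
  have main : ∀ {y z : Edge T} {l₁ l₂}, γ = l₁ ++ y :: x :: l₂ → Joins γ x z → y ≠ z → [y, x, z] <:+: γ := by
    rintro y z l₁ l₂ rfl hxz hyz
    have h1 : ¬ Joins (l₁ ++ [y]) x z := fun hj => by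
      have := hj.mem_left
      simp [List.nodup_append] at hγ this
      grind
    rw [joins_append_cons, joins_cons_cons] at hxz
    cases l₂ with
    | nil => simp at hxz; grind
    | cons w l =>
      rw [joins_cons_cons] at hxz
      have h2 : ¬ Joins (w :: l) x z := fun hj => by
        have := hj.mem_left
        simp [List.nodup_append] at hγ this
        grind
      simp [List.nodup_append] at hγ
      have : z = w := by grind
      subst this
      exact ⟨l₁, l, by simp⟩
  rcases hxy.exists_split with ⟨l₁, l₂, h⟩ | ⟨l₁, l₂, h⟩
  · rcases hxz.exists_split with ⟨l₃, l₄, h'⟩ | ⟨l₃, l₄, h'⟩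
    · have hn := hγ
      rw [h] at hn h'
      -- both `y` and `z` would follow `x`
      have : [x, z] <:+: l₁ ++ x :: y :: l₂ := ⟨l₃, l₄, by simp [h']⟩
      exfalso
      rw [pair_infix_append, pair_infix_cons] at this
      have e1 : ¬ [x, z] <:+: l₁ := fun hc => by
        have := hc.subset (List.mem_cons_self)
        simp [List.nodup_append] at hn
        grind
      have e2 : ¬ [x, z] <:+: y :: l₂ := fun hc => by
        have := hc.subset (List.mem_cons_self)
        simp [List.nodup_append] at hn this
        grind
      have e3 : l₁.getLast? ≠ some x := fun hc => by
        have := List.mem_of_getLast? hc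
        simp [List.nodup_append] at hn
        grind
      simp [e1, e2, e3] at this
      exact hyz this
    · exact .inr (main h' hxy hyz.symm)
  · exact .inl (main h hxz hyz)

theorem IsSAW.partner_unique {γ : List (Edge T)} (hγ : IsSAW γ) {r : Rhombus T} {x y z : Edge T}
    (hx : x ∈ sides r) (hy : y ∈ sides r) (hz : z ∈ sides r) (hxy : Joins γ x y) (hxz : Joins γ x z) :
    y = z := by
  by_contra hne
  rcases infix_of_joins hγ.nodup hxy hxz hne with h | h
  · exact hγ.crosses r _ _ _ h ⟨hy, hx, hz⟩
  · exact hγ.crosses r _ _ _ h ⟨hz, hx, hy⟩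

/-- The relations on the four sides of a rhombus in which every side has at most one partner and
opposite sides are not joined crosswise are those of the states. -/
theorem exists_state_of_bool : ∀ x01 x02 x03 x12 x13 x23 : Bool, ¬ (x02 = true ∧ x13 = true) →
    ¬ (x01 = true ∧ x02 = true) → ¬ (x01 = true ∧ x03 = true) → ¬ (x02 = true ∧ x03 = true) →
    ¬ (x01 = true ∧ x12 = true) → ¬ (x01 = true ∧ x13 = true) → ¬ (x12 = true ∧ x13 = true) →
    ¬ (x02 = true ∧ x12 = true) → ¬ (x02 = true ∧ x23 = true) → ¬ (x12 = true ∧ x23 = true) →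
    ¬ (x03 = true ∧ x13 = true) → ¬ (x03 = true ∧ x23 = true) → ¬ (x13 = true ∧ x23 = true) →
    ∃ s : RState, ∀ i j : Fin 4, (![![false, x01, x02, x03], ![x01, false, x12, x13],
      ![x02, x12, false, x23], ![x03, x13, x23, false]] i j) = true ↔
        (i, j) ∈ s.pairs ∨ (j, i) ∈ s.pairs := by
  have key : ∀ x01 x02 x03 x12 x13 x23 : Bool, (x02 && x13) || (x01 && x02) || (x01 && x03) ||
      (x02 && x03) || (x01 && x12) || (x01 && x13) || (x12 && x13) || (x02 && x12) || (x02 && x23) ||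
      (x12 && x23) || (x03 && x13) || (x03 && x23) || (x13 && x23) ||
      decide (∃ s : RState, ∀ i j : Fin 4, (![![false, x01, x02, x03], ![x01, false, x12, x13],
        ![x02, x12, false, x23], ![x03, x13, x23, false]] i j) = true ↔
          (i, j) ∈ s.pairs ∨ (j, i) ∈ s.pairs) := by
    decide +kernel
  intro x01 x02 x03 x12 x13 x23 h1 h2 h3 h4 h5 h6 h7 h8 h9 h10 h11 h12 h13
  have := key x01 x02 x03 x12 x13 x23
  simpa only [Bool.or_eq_true, Bool.and_eq_true, decide_eq_true_eq, h1, h2, h3, h4, h5, h6, h7, h8, h9,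
    h10, h11, h12, h13, false_or] using this

theorem IsSAW.exists_meets {γ : List (Edge T)} (hγ : IsSAW γ) (r : Rhombus T) : ∃ s, Meets γ r s := by
  classical
  have hu : ∀ i j k : Fin 4, Joins γ (side4 r i) (side4 r j) → Joins γ (side4 r i) (side4 r k) → j = k :=
    fun i j k h1 h2 => side4_injective r
      (hγ.partner_unique (side4_mem r i) (side4_mem r j) (side4_mem r k) h1 h2)
  have hc : ¬ (Joins γ (side4 r 0) (side4 r 2) ∧ Joins γ (side4 r 3) (side4 r 1)) := hγ.noncrossing r
  have hs : ∀ i j : Fin 4, Joins γ (side4 r i) (side4 r j) ↔ Joins γ (side4 r j) (side4 r i) :=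
    fun i j => joins_comm
  have hi : ∀ i : Fin 4, ¬ Joins γ (side4 r i) (side4 r i) := fun i h => h.ne hγ.nodup rfl
  -- only finitely many relations on the four sides have to be considered
  have key : ∀ J : Fin 4 → Fin 4 → Bool, (∀ i j, J i j = J j i) → (∀ i, J i i = false) →
      (∀ i j k, J i j = true → J i k = true → j = k) → ¬ (J 0 2 = true ∧ J 3 1 = true) →
        ∃ s : RState, ∀ i j, J i j = true ↔ (i, j) ∈ s.pairs ∨ (j, i) ∈ s.pairs := by
    intro J h1 h2 h3 h4
    have n : ∀ i j k, j ≠ k → ¬ (J i j = true ∧ J i k = true) := fun i j k hjk h => hjk (h3 i j k h.1 h.2)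
    obtain ⟨s, hs⟩ := exists_state_of_bool (J 0 1) (J 0 2) (J 0 3) (J 1 2) (J 1 3) (J 2 3) (by rwa [h1 1 3])
      (n 0 1 2 (by decide)) (n 0 1 3 (by decide)) (n 0 2 3 (by decide))
      (by rw [h1 0 1]; exact n 1 0 2 (by decide)) (by rw [h1 0 1]; exact n 1 0 3 (by decide))
      (n 1 2 3 (by decide)) (by rw [h1 0 2, h1 1 2]; exact n 2 0 1 (by decide))
      (by rw [h1 0 2]; exact n 2 0 3 (by decide)) (by rw [h1 1 2]; exact n 2 1 3 (by decide))
      (by rw [h1 0 3, h1 1 3]; exact n 3 0 1 (by decide)) (by rw [h1 0 3, h1 2 3]; exact n 3 0 2 (by decide))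
      (by rw [h1 1 3, h1 2 3]; exact n 3 1 2 (by decide))
    refine ⟨s, fun i j => ?_⟩
    rw [← hs]
    fin_cases i <;> fin_cases j <;> simp [h2, h1 1 0, h1 2 0, h1 3 0, h1 2 1, h1 3 1, h1 3 2]
  obtain ⟨s, h⟩ := key (fun i j => decide (Joins γ (side4 r i) (side4 r j)))
    (fun i j => by simp only [hs i j]) (fun i => by simpa using hi i)
    (fun i j k => by simpa using hu i j k) (by simpa using hc)
  exact ⟨s, fun i j => by rw [← h]; simp⟩

/-- The walk stays in the rows in `S`. -/
def StepsIn (S : Finset ℤ) (γ : List (Edge T)) : Prop :=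
  ∀ e f, Joins γ e f → ∃ r : Rhombus T, r.2 ∈ S ∧ e ∈ sides r ∧ f ∈ sides r

/-- The self-avoiding walks from `a` to `b` in the rows in `S`. -/
def rowWalks (S : Finset ℤ) (a b : Edge T) : Set (List (Edge T)) :=
  {γ | IsSAW γ ∧ γ.head? = some a ∧ γ.getLast? = some b ∧ StepsIn S γ}

theorem stepRel_iff_of_meets {S : Finset ℤ} {γ : List (Edge T)} (hS : StepsIn S γ)
    {c : Fin T × S → RState} (hc : ∀ i : Fin T × S, Meets γ (i.1, i.2.1) (c i)) (e f : Edge T) :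
    Joins γ e f ↔ stepRel (fun i : Fin T × S => side4 (i.1, i.2.1)) c e f := by
  constructor
  · intro h
    obtain ⟨r, hr, he, hf⟩ := hS e f h
    obtain ⟨i, rfl⟩ := mem_sides_iff.1 he
    obtain ⟨j, rfl⟩ := mem_sides_iff.1 hf
    rcases (hc (r.1, ⟨r.2, hr⟩) i j).1 h with h | h
    · exact ⟨(r.1, ⟨r.2, hr⟩), _, h, .inl ⟨rfl, rfl⟩⟩
    · exact ⟨(r.1, ⟨r.2, hr⟩), _, h, .inr ⟨rfl, rfl⟩⟩
  · rintro ⟨i, ⟨m, n⟩, hp, ⟨rfl, rfl⟩ | ⟨rfl, rfl⟩⟩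
    · exact (hc i m n).2 (.inl hp)
    · exact (hc i n m).2 (.inr hp)

theorem ne_of_mem_pairs {s : RState} {i j : Fin 4} (h : (i, j) ∈ s.pairs ∨ (j, i) ∈ s.pairs) : i ≠ j := by
  revert s i j; decide

theorem RState.pairs_unique (s : RState) (i j k : Fin 4) (hj : (i, j) ∈ s.pairs ∨ (j, i) ∈ s.pairs)
    (hk : (i, k) ∈ s.pairs ∨ (k, i) ∈ s.pairs) : j = k := by
  cases s <;> simp [RState.pairs] at hj hk <;> grind

theorem RState.pairs_noncrossing (s : RState) : ¬ (((0, 2) ∈ s.pairs ∨ (2, 0) ∈ s.pairs) ∧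
    ((3, 1) ∈ s.pairs ∨ (1, 3) ∈ s.pairs)) := by
  cases s <;> decide

theorem stepRel_side4 {S : Finset ℤ} {c : Fin T × S → RState} (i : Fin T × S) (m n : Fin 4) :
    m ≠ n → (stepRel (fun i : Fin T × S => side4 (i.1, i.2.1)) c (side4 (i.1, i.2.1) m) (side4 (i.1, i.2.1) n) ↔
      (m, n) ∈ (c i).pairs ∨ (n, m) ∈ (c i).pairs) := by
  intro hmn
  constructor
  · rintro ⟨i', ⟨m', n'⟩, hp, h⟩
    have hne : side4 (i.1, i.2.1) m ≠ side4 (i.1, i.2.1) n := (side4_injective _).ne hmn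
    have hi : i = i' := by
      have : ((i.1, i.2.1) : Rhombus T) = (i'.1, i'.2.1) := by
        rcases h with ⟨h1, h2⟩ | ⟨h1, h2⟩
        · exact rhombus_unique hne (side4_mem _ _) (side4_mem _ _) (h1 ▸ side4_mem _ _) (h2 ▸ side4_mem _ _)
        · exact rhombus_unique hne (side4_mem _ _) (side4_mem _ _) (h1 ▸ side4_mem _ _) (h2 ▸ side4_mem _ _)
      obtain ⟨i1, i2, h2⟩ := i
      obtain ⟨i1', i2', h2'⟩ := i'
      simpa using this
    subst hi
    rcases h with ⟨h1, h2⟩ | ⟨h1, h2⟩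
    · rw [side4_injective _ h1, side4_injective _ h2]; exact .inl hp
    · rw [side4_injective _ h1, side4_injective _ h2]; exact .inr hp
  · rintro (h | h)
    · exact ⟨i, _, h, .inl ⟨rfl, rfl⟩⟩
    · exact ⟨i, _, h, .inr ⟨rfl, rfl⟩⟩

theorem meets_of_stepRel {S : Finset ℤ} {γ : List (Edge T)} (hn : γ.Nodup) {c : Fin T × S → RState}
    (hc : ∀ e f, Joins γ e f ↔ stepRel (fun i : Fin T × S => side4 (i.1, i.2.1)) c e f)
    (i : Fin T × S) : Meets γ (i.1, i.2.1) (c i) := by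
  intro m n
  by_cases hmn : m = n
  · subst hmn
    exact iff_of_false (fun h => h.ne hn rfl) fun h => ne_of_mem_pairs h rfl
  · rw [hc, stepRel_side4 i m n hmn]

theorem stepsIn_of_stepRel {S : Finset ℤ} {γ : List (Edge T)} {c : Fin T × S → RState}
    (hc : ∀ e f, Joins γ e f ↔ stepRel (fun i : Fin T × S => side4 (i.1, i.2.1)) c e f) :
    StepsIn S γ := by
  intro e f h
  obtain ⟨i, p, -, ⟨rfl, rfl⟩ | ⟨rfl, rfl⟩⟩ := (hc e f).1 h <;>
    exact ⟨_, i.2.2, side4_mem _ _, side4_mem _ _⟩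

theorem isSAW_of_stepRel {S : Finset ℤ} {γ : List (Edge T)} (h0 : γ ≠ []) (hn : γ.Nodup)
    {c : Fin T × S → RState}
    (hc : ∀ e f, Joins γ e f ↔ stepRel (fun i : Fin T × S => side4 (i.1, i.2.1)) c e f) : IsSAW γ := by
  have hS := stepsIn_of_stepRel hc
  have hm := meets_of_stepRel hn hc
  have hrow : ∀ {r : Rhombus T} {e f : Edge T}, Joins γ e f → e ∈ sides r → f ∈ sides r → r.2 ∈ S := by
    intro r e f h he hf
    obtain ⟨r', hr', he', hf'⟩ := hS e f h
    rw [rhombus_unique (h.ne hn) he hf he' hf']; exact hr'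
  refine ⟨h0, hn, ?_, ?_, ?_⟩
  · rw [List.isChain_iff_forall_rel_of_append_cons_cons]
    rintro e f l₁ l₂ rfl
    obtain ⟨r, -, he, hf⟩ := hS e f (.inl ⟨l₁, l₂, by simp⟩)
    exact ⟨r, he, hf⟩
  · rintro r e f g h ⟨he, hf, hg⟩
    have h1 : Joins γ f e := .inr (List.IsInfix.trans ⟨[], [g], rfl⟩ h)
    have h2 : Joins γ f g := .inl (List.IsInfix.trans ⟨[e], [], rfl⟩ h)
    have hr := hrow h1 hf he
    have heg : e ≠ g := by
      have := hn.sublist h.sublist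
      simp at this; tauto
    obtain ⟨i, rfl⟩ := mem_sides_iff.1 he
    obtain ⟨j, rfl⟩ := mem_sides_iff.1 hf
    obtain ⟨k, rfl⟩ := mem_sides_iff.1 hg
    have e1 := (hm (r.1, ⟨r.2, hr⟩) j i).1 h1
    have e2 := (hm (r.1, ⟨r.2, hr⟩) j k).1 h2
    refine heg (congrArg _ ?_)
    generalize c (r.1, ⟨r.2, hr⟩) = s at e1 e2
    exact s.pairs_unique j i k e1 e2
  · rintro r ⟨h1, h2⟩
    have hr := hrow h1 (side4_mem r 0) (side4_mem r 2)
    have e1 := (hm (r.1, ⟨r.2, hr⟩) 0 2).1 h1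
    have e2 := (hm (r.1, ⟨r.2, hr⟩) 3 1).1 h2
    generalize c (r.1, ⟨r.2, hr⟩) = s at e1 e2
    exact s.pairs_noncrossing ⟨e1, e2⟩

theorem weight_eq_prod {S : Finset ℤ} {γ : List (Edge T)} (hn : γ.Nodup) (hS : StepsIn S γ)
    {c : Fin T × S → RState} (hc : ∀ i : Fin T × S, Meets γ (i.1, i.2.1) (c i)) (θ : Fin T → ℝ) :
    weight θ γ = ∏ i, RState.wt (θ i.1) (c i) := by
  classical
  have hout : ∀ r : Rhombus T, r.2 ∉ S → localWeight (θ r.1) γ r = 1 := by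
    intro r hr
    have : Meets γ r .O := by
      refine fun i j => iff_of_false (fun h => ?_) (by simp [RState.pairs])
      obtain ⟨r', hr', he', hf'⟩ := hS _ _ h
      exact hr (rhombus_unique (h.ne hn) (side4_mem _ _) (side4_mem _ _) he' hf' ▸ hr')
    rw [this.localWeight, RState.wt_O]
  rw [weight, finprod_eq_prod_of_mulSupport_subset (s := Finset.univ ×ˢ S)]
  · rw [Finset.prod_product, Fintype.prod_prod_type]
    refine Finset.prod_congr rfl fun k _ => ?_
    rw [← Finset.prod_coe_sort]
    exact Finset.prod_congr rfl fun y _ => (hc (k, y)).localWeight _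
  · intro r hr
    by_contra h
    exact hr (hout r (by simpa using h))

/-- A walk is determined by its first mid-edge and its set of steps. -/
theorem eq_of_joins_iff {γ γ' : List (Edge T)} (hn : γ.Nodup) (hn' : γ'.Nodup)
    (hh : γ.head? = γ'.head?) (h : ∀ e f, Joins γ e f ↔ Joins γ' e f) : γ = γ' := by
  induction γ generalizing γ' with
  | nil => cases γ' <;> simp_all
  | cons x l ih =>
    cases γ' with
    | nil => simp at hh
    | cons y l' =>
      obtain rfl : x = y := by simpa using hh
      have hx : x ∉ l := (List.nodup_cons.1 hn).1
      have hx' : x ∉ l' := (List.nodup_cons.1 hn').1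
      have key : ∀ (z : Edge T) (m : List (Edge T)), x ∉ m → (Joins (x :: m) x z ↔ m.head? = some z) := by
        intro z m hm
        cases m with
        | nil => simp
        | cons w m =>
          rw [joins_cons_cons]
          have : ¬ Joins (w :: m) x z := fun hj => hm hj.mem_left
          have hw : x ≠ w := fun hw => hm (hw ▸ List.mem_cons_self)
          simp [this]
          grind
      congr 1
      refine ih (List.nodup_cons.1 hn).2 (List.nodup_cons.1 hn').2 (Option.ext fun z => ?_) fun e f => ?_
      · rw [← key z l hx, h, key z l' hx']
      · have rest : ∀ m : List (Edge T), x ∉ m →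
            (Joins m e f ↔ Joins (x :: m) e f ∧ e ≠ x ∧ f ≠ x) := by
          intro m hm
          cases m with
          | nil => simp
          | cons w m =>
            rw [joins_cons_cons]
            have h1 : Joins (w :: m) e f → e ≠ x ∧ f ≠ x := fun hj =>
              ⟨fun hc => hm (hc ▸ hj.mem_left), fun hc => hm (hc ▸ hj.mem_right)⟩
            grind
        rw [rest l hx, rest l' hx', h]

/-- The partition function of finitely many rows is the sum of the weights of the walks in them. -/
theorem rowsPartFun_eq (θ : Fin T → ℝ) (S : Finset ℤ) (a b : Edge T) :
    ∃ h : (rowWalks S a b).Finite, rowsPartFun θ S a b = ∑ γ ∈ h.toFinset, weight θ γ := by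
  classical
  have hex : ∀ γ : List (Edge T), IsSAW γ → ∃ c : Fin T × S → RState, ∀ i : Fin T × S, Meets γ (i.1, i.2.1) (c i) :=
    fun γ hγ => by
      choose c hc using fun i : Fin T × S => hγ.exists_meets (i.1, i.2.1)
      exact ⟨c, hc⟩
  have : Nonempty (Fin T × S → RState) := ⟨fun _ => .O⟩
  choose! st hst using hex
  have hinj : Set.InjOn st (rowWalks S a b) := by
    rintro γ ⟨h1, h2, h3, h4⟩ γ' ⟨h1', h2', h3', h4'⟩ h
    refine eq_of_joins_iff h1.nodup h1'.nodup (h2.trans h2'.symm) fun e f => ?_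
    rw [stepRel_iff_of_meets h4 (hst γ h1), stepRel_iff_of_meets h4' (hst γ' h1'), h]
  have hfin : (rowWalks S a b).Finite := Set.Finite.of_injOn (fun _ _ => Set.mem_univ _) hinj Set.finite_univ
  refine ⟨hfin, ?_⟩
  rw [rowsPartFun, partFun]
  symm
  have himg : ∀ c, IsPath a b (stepRel (fun i : Fin T × S => side4 (i.1, i.2.1)) c) ↔
      c ∈ hfin.toFinset.image st := by
    intro c
    simp only [Finset.mem_image, Set.Finite.mem_toFinset]
    constructor
    · rintro ⟨γ, h1, h2, h3, h4⟩
      have h5 := isSAW_of_stepRel (by rintro rfl; simp at h2) h1 h4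
      refine ⟨γ, ⟨h5, h2, h3, stepsIn_of_stepRel h4⟩, ?_⟩
      ext1 i
      exact (hst γ h5 i).unique (meets_of_stepRel h1 h4 i)
    · rintro ⟨γ, ⟨h1, h2, h3, h4⟩, rfl⟩
      exact ⟨γ, h1.nodup, h2, h3, stepRel_iff_of_meets h4 (hst γ h1)⟩
  simp only [pathInd, himg, mul_ite, mul_one, mul_zero]
  rw [← Finset.sum_filter, Finset.filter_mem_eq_inter, Finset.univ_inter, Finset.sum_image]
  · refine Finset.sum_congr rfl fun γ hγ => ?_
    obtain ⟨h1, h2, h3, h4⟩ := hfin.mem_toFinset.1 hγ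
    exact weight_eq_prod h1.nodup h4 (hst γ h1) θ
  · simpa using hinj

/-! ### Flux of lattice walks -/

/-- The mid-edges of the strip are placed at integer points, the vertical ones at points `(x, y)` with
`x` even and `y` odd, the horizontal ones at points with `x` odd and `y` even, so that the rhombi are
centred at the points with odd coordinates, and the vertices are at the points with even coordinates.
A dart is a mid-edge, crossed in the direction that is obtained from east by `d` quarter-turns
counterclockwise; the integer `d` also records the winding. -/
structure Dart : Type where
  x : ℤ
  y : ℤ
  d : ℤ

/-- The cosine of `d` quarter-turns. -/
def chi (d : ℤ) : ℤ := if d % 4 = 0 then 1 else if d % 4 = 2 then -1 else 0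

namespace Dart

/-- The place of a dart. -/
def pos (q : Dart) : ℤ × ℤ := (q.x, q.y)
/-- The centre of the rhombus that the dart enters. -/
def ahead (q : Dart) : ℤ × ℤ := (q.x + chi q.d, q.y + chi (q.d - 1))
/-- The centre of the rhombus that the dart leaves. -/
def behind (q : Dart) : ℤ × ℤ := (q.x - chi q.d, q.y - chi (q.d - 1))

end Dart

/-- The corner of the rhombus centred at `r` that is between its sides in the directions `k` and
`k + 1`. -/
def corner (r : ℤ × ℤ) (k : ℤ) : ℤ × ℤ := (r.1 + chi k + chi (k + 1), r.2 + chi (k - 1) + chi k)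

/-- The number of darts that leave the rhombus centred at `r` through its side in the direction `k`,
minus the number of those that enter it there. -/
def outflow (r : ℤ × ℤ) (k : ℤ) (ξ : List Dart) : ℤ :=
  (ξ.map fun q => if q.x = r.1 + chi k ∧ q.y = r.2 + chi (k - 1) then chi (q.d - k) else 0).sum

/-- The number of darts that cross the half-line to the left of `c` upwards, minus the number of those
that cross it downwards. -/
def crossings (c : ℤ × ℤ) (ξ : List Dart) : ℤ :=
  (ξ.map fun q => if q.y = c.2 ∧ q.x < c.1 then chi (q.d - 1) else 0).sum

/-- The darts form a walk whose first dart leaves `B` and whose last dart enters `A`. -/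
def Linked : ℤ × ℤ → List Dart → ℤ × ℤ → Prop
  | B, [], A => B = A
  | B, q :: l, A => q.behind = B ∧ Linked q.ahead l A

theorem linked_append {B A : ℤ × ℤ} {l l' : List Dart} :
    Linked B (l ++ l') A ↔ ∃ C, Linked B l C ∧ Linked C l' A := by
  induction l generalizing B with
  | nil => simp [Linked]
  | cons q l ih => simp [Linked, ih]; tauto

theorem Linked.sum_eq {B A : ℤ × ℤ} {ξ : List Dart} (h : Linked B ξ A) (g : ℤ × ℤ → ℤ) :
    (ξ.map fun q => g q.behind - g q.ahead).sum = g B - g A := by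
  induction ξ generalizing B with
  | nil => simp only [Linked] at h; simp [h]
  | cons q l ih => simp [ih h.2, h.1]

theorem chi_cases (d : ℤ) :
    (d % 4 = 0 ∧ chi d = 1 ∧ chi (d - 1) = 0 ∧ chi (d + 1) = 0 ∧ chi (d + 2) = -1) ∨
    (d % 4 = 1 ∧ chi d = 0 ∧ chi (d - 1) = 1 ∧ chi (d + 1) = -1 ∧ chi (d + 2) = 0) ∨
    (d % 4 = 2 ∧ chi d = -1 ∧ chi (d - 1) = 0 ∧ chi (d + 1) = 0 ∧ chi (d + 2) = 1) ∨
    (d % 4 = 3 ∧ chi d = 0 ∧ chi (d - 1) = -1 ∧ chi (d + 1) = 1 ∧ chi (d + 2) = 0) := by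
  unfold chi
  have h : d % 4 = 0 ∨ d % 4 = 1 ∨ d % 4 = 2 ∨ d % 4 = 3 := by omega
  rcases h with h | h | h | h
  · have h1 : (d - 1) % 4 = 3 := by omega
    have h2 : (d + 1) % 4 = 1 := by omega
    have h3 : (d + 2) % 4 = 2 := by omega
    simp [h, h1, h2, h3]
  · have h1 : (d - 1) % 4 = 0 := by omega
    have h2 : (d + 1) % 4 = 2 := by omega
    have h3 : (d + 2) % 4 = 3 := by omega
    simp [h, h1, h2, h3]
  · have h1 : (d - 1) % 4 = 1 := by omega
    have h2 : (d + 1) % 4 = 3 := by omega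
    have h3 : (d + 2) % 4 = 0 := by omega
    simp [h, h1, h2, h3]
  · have h1 : (d - 1) % 4 = 2 := by omega
    have h2 : (d + 1) % 4 = 0 := by omega
    have h3 : (d + 2) % 4 = 1 := by omega
    simp [h, h1, h2, h3]

theorem chi_congr {d e : ℤ} (h : d % 4 = e % 4) : chi d = chi e := by simp [chi, h]

theorem sum_map_congr_mem {ξ : List Dart} {f g : Dart → ℤ} (h : ∀ q ∈ ξ, f q = g q) :
    (ξ.map f).sum = (ξ.map g).sum := by rw [List.map_congr_left h]

theorem sum_map_add' (ξ : List Dart) (f g : Dart → ℤ) :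
    (ξ.map f).sum + (ξ.map g).sum = (ξ.map fun q => f q + g q).sum := by
  induction ξ with
  | nil => simp
  | cons q l ih => simp [← ih]; ring

theorem sum_map_sub' (ξ : List Dart) (f g : Dart → ℤ) :
    (ξ.map f).sum - (ξ.map g).sum = (ξ.map fun q => f q - g q).sum := by
  induction ξ with
  | nil => simp
  | cons q l ih => simp [← ih]; ring

/-- The divergence theorem for one rhombus. -/
theorem Linked.outflow_add {B A : ℤ × ℤ} {ξ : List Dart} (h : Linked B ξ A) (r : ℤ × ℤ) (k : ℤ) :
    outflow r k ξ + outflow r (k + 1) ξ + outflow r (k + 2) ξ + outflow r (k - 1) ξ =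
      (if B = r then 1 else 0) - if A = r then 1 else 0 := by
  rw [← h.sum_eq (fun C => if C = r then 1 else 0)]
  unfold outflow
  simp only [sum_map_add']
  refine sum_map_congr_mem fun q _ => ?_
  obtain ⟨x, y, d⟩ := q
  obtain ⟨r1, r2⟩ := r
  have e1 : chi (k - 1 - 1) = chi (k + 2) := chi_congr (by omega)
  have e2 : chi (k + 1 - 1) = chi k := by ring_nf
  have e3 : chi (k + 2 - 1) = chi (k + 1) := by ring_nf
  simp only [Dart.ahead, Dart.behind, Prod.mk.injEq, e1, e2, e3]
  obtain ⟨j, rfl⟩ : ∃ j, d = k + j := ⟨d - k, by ring⟩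
  have f0 : chi (k + j - k) = chi j := by ring_nf
  have f1 : chi (k + j - (k + 1)) = chi (j - 1) := by ring_nf
  have f2 : chi (k + j - (k + 2)) = chi (j + 2) := chi_congr (by omega)
  have f3 : chi (k + j - (k - 1)) = chi (j + 1) := by ring_nf
  rw [f0, f1, f2, f3]
  rcases chi_cases j with ⟨j0, j1, j2, j3, j4⟩ | ⟨j0, j1, j2, j3, j4⟩ | ⟨j0, j1, j2, j3, j4⟩ |
    ⟨j0, j1, j2, j3, j4⟩
  · have g1 : chi (k + j) = chi k := chi_congr (by omega)
    have g2 : chi (k + j - 1) = chi (k - 1) := chi_congr (by omega)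
    rw [g1, g2, j1, j2, j3, j4]
    rcases chi_cases k with ⟨-, k1, k2, k3, k4⟩ | ⟨-, k1, k2, k3, k4⟩ | ⟨-, k1, k2, k3, k4⟩ |
      ⟨-, k1, k2, k3, k4⟩ <;> rw [k1, k2, k3, k4] <;> grind
  · have g1 : chi (k + j) = chi (k + 1) := chi_congr (by omega)
    have g2 : chi (k + j - 1) = chi k := chi_congr (by omega)
    rw [g1, g2, j1, j2, j3, j4]
    rcases chi_cases k with ⟨-, k1, k2, k3, k4⟩ | ⟨-, k1, k2, k3, k4⟩ | ⟨-, k1, k2, k3, k4⟩ |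
      ⟨-, k1, k2, k3, k4⟩ <;> rw [k1, k2, k3, k4] <;> grind
  · have g1 : chi (k + j) = chi (k + 2) := chi_congr (by omega)
    have g2 : chi (k + j - 1) = chi (k + 1) := chi_congr (by omega)
    rw [g1, g2, j1, j2, j3, j4]
    rcases chi_cases k with ⟨-, k1, k2, k3, k4⟩ | ⟨-, k1, k2, k3, k4⟩ | ⟨-, k1, k2, k3, k4⟩ |
      ⟨-, k1, k2, k3, k4⟩ <;> rw [k1, k2, k3, k4] <;> grind
  · have g1 : chi (k + j) = chi (k - 1) := chi_congr (by omega)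
    have g2 : chi (k + j - 1) = chi (k + 2) := chi_congr (by omega)
    rw [g1, g2, j1, j2, j3, j4]
    rcases chi_cases k with ⟨-, k1, k2, k3, k4⟩ | ⟨-, k1, k2, k3, k4⟩ | ⟨-, k1, k2, k3, k4⟩ |
      ⟨-, k1, k2, k3, k4⟩ <;> rw [k1, k2, k3, k4] <;> grind

/-- The indicator of the points in the same row as `r` and to the left of `x`. -/
def leftOf (r : ℤ × ℤ) (x : ℤ) (C : ℤ × ℤ) : ℤ := if C.2 = r.2 ∧ C.1 < x then 1 else 0

/-- Moving counterclockwise along one side of a rhombus changes the number of crossings by the outflow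
through this side, up to a contribution of the ends of the walk. -/
theorem Linked.crossings_succ {B A : ℤ × ℤ} {ξ : List Dart} (h : Linked B ξ A)
    (hp : ∀ q ∈ ξ, q.x % 2 = q.d % 2) {r : ℤ × ℤ} (hr : r.1 % 2 = 1) (k : ℤ) :
    crossings (corner r (k + 1)) ξ + outflow r (k + 1) ξ = crossings (corner r k) ξ +
      (if k % 4 = 1 then leftOf r (r.1 - 1) A - leftOf r (r.1 - 1) B
        else if k % 4 = 3 then leftOf r (r.1 + 1) B - leftOf r (r.1 + 1) A else 0) := by
  obtain ⟨r1, r2⟩ := r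
  rw [← sub_eq_iff_eq_add']
  have key : ∀ g : ℤ × ℤ → ℤ, (∀ q ∈ ξ,
      ((if q.y = (corner (r1, r2) (k + 1)).2 ∧ q.x < (corner (r1, r2) (k + 1)).1 then chi (q.d - 1) else 0) +
        (if q.x = r1 + chi (k + 1) ∧ q.y = r2 + chi (k + 1 - 1) then chi (q.d - (k + 1)) else 0) -
          (if q.y = (corner (r1, r2) k).2 ∧ q.x < (corner (r1, r2) k).1 then chi (q.d - 1) else 0)) =
        g q.behind - g q.ahead) →
      crossings (corner (r1, r2) (k + 1)) ξ + outflow (r1, r2) (k + 1) ξ - crossings (corner (r1, r2) k) ξ =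
        g B - g A := by
    intro g hg
    rw [← h.sum_eq g, ← sum_map_congr_mem hg]
    unfold crossings outflow
    rw [sum_map_add', sum_map_sub']
  have ek : chi (k + 1 - 1) = chi k := by ring_nf
  have ek' : chi (k + 1 + 1) = chi (k + 2) := by ring_nf
  simp only [corner, ek, ek', Dart.ahead, Dart.behind] at key ⊢
  simp only at hr
  rcases chi_cases k with ⟨k0, k1, k2, k3, k4⟩ | ⟨k0, k1, k2, k3, k4⟩ | ⟨k0, k1, k2, k3, k4⟩ |
    ⟨k0, k1, k2, k3, k4⟩
  · rw [k0]
    simp only [k1, k2, k3, k4] at key ⊢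
    refine (key 0 fun q hq => ?_).trans (by simp)
    have e : chi (q.d - (k + 1)) = chi (q.d - 1) := chi_congr (by omega)
    have := hp q hq
    simp only [e, Pi.zero_apply]
    rcases chi_cases q.d with ⟨d0, d1, d2, -⟩ | ⟨d0, d1, d2, -⟩ | ⟨d0, d1, d2, -⟩ | ⟨d0, d1, d2, -⟩ <;>
      rw [d2] <;> split_ifs <;> omega
  · rw [k0]
    simp only [k1, k2, k3, k4] at key ⊢
    refine (key (fun C => -leftOf (r1, r2) (r1 - 1) C) fun q hq => ?_).trans (by simp; ring)
    have e : chi (q.d - (k + 1)) = chi (q.d + 2) := chi_congr (by omega)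
    have := hp q hq
    simp only [e, leftOf]
    rcases chi_cases q.d with ⟨d0, d1, d2, -, d3⟩ | ⟨d0, d1, d2, -, d3⟩ | ⟨d0, d1, d2, -, d3⟩ |
      ⟨d0, d1, d2, -, d3⟩ <;>
      rw [d1, d2, d3] <;> split_ifs <;> omega
  · rw [k0]
    simp only [k1, k2, k3, k4] at key ⊢
    refine (key 0 fun q hq => ?_).trans (by simp)
    have e : chi (q.d - (k + 1)) = chi (q.d + 1) := chi_congr (by omega)
    have := hp q hq
    simp only [e, Pi.zero_apply]
    rcases chi_cases q.d with ⟨d0, d1, d2, d3, -⟩ | ⟨d0, d1, d2, d3, -⟩ | ⟨d0, d1, d2, d3, -⟩ |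
      ⟨d0, d1, d2, d3, -⟩ <;>
      rw [d2, d3] <;> split_ifs <;> omega
  · rw [k0]
    simp only [k1, k2, k3, k4] at key ⊢
    refine (key (leftOf (r1, r2) (r1 + 1)) fun q hq => ?_).trans (by simp)
    have e : chi (q.d - (k + 1)) = chi q.d := chi_congr (by omega)
    have := hp q hq
    simp only [e, leftOf]
    rcases chi_cases q.d with ⟨d0, d1, d2, -, d3⟩ | ⟨d0, d1, d2, -, d3⟩ | ⟨d0, d1, d2, -, d3⟩ |
      ⟨d0, d1, d2, -, d3⟩ <;>
      rw [d1, d2] <;> split_ifs <;> omega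

/-- The flux through a whole horizontal line. -/
theorem Linked.crossings_line {B A : ℤ × ℤ} {ξ : List Dart} (h : Linked B ξ A)
    (hp : ∀ q ∈ ξ, q.y % 2 = (q.d + 1) % 2) {c : ℤ × ℤ} (hy : c.2 % 2 = 0) (hc : ∀ q ∈ ξ, q.x < c.1) :
    crossings c ξ = (if c.2 < A.2 then 1 else 0) - if c.2 < B.2 then 1 else 0 := by
  have e := h.sum_eq fun C => -(if c.2 < C.2 then (1 : ℤ) else 0)
  have e' : (if c.2 < A.2 then (1 : ℤ) else 0) - (if c.2 < B.2 then 1 else 0) =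
      -(if c.2 < B.2 then (1 : ℤ) else 0) - -(if c.2 < A.2 then (1 : ℤ) else 0) := by ring
  rw [e', ← e]
  refine sum_map_congr_mem fun q hq => ?_
  have h1 := hp q hq
  have h2 := hc q hq
  have h3 : q.behind.2 = q.y - chi (q.d - 1) := rfl
  have h4 : q.ahead.2 = q.y + chi (q.d - 1) := rfl
  rcases chi_cases q.d with ⟨d0, d1, d2, -⟩ | ⟨d0, d1, d2, -⟩ | ⟨d0, d1, d2, -⟩ | ⟨d0, d1, d2, -⟩ <;>
    rw [d2] at h3 h4 ⊢ <;> split_ifs <;> omega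

/-! ### The winding of a self-avoiding lattice walk -/

theorem Linked.last_or_next {B A : ℤ × ℤ} {ξ : List Dart} (h : Linked B ξ A) {u : Dart} (hu : u ∈ ξ) :
    ξ.getLast? = some u ∧ u.ahead = A ∨ ∃ u', [u, u'] <:+: ξ := by
  obtain ⟨l, l', rfl⟩ := List.append_of_mem hu
  cases l' with
  | nil =>
    obtain ⟨C, -, h2⟩ := linked_append.1 h
    exact .inl ⟨by simp, h2.2⟩
  | cons u' l' => exact .inr ⟨u', l, l', by simp⟩

theorem Linked.first_or_prev {B A : ℤ × ℤ} {ξ : List Dart} (h : Linked B ξ A) {u : Dart} (hu : u ∈ ξ) :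
    u.behind = B ∨ ∃ u', [u', u] <:+: ξ := by
  obtain ⟨l, l', rfl⟩ := List.append_of_mem hu
  rcases List.eq_nil_or_concat' l with rfl | ⟨l, u', rfl⟩
  · exact .inl h.1
  · exact .inr ⟨u', l, l', by simp⟩

/-- The dart `q'` follows the dart `q`, after a turn to the right, none, or a turn to the left. -/
def Turn (q q' : Dart) : Prop :=
  (q'.d = q.d - 1 ∨ q'.d = q.d ∨ q'.d = q.d + 1) ∧ q'.behind = q.ahead

/-- `ω` is the list of the darts of a self-avoiding walk in the half-plane to the right of `0` that
starts from `(0, y₀)`. -/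
structure DartWalk (y₀ : ℤ) (ω : List Dart) : Prop where
  head : ω.head? = some ⟨0, y₀, 0⟩
  odd : y₀ % 2 = 1
  turn : ω.IsChain Turn
  nodup : (ω.map Dart.pos).Nodup
  nonneg : ∀ q ∈ ω, 0 ≤ q.x
  noncrossing : ∀ q q' u u', [q, q'] <:+: ω → [u, u'] <:+: ω → q'.d = q.d → u'.d = u.d →
    q.ahead = u.ahead → (q.d - u.d) % 2 = 0

theorem linked_of_isChain {ξ : List Dart} {f q : Dart} (h : ξ.IsChain Turn) (hf : ξ.head? = some f)
    (hq : ξ.getLast? = some q) : Linked f.behind ξ q.ahead := by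
  induction ξ generalizing f with
  | nil => simp at hf
  | cons p l ih =>
    obtain rfl : p = f := by simpa using hf
    refine ⟨rfl, ?_⟩
    cases l with
    | nil =>
      obtain rfl : p = q := by simpa using hq
      exact rfl
    | cons p' l =>
      rw [List.isChain_cons_cons] at h
      rw [← h.1.2]
      exact ih h.2 rfl (by simpa using hq)

theorem behind_start (y : ℤ) : (⟨0, y, 0⟩ : Dart).behind = (-1, y) := by simp [Dart.behind, chi]

theorem Dart.pos_ahead (q : Dart) : q.pos = (q.ahead.1 + chi (q.d + 2), q.ahead.2 + chi (q.d + 1)) := by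
  simp only [Dart.pos, Dart.ahead, Prod.mk.injEq]
  rcases chi_cases q.d with ⟨-, k1, k2, k3, k4⟩ | ⟨-, k1, k2, k3, k4⟩ | ⟨-, k1, k2, k3, k4⟩ |
    ⟨-, k1, k2, k3, k4⟩ <;> rw [k1, k2, k3, k4] <;> constructor <;> ring

theorem Dart.pos_behind (q : Dart) : q.pos = (q.behind.1 + chi q.d, q.behind.2 + chi (q.d - 1)) := by
  simp [Dart.pos, Dart.behind]

/-- The parities of the coordinates and of the heading agree. -/
def Dart.Even (q : Dart) : Prop := q.x % 2 = q.d % 2 ∧ q.y % 2 = (q.d + 1) % 2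

theorem Turn.even {q q' : Dart} (h : Turn q q') (hq : q.Even) : q'.Even := by
  obtain ⟨h1, h2⟩ := h
  obtain ⟨h3, h4⟩ := hq
  simp only [Dart.behind, Dart.ahead, Prod.mk.injEq, Dart.Even] at *
  obtain ⟨h5, h6⟩ := h2
  rcases chi_cases q.d with ⟨_, k1, k2, k3, k4⟩ | ⟨_, k1, k2, k3, k4⟩ | ⟨_, k1, k2, k3, k4⟩ |
    ⟨_, k1, k2, k3, k4⟩ <;>
  rcases chi_cases q'.d with ⟨_, j1, j2, j3, j4⟩ | ⟨_, j1, j2, j3, j4⟩ | ⟨_, j1, j2, j3, j4⟩ |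
    ⟨_, j1, j2, j3, j4⟩ <;>
  rw [k1, j1] at h5 <;> rw [k2, j2] at h6 <;> omega

theorem Dart.Even.ahead_odd {q : Dart} (h : q.Even) : q.ahead.1 % 2 = 1 ∧ q.ahead.2 % 2 = 1 := by
  obtain ⟨h3, h4⟩ := h
  simp only [Dart.ahead]
  rcases chi_cases q.d with ⟨_, k1, k2, k3, k4⟩ | ⟨_, k1, k2, k3, k4⟩ | ⟨_, k1, k2, k3, k4⟩ |
    ⟨_, k1, k2, k3, k4⟩ <;> rw [k1, k2] <;> omega

namespace DartWalk

variable {y₀ : ℤ} {ω ξ : List Dart}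

theorem of_append {l l' : List Dart} (h : DartWalk y₀ (l ++ l')) (hl : l ≠ []) : DartWalk y₀ l where
  head := by
    obtain ⟨q, l, rfl⟩ := List.exists_cons_of_ne_nil hl
    simpa using h.head
  odd := h.odd
  turn := h.turn.left_of_append
  nodup := by have := h.nodup; rw [List.map_append] at this; exact this.of_append_left
  nonneg := fun q hq => h.nonneg q (List.mem_append_left _ hq)
  noncrossing := fun q q' u u' h1 h2 => h.noncrossing q q' u u'
    (h1.trans (List.prefix_append l l').isInfix) (h2.trans (List.prefix_append l l').isInfix)

theorem linked (h : DartWalk y₀ ω) {q : Dart} (hq : ω.getLast? = some q) : Linked (-1, y₀) ω q.ahead := by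
  rw [← behind_start]; exact linked_of_isChain h.turn h.head hq

theorem turn_of_infix (h : DartWalk y₀ ω) {q q' : Dart} (hq : [q, q'] <:+: ω) : Turn q q' := by
  have := h.turn.infix hq
  simpa using this

theorem even (h : DartWalk y₀ ω) : ∀ q ∈ ω, q.Even := by
  have h1 := h.turn
  obtain ⟨l, rfl⟩ : ∃ l, ω = ⟨0, y₀, 0⟩ :: l := by
    have := h.head
    cases ω with
    | nil => simp at this
    | cons a l => exact ⟨l, by simpa using this⟩
  have h0 : (⟨0, y₀, 0⟩ : Dart).Even := by have := h.odd; simp [Dart.Even]; omega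
  clear h
  generalize (⟨0, y₀, 0⟩ : Dart) = f at *
  induction l generalizing f with
  | nil => simpa using h0
  | cons q l ih =>
    rw [List.isChain_cons_cons] at h1
    intro p hp
    rcases List.mem_cons.1 hp with rfl | hp
    · exact h0
    · exact ih q h1.2 (h1.1.even h0) p hp

theorem eq_of_pos (h : DartWalk y₀ ω) {q q' : Dart} (hq : q ∈ ω) (hq' : q' ∈ ω) (e : q.pos = q'.pos) : q = q' :=
  List.inj_on_of_nodup_map h.nodup hq hq' e

end DartWalk

theorem outflow_eq_zero {r : ℤ × ℤ} {k : ℤ} {ξ : List Dart}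
    (h : ∀ u ∈ ξ, u.pos ≠ (r.1 + chi k, r.2 + chi (k - 1))) : outflow r k ξ = 0 := by
  rw [outflow, sum_map_congr_mem (g := fun _ => 0)]
  · simp
  · intro u hu
    have := h u hu
    simp only [Dart.pos, ne_eq, Prod.mk.injEq] at this
    rw [if_neg this]

theorem outflow_eq_chi {r : ℤ × ℤ} {k : ℤ} {ξ : List Dart} (hn : (ξ.map Dart.pos).Nodup) {u : Dart}
    (hu : u ∈ ξ) (h : u.pos = (r.1 + chi k, r.2 + chi (k - 1))) : outflow r k ξ = chi (u.d - k) := by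
  obtain ⟨l, l', rfl⟩ := List.append_of_mem hu
  have h1 : outflow r k l = 0 := outflow_eq_zero fun v hv e => by
    simp only [List.map_append, List.map_cons, List.nodup_append] at hn
    exact hn.2.2 _ (List.mem_map_of_mem hv) _ (List.mem_cons_self) (e.trans h.symm)
  have h2 : outflow r k l' = 0 := outflow_eq_zero fun v hv e => by
    simp only [List.map_append, List.map_cons, List.nodup_append, List.nodup_cons] at hn
    exact hn.2.1.1 (by rw [h, ← e]; exact List.mem_map_of_mem hv)
  simp only [Dart.pos, Prod.mk.injEq] at h
  unfold outflow at *
  simp [h1, h2, h]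

theorem pos_eq_iff {r : ℤ × ℤ} {j k : ℤ} :
    ((r.1 + chi j, r.2 + chi (j - 1)) = (r.1 + chi k, r.2 + chi (k - 1))) ↔ j % 4 = k % 4 := by
  simp only [Prod.mk.injEq, add_right_inj]
  rcases chi_cases j with ⟨_, k1, k2, -⟩ | ⟨_, k1, k2, -⟩ | ⟨_, k1, k2, -⟩ | ⟨_, k1, k2, -⟩ <;>
  rcases chi_cases k with ⟨_, j1, j2, -⟩ | ⟨_, j1, j2, -⟩ | ⟨_, j1, j2, -⟩ | ⟨_, j1, j2, -⟩ <;>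
  rw [k1, k2, j1, j2] <;> omega

theorem ahead_eq_iff {r : ℤ × ℤ} {q : Dart} {k : ℤ} (h : q.pos = (r.1 + chi k, r.2 + chi (k - 1))) :
    q.ahead = r ↔ q.d % 4 = (k + 2) % 4 := by
  simp only [Dart.pos, Dart.ahead, Prod.mk.injEq] at *
  obtain ⟨r1, r2⟩ := r
  simp only [Prod.mk.injEq] at *
  rw [h.1, h.2]
  rcases chi_cases q.d with ⟨_, k1, k2, -⟩ | ⟨_, k1, k2, -⟩ | ⟨_, k1, k2, -⟩ | ⟨_, k1, k2, -⟩ <;>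
  rcases chi_cases k with ⟨_, j1, j2, -⟩ | ⟨_, j1, j2, -⟩ | ⟨_, j1, j2, -⟩ | ⟨_, j1, j2, -⟩ <;>
  rw [k1, k2, j1, j2] <;> omega

theorem behind_eq_iff {r : ℤ × ℤ} {q : Dart} {k : ℤ} (h : q.pos = (r.1 + chi k, r.2 + chi (k - 1))) :
    q.behind = r ↔ q.d % 4 = k % 4 := by
  simp only [Dart.pos, Dart.behind, Prod.mk.injEq] at *
  obtain ⟨r1, r2⟩ := r
  simp only [Prod.mk.injEq] at *
  rw [h.1, h.2]
  rcases chi_cases q.d with ⟨_, k1, k2, -⟩ | ⟨_, k1, k2, -⟩ | ⟨_, k1, k2, -⟩ | ⟨_, k1, k2, -⟩ <;>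
  rcases chi_cases k with ⟨_, j1, j2, -⟩ | ⟨_, j1, j2, -⟩ | ⟨_, j1, j2, -⟩ | ⟨_, j1, j2, -⟩ <;>
  rw [k1, k2, j1, j2] <;> omega

namespace DartWalk

variable {y₀ : ℤ} {ω ξ : List Dart} {B A : ℤ × ℤ} {q q' : Dart}

theorem mem_left (hqq : [q, q'] <:+: ω) : q ∈ ω := hqq.subset List.mem_cons_self
theorem mem_right (hqq : [q, q'] <:+: ω) : q' ∈ ω := hqq.subset (by simp)

theorem _root_.RhombicSAW.Dart.Even.heading_of_pos {u : Dart} (hu : u.Even) {r : ℤ × ℤ} {k : ℤ}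
    (hr : r.1 % 2 = 1 ∧ r.2 % 2 = 1) (h : u.pos = (r.1 + chi k, r.2 + chi (k - 1))) :
    u.d % 2 = k % 2 := by
  obtain ⟨h1, h2⟩ := hu
  obtain ⟨h3, h4⟩ := hr
  simp only [Dart.pos, Prod.mk.injEq] at h
  obtain ⟨h5, h6⟩ := h
  rcases chi_cases k with ⟨_, k1, -⟩ | ⟨_, k1, -⟩ | ⟨_, k1, -⟩ | ⟨_, k1, -⟩ <;> rw [k1] at h5 <;> omega

/-- When a walk passes a rhombus, another part `ξ` of the walk does not cross, in total, the sides
on the left of this passage. -/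
theorem outflow_of_turn (hω : DartWalk y₀ ω) (hξ : ξ <:+: ω) (hL : Linked B ξ A) (hqq : [q, q'] <:+: ω)
    (hq' : q' ∉ ξ) (hq : q ∉ ξ ∧ A ≠ q.ahead ∨ ξ.getLast? = some q ∧ A = q.ahead) (hB : B ≠ q.ahead) :
    (q'.d = q.d → outflow q.ahead (q.d + 1) ξ = 0) ∧
      (q'.d = q.d - 1 → outflow q.ahead (q.d + 1) ξ + outflow q.ahead q.d ξ = 0) := by
  have hn : (ξ.map Dart.pos).Nodup := hω.nodup.sublist (hξ.sublist.map _)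
  have hqω := mem_left hqq
  have hqω' := mem_right hqq
  have ht := hω.turn_of_infix hqq
  have hpos' : q'.pos = (q.ahead.1 + chi q'.d, q.ahead.2 + chi (q'.d - 1)) := by
    rw [← ht.2]; exact q'.pos_behind
  constructor
  · intro hd
    refine outflow_eq_zero fun u hu hpos => ?_
    have huω := hξ.subset hu
    -- a dart through the left side would be part of a passage from left to right or back
    have hmod : u.d % 4 = (q.d + 3) % 4 ∨ u.d % 4 = (q.d + 1) % 4 := by
      have := (hω.even u huω).heading_of_pos (hω.even q hqω).ahead_odd hpos
      omega
    rcases hmod with hu3 | hu1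
    · have ha : u.ahead = q.ahead := (ahead_eq_iff hpos).2 (by omega)
      rcases hL.last_or_next hu with ⟨hl, hA⟩ | ⟨u', huu⟩
      · rcases hq with ⟨-, hq⟩ | ⟨hq, -⟩
        · exact hq (hA.symm.trans ha)
        · obtain rfl : u = q := by simpa [hl] using hq
          omega
      · have huu' := huu.trans hξ
        have hu' := hω.turn_of_infix huu'
        have hpu : u'.pos = (q.ahead.1 + chi u'.d, q.ahead.2 + chi (u'.d - 1)) := by
          rw [← ha, ← hu'.2]; exact u'.pos_behind
        rcases hu'.1 with h | h | h
        · -- back to the side where the passage starts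
          have : u' = q := hω.eq_of_pos (mem_right huu') hqω (by
            rw [hpu, q.pos_ahead, show q.d + 1 = q.d + 2 - 1 by ring]; exact pos_eq_iff.2 (by omega))
          subst this
          omega
        · have := hω.noncrossing q q' u u' hqq huu' hd h ha.symm
          omega
        · have : u' = q' := hω.eq_of_pos (mem_right huu') hqω' (by
            rw [hpu, hpos']; exact pos_eq_iff.2 (by omega))
          exact hq' (this ▸ mem_right huu)
    · have hb : u.behind = q.ahead := (behind_eq_iff hpos).2 (by omega)
      rcases hL.first_or_prev hu with h | ⟨u', huu⟩
      · exact hB (h.symm.trans hb)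
      · have huu' := huu.trans hξ
        have hu' := hω.turn_of_infix huu'
        have ha : u'.ahead = q.ahead := hu'.2.symm.trans hb
        have hpu := u'.pos_ahead
        rw [ha, show u'.d + 1 = u'.d + 2 - 1 by ring] at hpu
        rcases hu'.1 with h | h | h
        · have : u' = q' := hω.eq_of_pos (mem_left huu') hqω' (by
            rw [hpu, hpos']; exact pos_eq_iff.2 (by omega))
          exact hq' (this ▸ mem_left huu)
        · have := hω.noncrossing q q' u' u hqq huu' hd h ha.symm
          omega
        · have : u' = q := hω.eq_of_pos (mem_left huu') hqω (by
            rw [hpu, q.pos_ahead, show q.d + 1 = q.d + 2 - 1 by ring]; exact pos_eq_iff.2 (by omega))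
          subst this
          rcases hq with ⟨hq, -⟩ | ⟨hq, -⟩
          · exact hq (mem_left huu)
          · -- the last dart has no successor
            obtain ⟨l, l', rfl⟩ := huu
            have h2 : u' ∈ u :: l' := List.mem_of_getLast? (by simpa using hq)
            simp only [List.map_append, List.map_cons, List.append_assoc, List.nodup_append,
              List.nodup_cons] at hn
            have h3 : u'.pos ∈ (u :: l').map Dart.pos := List.mem_map_of_mem h2
            simp at hn h3
            grind
  · intro hd
    have h1 := hL.outflow_add q.ahead q.d
    have h2 : outflow q.ahead (q.d - 1) ξ = 0 := by
      refine outflow_eq_zero fun u hu hpos => hq' ?_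
      rw [← hd, ← hpos'] at hpos
      exact hω.eq_of_pos (hξ.subset hu) hqω' hpos ▸ hu
    have hq2 : q.pos = (q.ahead.1 + chi (q.d + 2), q.ahead.2 + chi (q.d + 2 - 1)) := by
      rw [show q.d + 2 - 1 = q.d + 1 by ring]; exact q.pos_ahead
    rw [h2, if_neg hB] at h1
    rcases hq with ⟨hq, hA⟩ | ⟨hq, hA⟩
    · rw [if_neg hA, outflow_eq_zero (k := q.d + 2)] at h1
      · linarith
      · intro u hu hpos
        rw [← hq2] at hpos
        exact hq (hω.eq_of_pos (hξ.subset hu) hqω hpos ▸ hu)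
    · rw [if_pos hA, outflow_eq_chi (k := q.d + 2) hn (List.mem_of_getLast? hq) hq2,
        show q.d - (q.d + 2) = -2 by ring, show chi (-2) = -1 from rfl] at h1
      linarith

/-- The number that vanishes, by `level_eq_zero`, at the corner of the rhombus `r` between the directions
`k` and `k + 1` when the last dart enters `r` with the heading `k - 1`: the crossings of the half-line to
the left of the corner, corrected by the virtual half-line `y = y₀`, `x < 0` from which the walk comes,
plus the number of full turns, normalised to vanish at the start. -/
def level (y₀ : ℤ) (r : ℤ × ℤ) (k : ℤ) (ω : List Dart) : ℤ :=
  crossings (corner r k) ω - (if y₀ < (corner r k).2 then 1 else 0) + k / 4 + 1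

theorem level_succ (hω : DartWalk y₀ ω) (hq : ω.getLast? = some q) (hr : 0 ≤ q.ahead.1) (k : ℤ) :
    level y₀ q.ahead (k + 1) ω + outflow q.ahead (k + 1) ω = level y₀ q.ahead k ω := by
  have hodd := (hω.even q (List.mem_of_getLast? hq)).ahead_odd
  have h := (hω.linked hq).crossings_succ (fun u hu => (hω.even u hu).1) hodd.1 k
  have h0 := hω.odd
  unfold level
  generalize q.ahead = r at *
  obtain ⟨r1, r2⟩ := r
  simp only at hr hodd
  have e1 : (corner (r1, r2) k).2 = r2 + chi (k - 1) + chi k := rfl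
  have e2 : (corner (r1, r2) (k + 1)).2 = r2 + chi k + chi (k + 1) := by simp [corner]
  rw [e1, e2]
  generalize crossings (corner (r1, r2) (k + 1)) ω = a at *
  generalize crossings (corner (r1, r2) k) ω = b at *
  generalize outflow (r1, r2) (k + 1) ω = c at *
  simp only [leftOf] at h
  rcases chi_cases k with ⟨k0, k1, k2, k3, -⟩ | ⟨k0, k1, k2, k3, -⟩ | ⟨k0, k1, k2, k3, -⟩ |
    ⟨k0, k1, k2, k3, -⟩ <;> simp only [k0, k1, k2, k3] at h ⊢ <;> norm_num at h <;> split_ifs at h ⊢ <;> omega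

theorem corner_ahead (q : Dart) : corner q.ahead (q.d + 1) = corner q.behind q.d := by
  simp only [corner, Dart.ahead, Dart.behind, Prod.mk.injEq, show q.d + 1 + 1 = q.d + 2 by ring,
    show q.d + 1 - 1 = q.d by ring]
  rcases chi_cases q.d with ⟨k0, k1, k2, k3, k4⟩ | ⟨k0, k1, k2, k3, k4⟩ | ⟨k0, k1, k2, k3, k4⟩ |
    ⟨k0, k1, k2, k3, k4⟩ <;> rw [k1, k2, k3, k4] <;> constructor <;> ring

theorem ahead_nonneg (hω : DartWalk y₀ ω) (hqq : [q, q'] <:+: ω) : 0 ≤ q.ahead.1 := by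
  have h1 := hω.nonneg q (mem_left hqq)
  have h2 := hω.nonneg q' (mem_right hqq)
  obtain ⟨h3, h4⟩ := hω.turn_of_infix hqq
  simp only [Dart.ahead, Dart.behind, Prod.mk.injEq] at *
  obtain ⟨h4, -⟩ := h4
  rcases chi_cases q.d with ⟨k0, k1, -⟩ | ⟨k0, k1, -⟩ | ⟨k0, k1, -⟩ | ⟨k0, k1, -⟩ <;>
  rcases chi_cases q'.d with ⟨j0, j1, -⟩ | ⟨j0, j1, -⟩ | ⟨j0, j1, -⟩ | ⟨j0, j1, -⟩ <;>
  rw [k1] at h4 ⊢ <;> rw [j1] at h4 <;> omega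

theorem crossings_append (c : ℤ × ℤ) (l l' : List Dart) :
    crossings c (l ++ l') = crossings c l + crossings c l' := by simp [crossings]

theorem crossings_left (q : Dart) : crossings (corner q.ahead (q.d + 1)) [q] = if q.d % 4 = 3 then -1 else 0 := by
  rw [corner_ahead]
  simp only [corner, crossings, Dart.behind, List.map_cons, List.map_nil, List.sum_cons, List.sum_nil]
  rcases chi_cases q.d with ⟨k0, k1, k2, k3, k4⟩ | ⟨k0, k1, k2, k3, k4⟩ | ⟨k0, k1, k2, k3, k4⟩ |
    ⟨k0, k1, k2, k3, k4⟩ <;> simp only [k0, k1, k2, k3] <;> simp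

theorem start_behind_ne (h : 0 ≤ q.ahead.1) : ((-1, y₀) : ℤ × ℤ) ≠ q.ahead := by
  intro hc; rw [← hc] at h; simp at h

/-- The winding of a self-avoiding walk is determined by its crossings with the half-line to the left
of its end. -/
theorem level_eq_zero (hω : DartWalk y₀ ω) (hq : ω.getLast? = some q) :
    level y₀ q.ahead (q.d + 1) ω = 0 := by
  induction ω using List.reverseRecOn generalizing q with
  | nil => simp at hq
  | append_singleton l p ih =>
    obtain rfl : p = q := by simpa using hq
    rcases List.eq_nil_or_concat' l with rfl | ⟨l, q, rfl⟩
    · have := hω.head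
      obtain rfl : p = ⟨0, y₀, 0⟩ := by simpa using this
      simp [level, crossings, corner, Dart.ahead, chi]
    · have hω' := hω.of_append (l := l ++ [q]) (by simp)
      have h0 := ih (q := q) hω' (by simp)
      have hqq : [q, p] <:+: l ++ [q] ++ [p] := ⟨l, [], by simp⟩
      have hr := hω.ahead_nonneg hqq
      have hp : p ∉ l ++ [q] := fun hc => by
        have := hω.nodup
        rw [List.map_append, List.nodup_append] at this
        exact this.2.2 _ (List.mem_map_of_mem hc) _ (by simp) rfl
      have ht := hω.turn_of_infix hqq
      have ho := hω.outflow_of_turn (List.prefix_append _ _).isInfix (hω'.linked (q := q) (by simp)) hqq hp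
        (.inr ⟨by simp, rfl⟩) (start_behind_ne hr)
      have hs := hω'.level_succ (q := q) (by simp) hr
      have key : level y₀ q.ahead p.d (l ++ [q]) = 0 := by
        rcases ht.1 with h | h | h
        · have h1 := hs q.d
          have h2 := hs (q.d - 1)
          have h3 := ho.2 h
          rw [sub_add_cancel] at h2
          rw [h]; omega
        · have h1 := hs q.d
          have h3 := ho.1 h
          rw [h]; omega
        · rw [h, h0]
      have e := crossings_left p
      rw [level, ← ht.2, ← corner_ahead] at key
      rw [level, crossings_append, e]
      split_ifs at key ⊢ <;> omega

/-- A part of the walk that starts and ends in the same rhombus does not wind around the part of the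
walk that precedes the first visit to this rhombus. -/
theorem crossings_loop {r : ℤ × ℤ} {α β l l' : List Dart} {y : Dart} (hω : DartWalk y₀ (α ++ y :: β))
    (hβ : Linked r β r) (hα : ∀ q ∈ α, q.ahead ≠ r) (hl : α ++ [y] = l ++ l') (hq : l.getLast? = some q) :
    crossings (corner q.ahead (q.d + 1)) β = 0 := by
  induction l using List.reverseRecOn generalizing q l' with
  | nil => simp at hq
  | append_singleton l p ih =>
    obtain rfl : p = q := by simpa using hq
    have e : α ++ y :: β = α ++ [y] ++ β := by simp
    rcases List.eq_nil_or_concat' l with rfl | ⟨l, q, rfl⟩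
    · have := hω.head
      rw [e, hl] at this
      obtain rfl : p = ⟨0, y₀, 0⟩ := by simpa using this
      rw [crossings, sum_map_congr_mem (g := fun _ => 0)]
      · simp
      · intro u hu
        have := hω.nonneg u (by simp [hu])
        simp [corner, Dart.ahead, chi]
        omega
    · rw [e, hl] at hω
      have h0 := ih (q := q) (l' := p :: l') (by simp [hl]) (by simp)
      have hqα : q ∈ α := by
        rcases List.eq_nil_or_concat' l' with rfl | ⟨l', z, rfl⟩
        · have := congrArg List.dropLast hl
          simp at this
          simp [this]
        · have := congrArg List.dropLast hl
          simp at this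
          simp [this]
      have hqq : [q, p] <:+: l ++ [q] ++ [p] ++ l' ++ β := ⟨l, l' ++ β, by simp⟩
      have hr := hω.ahead_nonneg hqq
      have hnot : ∀ u ∈ l ++ [q] ++ [p], u ∉ β := fun u hu hc => by
        have := hω.nodup
        rw [List.map_append, List.nodup_append] at this
        exact this.2.2 _ (List.mem_map_of_mem (List.mem_append_left _ hu)) _ (List.mem_map_of_mem hc) rfl
      have ht := hω.turn_of_infix hqq
      have hβω : β <:+: l ++ [q] ++ [p] ++ l' ++ β := (List.suffix_append _ _).isInfix
      have ho := hω.outflow_of_turn hβω hβ hqq (hnot p (by simp))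
        (.inl ⟨hnot q (by simp), (hα q hqα).symm⟩) (hα q hqα).symm
      have hs : ∀ k, crossings (corner q.ahead (k + 1)) β + outflow q.ahead (k + 1) β =
          crossings (corner q.ahead k) β := fun k => by
        have := hβ.crossings_succ (fun u hu => (hω.even u (hβω.subset hu)).1)
          (hω.even q (mem_left hqq)).ahead_odd.1 k
        simpa using this
      have key : crossings (corner q.ahead p.d) β = 0 := by
        rcases ht.1 with h | h | h
        · have h1 := hs q.d
          have h2 := hs (q.d - 1)
          have h3 := ho.2 h
          rw [sub_add_cancel] at h2
          rw [h]; omega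
        · have h1 := hs q.d
          have h3 := ho.1 h
          rw [h]; omega
        · rw [h, h0]
      rw [corner_ahead, ht.2, key]

end DartWalk

theorem corner_congr (r : ℤ × ℤ) {k k' : ℤ} (h : k % 4 = k' % 4) : corner r k = corner r k' := by
  simp only [corner]
  rw [chi_congr h, chi_congr (show (k + 1) % 4 = (k' + 1) % 4 by omega),
    chi_congr (show (k - 1) % 4 = (k' - 1) % 4 by omega)]

theorem outflow_congr (r : ℤ × ℤ) {k k' : ℤ} (h : k % 4 = k' % 4) (ξ : List Dart) :
    outflow r k ξ = outflow r k' ξ := by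
  simp only [outflow]
  rw [chi_congr h, chi_congr (show (k - 1) % 4 = (k' - 1) % 4 by omega)]
  refine sum_map_congr_mem fun q _ => ?_
  rw [chi_congr (show (q.d - k) % 4 = (q.d - k') % 4 by omega)]

namespace DartWalk

variable {y₀ : ℤ} {ω : List Dart} {q : Dart}

theorem level_congr (r : ℤ × ℤ) {k k' : ℤ} (h : k % 4 = k' % 4) (ω : List Dart) :
    level y₀ r k ω - k / 4 = level y₀ r k' ω - k' / 4 := by
  simp only [level]
  rw [corner_congr r h]
  ring

/-- The winding of a loop: the walk enters a rhombus for the first time at `y`, leaves it through the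
side at `t₁` quarter-turns from the direction of `y`, and comes back for the first time at `x`, through
the side at `t₂` quarter-turns from the direction of `y`. -/
theorem heading_loop {α β : List Dart} {y z x : Dart} (hω : DartWalk y₀ (α ++ y :: z :: β))
    (hx : (z :: β).getLast? = some x) (hr : x.ahead = y.ahead) (hα : ∀ q ∈ α, q.ahead ≠ y.ahead)
    {t₁ t₂ : ℤ} (h₁ : z.d = y.d + t₁)
    (h₂ : x.pos = (y.ahead.1 + chi (y.d + t₂), y.ahead.2 + chi (y.d + t₂ - 1)))
    (ht₂ : t₂ = -1 ∨ t₂ = 0 ∨ t₂ = 1) (hne : t₁ ≠ t₂) :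
    x.d = y.d + t₂ + if t₁ < t₂ then 2 else -2 := by
  have hyz : [y, z] <:+: α ++ y :: z :: β := ⟨α, β, by simp⟩
  have hlast : (α ++ y :: z :: β).getLast? = some x := by
    rw [List.getLast?_append, List.getLast?_cons_cons, hx]; rfl
  have ht := hω.turn_of_infix hyz
  have hn := hω.nodup
  have hzω : z ∈ α ++ y :: z :: β := mem_right hyz
  have hyω : y ∈ α ++ y :: z :: β := mem_left hyz
  have hxω : x ∈ α ++ y :: z :: β := List.mem_of_getLast? hlast
  have h0 := hω.ahead_nonneg hyz
  have hodd := (hω.even y hyω).ahead_odd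
  have hL := hω.linked hlast
  have hs := hω.level_succ hlast (hr ▸ h0)
  have hx0 := hω.level_eq_zero hlast
  rw [hr] at hL hs hx0
  have hβ : Linked y.ahead (z :: β) y.ahead := by
    have := linked_of_isChain (f := z) (q := x) (hω.turn.suffix ⟨α ++ [y], by simp⟩) rfl hx
    rwa [ht.2, hr] at this
  have hc := hω.crossings_loop hβ hα (l := α ++ [y]) (l' := []) (q := y) (by simp) (by simp)
  have hy0 : level y₀ y.ahead (y.d + 1) (α ++ y :: z :: β) = 0 := by
    have h := (DartWalk.of_append (l := α ++ [y]) (l' := z :: β) (by simpa using hω) (by simp)).level_eq_zero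
      (q := y) (by simp)
    rw [level] at h ⊢
    rw [show α ++ y :: z :: β = (α ++ [y]) ++ z :: β by simp, crossings_append, hc]
    simpa using h
  -- the flux through the four sides
  have o1 : outflow y.ahead (y.d + 2) (α ++ y :: z :: β) = -1 := by
    rw [outflow_eq_chi hn hyω (by rw [show y.d + 2 - 1 = y.d + 1 by ring]; exact y.pos_ahead),
      show y.d - (y.d + 2) = -2 by ring]; rfl
  have o2 : outflow y.ahead z.d (α ++ y :: z :: β) = 1 := by
    rw [outflow_eq_chi hn hzω (by rw [← ht.2]; exact z.pos_behind), sub_self]; rfl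
  have hxd := (ahead_eq_iff h₂).1 hr
  have o3 : outflow y.ahead (y.d + t₂) (α ++ y :: z :: β) = -1 := by
    rw [outflow_eq_chi hn hxω h₂, chi_congr (show (x.d - (y.d + t₂)) % 4 = 2 % 4 by omega)]; rfl
  have o4 := hL.outflow_add y.ahead y.d
  rw [if_neg (start_behind_ne h0), if_pos rfl] at o4
  have s1 := hs (y.d + 1)
  have s2 := hs (y.d + 2)
  have s3 := hs (y.d + 3)
  rw [show y.d + 1 + 1 = y.d + 2 by ring] at s1
  rw [show y.d + 2 + 1 = y.d + 3 by ring, outflow_congr (k := y.d + 3) (k' := y.d - 1) _ (by omega)] at s2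
  rw [show y.d + 3 + 1 = y.d + 4 by ring, outflow_congr (k := y.d + 4) (k' := y.d) _ (by omega)] at s3
  have ht₁ : t₁ = -1 ∨ t₁ = 0 ∨ t₁ = 1 := by have := ht.1; omega
  rw [h₁] at o2
  rcases ht₂ with rfl | rfl | rfl <;> rcases ht₁ with rfl | rfl | rfl
  · omega
  · have := level_congr (y₀ := y₀) y.ahead (k := x.d + 1) (k' := y.d + 2) (by omega) (α ++ y :: z :: β)
    simp only [add_zero, ← sub_eq_add_neg] at *
    norm_num
    omega
  · have := level_congr (y₀ := y₀) y.ahead (k := x.d + 1) (k' := y.d + 2) (by omega) (α ++ y :: z :: β)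
    simp only [← sub_eq_add_neg] at *
    norm_num
    omega
  · have := level_congr (y₀ := y₀) y.ahead (k := x.d + 1) (k' := y.d + 3) (by omega) (α ++ y :: z :: β)
    simp only [add_zero, ← sub_eq_add_neg] at *
    norm_num
    omega
  · omega
  · have := level_congr (y₀ := y₀) y.ahead (k := x.d + 1) (k' := y.d + 3) (by omega) (α ++ y :: z :: β)
    simp only [add_zero] at *
    norm_num
    omega
  · have := level_congr (y₀ := y₀) y.ahead (k := x.d + 1) (k' := y.d + 4) (by omega) (α ++ y :: z :: β)
    simp only [← sub_eq_add_neg] at *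
    norm_num
    omega
  · have := level_congr (y₀ := y₀) y.ahead (k := x.d + 1) (k' := y.d + 4) (by omega) (α ++ y :: z :: β)
    simp only [add_zero] at *
    norm_num
    omega
  · omega

theorem corner_eq (q : Dart) : corner q.ahead (q.d + 1) = (q.x + chi (q.d + 1), q.y + chi q.d) := by
  rw [corner_ahead]; simp [corner, Dart.behind]

/-- The headings with which a walk can come back to the left boundary. -/
theorem heading_left (hω : DartWalk y₀ ω) (hq : ω.getLast? = some q) (hx : q.x = 0) (hd : q.d % 4 = 2) :
    q.d = 2 ∨ q.d = -2 := by
  have h := hω.level_eq_zero hq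
  have h1 : crossings (corner q.ahead (q.d + 1)) ω = 0 := by
    rw [crossings, sum_map_congr_mem (g := fun _ => 0)]
    · simp
    · intro u hu
      have := hω.nonneg u hu
      rw [corner_eq, hx, chi_congr (show (q.d + 1) % 4 = 3 % 4 by omega)]
      rw [if_neg]
      rintro ⟨-, hc⟩
      exact absurd hc (not_lt.2 this)
  rw [level, h1] at h
  split_ifs at h <;> omega

/-- The heading with which a walk reaches a right boundary. -/
theorem heading_right (hω : DartWalk y₀ ω) (hq : ω.getLast? = some q) (hx : ∀ u ∈ ω, u.x ≤ q.x)
    (hd : q.d % 4 = 0) : q.d = 0 := by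
  have h := hω.level_eq_zero hq
  have he := hω.even q (List.mem_of_getLast? hq)
  have e1 : chi (q.d + 1) = 0 := chi_congr (show (q.d + 1) % 4 = 1 % 4 by omega)
  have e2 : chi q.d = 1 := chi_congr (show q.d % 4 = 0 % 4 by omega)
  have e3 : chi (q.d - 1) = 0 := chi_congr (show (q.d - 1) % 4 = 3 % 4 by omega)
  rw [level, corner_eq, e1, e2] at h
  have h1 : crossings (q.x + 0, q.y + 1) ω = crossings (q.x + 1, q.y + 1) ω := by
    refine sum_map_congr_mem fun u hu => ?_
    have h1 := hx u hu
    have h2 := hω.even u hu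
    obtain ⟨h3, -⟩ := h2
    obtain ⟨h4, -⟩ := he
    rcases chi_cases u.d with ⟨k0, k1, k2, -⟩ | ⟨k0, k1, k2, -⟩ | ⟨k0, k1, k2, -⟩ | ⟨k0, k1, k2, -⟩ <;>
      simp only [k2] <;> split_ifs <;> omega
  have h2 := (hω.linked hq).crossings_line (fun u hu => (hω.even u hu).2) (c := (q.x + 1, q.y + 1))
    (by have := he.2; simp only; omega) (fun u hu => by have := hx u hu; simp only; omega)
  have h3 : q.ahead.2 = q.y + 0 := by simp [Dart.ahead, e3]
  rw [h1, h2, h3] at h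
  have := hω.odd
  have := he.2
  simp only at h
  split_ifs at h <;> omega

/-- The headings with which a walk reaches a horizontal line that it has not met before. -/
theorem heading_horizontal (hω : DartWalk y₀ ω) (hq : ω.getLast? = some q)
    (hy : ∀ u ∈ ω, u ≠ q → u.y ≠ q.y) :
    (q.d % 4 = 1 → y₀ < q.y → q.d = 1) ∧ (q.d % 4 = 3 → q.y < y₀ → q.d = -1) := by
  have h := hω.level_eq_zero hq
  obtain ⟨l, rfl⟩ : ∃ l, ω = l ++ [q] := by
    rcases List.eq_nil_or_concat' ω with rfl | ⟨l, b, rfl⟩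
    · simp at hq
    · obtain rfl : b = q := by simpa using hq
      exact ⟨l, rfl⟩
  have hl : q ∉ l := fun hc => by
    have := hω.nodup
    rw [List.map_append, List.nodup_append] at this
    exact this.2.2 _ (List.mem_map_of_mem hc) _ (by simp) rfl
  rw [level, crossings_append, crossings_left] at h
  have key : chi q.d = 0 → crossings (corner q.ahead (q.d + 1)) l = 0 := by
    intro hd
    rw [crossings, sum_map_congr_mem (g := fun _ => 0)]
    · simp
    · intro u hu
      have := hy u (by simp [hu]) (fun hc => hl (hc ▸ hu))
      rw [corner_eq, hd, if_neg]
      rintro ⟨hc, -⟩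
      exact this (by simpa using hc)
  constructor
  · intro hd h1
    have e := chi_congr (show q.d % 4 = 1 % 4 by omega)
    rw [key e, hd, corner_eq, e, show chi 1 = 0 from rfl] at h
    simp [h1] at h
    omega
  · intro hd h1
    have e := chi_congr (show q.d % 4 = 3 % 4 by omega)
    rw [key e, hd, corner_eq, e, show chi 3 = 0 from rfl] at h
    simp at h
    omega

end DartWalk

/-! ### The darts of a walk in the strip -/

/-- The place of a mid-edge on the integer lattice. -/
def Edge.pos : Edge T → ℤ × ℤ
  | .vert k j => (2 * k.val, 2 * j + 1)
  | .horiz k j => (2 * k.val + 1, 2 * j)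

/-- The centre of a rhombus on the integer lattice. -/
def center (r : Rhombus T) : ℤ × ℤ := (2 * r.1.val + 1, 2 * r.2 + 1)

theorem Edge.pos_injective : (Edge.pos : Edge T → ℤ × ℤ).Injective := by
  rintro (⟨k, j⟩ | ⟨k, j⟩) (⟨k', j'⟩ | ⟨k', j'⟩) h <;>
    simp only [Edge.pos, Prod.mk.injEq, Edge.vert.injEq, Edge.horiz.injEq, Fin.ext_iff, reduceCtorEq] at * <;>
    omega

theorem center_injective : (center : Rhombus T → ℤ × ℤ).Injective := by
  rintro ⟨k, j⟩ ⟨k', j'⟩ h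
  simp only [center, Prod.mk.injEq, Fin.ext_iff] at *
  omega

/-- The number of the side of a rhombus in the direction `d`. -/
def sideIdx (d : ℤ) : Fin 4 := if d % 4 = 0 then 2 else if d % 4 = 1 then 1 else if d % 4 = 2 then 0 else 3

theorem pos_side4 (r : Rhombus T) (k : ℤ) :
    (side4 r (sideIdx k)).pos = ((center r).1 + chi k, (center r).2 + chi (k - 1)) := by
  rcases chi_cases k with ⟨k0, k1, k2, -⟩ | ⟨k0, k1, k2, -⟩ | ⟨k0, k1, k2, -⟩ | ⟨k0, k1, k2, -⟩ <;>
    rw [k1, k2] <;> simp [sideIdx, k0, side4, west, east, north, south, Edge.pos, center] <;> ring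

theorem mem_sides_iff_pos {r : Rhombus T} {e : Edge T} :
    e ∈ sides r ↔ ∃ k : ℤ, e.pos = ((center r).1 + chi k, (center r).2 + chi (k - 1)) := by
  constructor
  · intro h
    obtain ⟨i, rfl⟩ := mem_sides_iff.1 h
    obtain ⟨k, rfl⟩ : ∃ k : ℤ, sideIdx k = i := by
      fin_cases i
      exacts [⟨2, rfl⟩, ⟨1, rfl⟩, ⟨0, rfl⟩, ⟨3, rfl⟩]
    exact ⟨k, pos_side4 r k⟩
  · rintro ⟨k, h⟩
    rw [← pos_side4] at h
    rw [Edge.pos_injective h]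
    exact side4_mem _ _

/-- The dart with which the walk passes the mid-edge `e` after the dart `q`. -/
def nextDart (q : Dart) (e : Edge T) : Dart :=
  ⟨e.pos.1, e.pos.2, q.d +
    if e.pos = (q.ahead.1 + chi (q.d + 1), q.ahead.2 + chi q.d) then 1
    else if e.pos = (q.ahead.1 + chi (q.d - 1), q.ahead.2 + chi (q.d - 2)) then -1 else 0⟩

/-- The darts of a walk that continues after the dart `q`. -/
def trail (q : Dart) : List (Edge T) → List Dart
  | [] => []
  | e :: l => nextDart q e :: trail (nextDart q e) l

/-- The darts of a walk that starts with the heading `0`. -/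
def darts : List (Edge T) → List Dart
  | [] => []
  | a :: l => ⟨a.pos.1, a.pos.2, 0⟩ :: trail ⟨a.pos.1, a.pos.2, 0⟩ l

theorem trail_append (q : Dart) (l l' : List (Edge T)) :
    trail q (l ++ l') = trail q l ++ trail (l.foldl nextDart q) l' := by
  induction l generalizing q with
  | nil => rfl
  | cons e l ih => simp [trail, ih]

theorem map_pos_trail (q : Dart) (l : List (Edge T)) : (trail q l).map Dart.pos = l.map Edge.pos := by
  induction l generalizing q with
  | nil => rfl
  | cons e l ih => simp [trail, ih, nextDart, Dart.pos]

theorem map_pos_darts (γ : List (Edge T)) : (darts γ).map Dart.pos = γ.map Edge.pos := by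
  cases γ with
  | nil => rfl
  | cons a l => simp [darts, map_pos_trail, Dart.pos]

theorem darts_prefix (γ γ' : List (Edge T)) : darts γ <+: darts (γ ++ γ') := by
  cases γ with
  | nil => simp [darts]
  | cons a l => exact ⟨_, by simp only [darts, List.cons_append, trail_append]; rfl⟩

theorem getLast?_trail (q : Dart) (l : List (Edge T)) :
    (q :: trail q l).getLast? = some (l.foldl nextDart q) := by
  induction l generalizing q with
  | nil => rfl
  | cons e l ih => rw [trail, List.getLast?_cons_cons, ih]; rfl

theorem exists_getLast?_darts {γ : List (Edge T)} (h : γ ≠ []) : ∃ q, (darts γ).getLast? = some q := by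
  obtain ⟨a, l, rfl⟩ := List.exists_cons_of_ne_nil h
  exact ⟨_, getLast?_trail _ _⟩

theorem pos_last {γ : List (Edge T)} {q : Dart} {x : Edge T} (hq : (darts γ).getLast? = some q)
    (hx : γ.getLast? = some x) : q.pos = x.pos := by
  have := congrArg List.getLast? (map_pos_darts γ)
  rw [List.getLast?_map, List.getLast?_map, hq, hx] at this
  simpa using this

theorem darts_concat {γ : List (Edge T)} {q : Dart} (hq : (darts γ).getLast? = some q) (z : Edge T) :
    darts (γ ++ [z]) = darts γ ++ [nextDart q z] := by
  cases γ with
  | nil => simp [darts] at hq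
  | cons a l =>
    simp only [darts, List.cons_append, trail_append]
    rw [darts, getLast?_trail] at hq
    obtain rfl := Option.some.inj hq
    rfl

theorem exists_infix_of_darts {γ : List (Edge T)} {q q' : Dart} (h : [q, q'] <:+: darts γ) :
    ∃ e f, [e, f] <:+: γ ∧ e.pos = q.pos ∧ f.pos = q'.pos := by
  obtain ⟨l, l', h⟩ := h
  have := map_pos_darts γ
  rw [← h] at this
  simp only [List.map_append, List.map_cons, List.map_nil, List.append_assoc] at this
  obtain ⟨γ₁, γ₂, rfl, -, h2⟩ := List.map_eq_append_iff.1 this.symm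
  obtain ⟨e, γ₂, rfl, he, h2⟩ := List.map_eq_cons_iff.1 h2
  obtain ⟨f, γ₂, rfl, hf, h2⟩ := List.map_eq_cons_iff.1 h2
  exact ⟨e, f, ⟨γ₁, γ₂, by simp⟩, he, hf⟩

theorem exists_infix_darts {γ : List (Edge T)} {e f : Edge T} (h : [e, f] <:+: γ) :
    ∃ q q', [q, q'] <:+: darts γ ∧ q.pos = e.pos ∧ q'.pos = f.pos := by
  obtain ⟨l, l', h⟩ := h
  have := map_pos_darts γ
  rw [← h] at this
  simp only [List.map_append, List.map_cons, List.map_nil, List.append_assoc] at this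
  obtain ⟨γ₁, γ₂, h1, -, h2⟩ := List.map_eq_append_iff.1 this
  obtain ⟨q, γ₂, rfl, he, h2⟩ := List.map_eq_cons_iff.1 h2
  obtain ⟨q', γ₂, rfl, hf, h2⟩ := List.map_eq_cons_iff.1 h2
  exact ⟨q, q', ⟨γ₁, γ₂, by rw [← h, List.append_assoc]; simp only [List.append_assoc, List.cons_append, List.nil_append] at h1 ⊢; rw [h1]⟩, he, hf⟩

theorem IsSAW.of_append {l l' : List (Edge T)} (h : IsSAW (l ++ l')) (hl : l ≠ []) : IsSAW l where
  ne_nil := hl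
  nodup := h.nodup.of_append_left
  step := h.step.left_of_append
  crosses := fun r e f g hi => h.crosses r e f g (hi.trans (List.prefix_append l l').isInfix)
  noncrossing := fun r hr => h.noncrossing r ⟨joins_append_left _ hr.1, joins_append_left _ hr.2⟩

theorem center_odd (r : Rhombus T) : (center r).1 % 2 = 1 ∧ (center r).2 % 2 = 1 := by
  simp only [center]; omega

/-- A rhombus that has a dart on its boundary is ahead of the dart or behind it. -/
theorem Dart.Even.ahead_or_behind {q : Dart} (hq : q.Even) {r : Rhombus T} {e : Edge T} (he : e ∈ sides r)
    (h : e.pos = q.pos) : q.ahead = center r ∨ q.behind = center r := by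
  obtain ⟨k, hk⟩ := mem_sides_iff_pos.1 he
  rw [h] at hk
  have := hq.heading_of_pos (center_odd r) hk
  rw [ahead_eq_iff hk, behind_eq_iff hk]
  omega

theorem mem_sides_of_ahead {q : Dart} {r : Rhombus T} {e : Edge T} (h : e.pos = q.pos) (hr : q.ahead = center r) :
    e ∈ sides r :=
  mem_sides_iff_pos.2 ⟨q.d + 2, by rw [h, ← hr, show q.d + 2 - 1 = q.d + 1 by ring]; exact q.pos_ahead⟩

theorem mem_sides_of_behind {q : Dart} {r : Rhombus T} {e : Edge T} (h : e.pos = q.pos) (hr : q.behind = center r) :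
    e ∈ sides r :=
  mem_sides_iff_pos.2 ⟨q.d, by rw [h, ← hr]; exact q.pos_behind⟩

theorem sideIdx_eq_iff {d : ℤ} : (sideIdx d = 2 ↔ d % 4 = 0) ∧ (sideIdx d = 1 ↔ d % 4 = 1) ∧
    (sideIdx d = 0 ↔ d % 4 = 2) ∧ (sideIdx d = 3 ↔ d % 4 = 3) := by
  have h : d % 4 = 0 ∨ d % 4 = 1 ∨ d % 4 = 2 ∨ d % 4 = 3 := by omega
  rcases h with h | h | h | h <;> simp [sideIdx, h]

/-- The darts of a self-avoiding walk that starts on the left boundary form a self-avoiding lattice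
walk. -/
theorem IsSAW.dartWalk {γ : List (Edge T)} (hγ : IsSAW γ) {j : ℤ} (h0 : γ.head? = some (.vert 0 j)) :
    DartWalk (2 * j + 1) (darts γ) := by
  induction γ using List.reverseRecOn with
  | nil => simp at h0
  | append_singleton l z ih =>
    rcases List.eq_nil_or_concat' l with rfl | ⟨l, x, rfl⟩
    · obtain rfl : z = .vert 0 j := by simpa using h0
      refine ⟨by simp [darts, Edge.pos], by omega, by simp [darts, trail], by simp [darts, trail],
        by simp [darts, trail, Edge.pos], ?_⟩
      intro q q' u u' h
      exact absurd h.length_le (by simp [darts, trail])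
    · have hγ' := hγ.of_append (l := l ++ [x]) (by simp)
      have ih := ih hγ' (by simpa using h0)
      obtain ⟨q, hq⟩ : ∃ q, (darts (l ++ [x])).getLast? = some q := exists_getLast?_darts (by simp)
      have hqx : q.pos = x.pos := pos_last hq (by simp)
      have hqm := List.mem_of_getLast? hq
      have hqe := ih.even q hqm
      obtain ⟨r, hxr, hzr⟩ : ∃ r, x ∈ sides r ∧ z ∈ sides r := by
        have := hγ.step
        rw [List.isChain_iff_forall_rel_of_append_cons_cons] at this
        exact this (by simp : l ++ [x] ++ [z] = l ++ x :: z :: [])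
      have hxz : x ≠ z := by
        have := hγ.nodup
        simp [List.nodup_append] at this
        tauto
      have hr : q.ahead = center r := by
        refine (hqe.ahead_or_behind hxr hqx.symm).resolve_right fun hb => ?_
        rcases (ih.linked hq).first_or_prev hqm with h | ⟨p, hp⟩
        · rw [h] at hb
          simp only [center, Prod.mk.injEq] at hb
          omega
        · obtain ⟨e, f, hef, he, hf⟩ := exists_infix_of_darts hp
          obtain rfl : f = x := Edge.pos_injective (hf.trans hqx)
          have her : e ∈ sides r := mem_sides_of_ahead he ((ih.turn_of_infix hp).2.symm.trans hb)
          refine hγ.crosses r e f z ?_ ⟨her, hxr, hzr⟩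
          -- the predecessor of the last mid-edge
          obtain ⟨m, m', hm⟩ := hef
          rcases List.eq_nil_or_concat' m' with rfl | ⟨m', w, rfl⟩
          · exact ⟨m, [], by rw [← hm]; simp⟩
          · have h1 : f = w := by
              have := congrArg List.getLast? hm
              rw [← List.append_assoc, List.getLast?_concat, List.getLast?_concat] at this
              simpa using this.symm
            have := hγ'.nodup
            rw [← hm, h1] at this
            simp [List.nodup_append] at this
      obtain ⟨k, hk⟩ := mem_sides_iff_pos.1 hzr
      have hk2 : k % 4 ≠ (q.d + 2) % 4 := fun hc => by
        refine hxz (Edge.pos_injective ?_)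
        rw [← hqx, hk, q.pos_ahead, hr, show q.d + 1 = q.d + 2 - 1 by ring]
        exact (pos_eq_iff.2 hc).symm
      have ht : Turn q (nextDart q z) := by
        have c1 : z.pos = (q.ahead.1 + chi (q.d + 1), q.ahead.2 + chi q.d) ↔ k % 4 = (q.d + 1) % 4 := by
          rw [hr, hk, show chi q.d = chi (q.d + 1 - 1) by ring_nf]; exact pos_eq_iff
        have c2 : z.pos = (q.ahead.1 + chi (q.d - 1), q.ahead.2 + chi (q.d - 2)) ↔ k % 4 = (q.d - 1) % 4 := by
          rw [hr, hk, show chi (q.d - 2) = chi (q.d - 1 - 1) by ring_nf]; exact pos_eq_iff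
        have hpos : (nextDart q z).pos = ((center r).1 + chi k, (center r).2 + chi (k - 1)) := hk
        have hd : (nextDart q z).d = q.d + if k % 4 = (q.d + 1) % 4 then 1 else if k % 4 = (q.d - 1) % 4 then -1 else 0 := by
          simp only [nextDart, c1, c2]
        constructor
        · rw [hd]; split_ifs <;> omega
        · rw [hr, behind_eq_iff hpos, hd]; split_ifs <;> omega
      rw [darts_concat hq]
      refine ⟨?_, ih.odd, ?_, ?_, ?_, ?_⟩
      · rw [List.head?_append, ih.head]; rfl
      · rw [List.isChain_append]
        refine ⟨ih.turn, by simp, fun u hu w hw => ?_⟩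
        obtain rfl : q = u := by simpa [hq] using hu
        obtain rfl : nextDart q z = w := by simpa using hw
        exact ht
      · rw [← darts_concat hq, map_pos_darts]
        exact hγ.nodup.map Edge.pos_injective
      · intro u hu
        rw [← darts_concat hq] at hu
        have := List.mem_map_of_mem (f := Dart.pos) hu
        rw [map_pos_darts] at this
        obtain ⟨e, -, he⟩ := List.mem_map.1 this
        have : u.x = e.pos.1 := by rw [he]; rfl
        rw [this]
        cases e <;> simp only [Edge.pos] <;> omega
      · -- perpendicular passages would cross
        have key : ∀ u u', [u, u'] <:+: darts (l ++ [x]) ++ [nextDart q z] → u'.d = u.d →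
            Turn u u' → u.Even → ∃ r, u.ahead = center r ∧
              Joins (l ++ [x] ++ [z]) (side4 r (sideIdx (u.d + 2))) (side4 r (sideIdx u.d)) := by
          intro u u' hu hd htu heu
          rw [← darts_concat hq] at hu
          obtain ⟨e, f, hef, he, hf⟩ := exists_infix_of_darts hu
          obtain ⟨m, m', hm⟩ := hef
          obtain ⟨r', her, hfr⟩ : ∃ r, e ∈ sides r ∧ f ∈ sides r := by
            have := hγ.step
            rw [List.isChain_iff_forall_rel_of_append_cons_cons] at this
            exact this (l₁ := m) (l₂ := m') (by rw [← hm]; simp)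
          have hbu : u'.behind = u.ahead := htu.2
          have h1 : u.ahead = center r' := by
            refine (heu.ahead_or_behind her he).resolve_right fun hb => ?_
            obtain ⟨k, hk⟩ := mem_sides_iff_pos.1 hfr
            rw [hf, Dart.pos_behind, hd, hbu, ← hb] at hk
            simp only [Dart.ahead, Dart.behind, Prod.mk.injEq] at hk
            rcases chi_cases u.d with ⟨k0, k1, k2, -⟩ | ⟨k0, k1, k2, -⟩ | ⟨k0, k1, k2, -⟩ | ⟨k0, k1, k2, -⟩ <;>
            rcases chi_cases k with ⟨j0, j1, j2, -⟩ | ⟨j0, j1, j2, -⟩ | ⟨j0, j1, j2, -⟩ | ⟨j0, j1, j2, -⟩ <;>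
            rw [k1, k2, j1, j2] at hk <;> omega
          refine ⟨r', h1, .inl ⟨m, m', ?_⟩⟩
          rw [← hm]
          congr 3
          · apply Edge.pos_injective
            rw [pos_side4, he, u.pos_ahead, h1, show u.d + 2 - 1 = u.d + 1 by ring]
          · congr 1
            apply Edge.pos_injective
            rw [pos_side4, hf, u'.pos_behind, hbu, h1, hd]
        have hturn : (darts (l ++ [x]) ++ [nextDart q z]).IsChain Turn := by
          rw [List.isChain_append]
          refine ⟨ih.turn, by simp, fun u hu w hw => ?_⟩
          obtain rfl : q = u := by simpa [hq] using hu
          obtain rfl : nextDart q z = w := by simpa using hw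
          exact ht
        have heven : ∀ u ∈ darts (l ++ [x]) ++ [nextDart q z], u.Even := by
          intro u hu
          rcases List.mem_append.1 hu with hu | hu
          · exact ih.even u hu
          · obtain rfl : u = nextDart q z := by simpa using hu
            exact ht.even hqe
        have hinf : ∀ u u', [u, u'] <:+: darts (l ++ [x]) ++ [nextDart q z] → Turn u u' := by
          intro u u' hu
          simpa using hturn.infix hu
        intro u u' w w' hu hw hd hd' ha
        obtain ⟨r₁, h1, j1⟩ := key u u' hu hd (hinf _ _ hu) (heven u (hu.subset (by simp)))
        obtain ⟨r₂, h2, j2⟩ := key w w' hw hd' (hinf _ _ hw) (heven w (hw.subset (by simp)))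
        obtain rfl : r₁ = r₂ := center_injective (h1.symm.trans (ha.trans h2))
        by_contra hc
        have hh : ∀ d : ℤ, Joins (l ++ [x] ++ [z]) (side4 r₁ (sideIdx (d + 2))) (side4 r₁ (sideIdx d)) →
            (d % 2 = 0 → Joins (l ++ [x] ++ [z]) (west r₁) (east r₁)) ∧
            (d % 2 = 1 → Joins (l ++ [x] ++ [z]) (south r₁) (north r₁)) := by
          intro d hj
          have h : d % 4 = 0 ∨ d % 4 = 1 ∨ d % 4 = 2 ∨ d % 4 = 3 := by omega
          rcases h with h | h | h | h
          · rw [sideIdx_eq_iff.1.2 h, sideIdx_eq_iff.2.2.1.2 (by omega)] at hj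
            exact ⟨fun _ => hj, by omega⟩
          · rw [sideIdx_eq_iff.2.1.2 h, sideIdx_eq_iff.2.2.2.2 (by omega)] at hj
            exact ⟨by omega, fun _ => hj⟩
          · rw [sideIdx_eq_iff.2.2.1.2 h, sideIdx_eq_iff.1.2 (by omega)] at hj
            exact ⟨fun _ => hj.symm, by omega⟩
          · rw [sideIdx_eq_iff.2.2.2.2 h, sideIdx_eq_iff.2.1.2 (by omega)] at hj
            exact ⟨by omega, fun _ => hj.symm⟩
        have hu2 := hh u.d j1
        have hw2 := hh w.d j2
        rcases (by omega : u.d % 2 = 0 ∧ w.d % 2 = 1 ∨ u.d % 2 = 1 ∧ w.d % 2 = 0) with ⟨a, b⟩ | ⟨a, b⟩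
        · exact hγ.noncrossing r₁ ⟨hu2.1 a, hw2.2 b⟩
        · exact hγ.noncrossing r₁ ⟨hw2.1 b, hu2.2 a⟩

/-! ### The local identities of the observable -/

/-- The phase `exp (3iω/8)` of a walk that ends with the heading `d`, where `ω` is the total angle by
which it has turned in the plane: `dπ/2` on a vertical edge, and `(d - 1)π/2 + θ` on a horizontal side of a
rhombus of upper-left angle `θ`. -/
def phase (θ : ℝ) (d : ℤ) : ℂ :=
  if d % 2 = 0 then (root16 ^ 3) ^ (d / 2) else (root16 ^ 3) ^ (d / 2) * unitPhase θ

/-- The weight of the arc of a walk that enters a rhombus with the heading `d` and makes the turn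
`t`. -/
def arcWt (θ : ℝ) (d t : ℤ) : ℝ :=
  if t = 0 then v θ else if d % 2 = 0 then (if t = 1 then u₁ θ else u₂ θ)
  else if t = 1 then u₂ θ else u₁ θ

/-- The weight of a pair of arcs, one of which enters the rhombus with the heading `d` and makes the
turn `t`. -/
def pairWt (θ : ℝ) (d t : ℤ) : ℝ :=
  if t = 0 then 0 else if d % 2 = 0 then (if t = 1 then w₁ θ else w₂ θ)
  else if t = 1 then w₂ θ else w₁ θ

/-- The heading with which a loop comes back to the rhombus that it has left after the turn `t₁`, through
the side at `t₂` quarter-turns from the original direction. -/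
def loopHeading (t₁ t₂ : ℤ) : ℤ := t₂ + if t₁ < t₂ then 2 else -2

/-- The last turn of a walk that crosses the same rhombus a second time after such a loop. -/
def loopTurn (t₁ t₂ : ℤ) : ℤ := if t₂ = 0 then t₁ else -t₁

theorem phase_add (θ : ℝ) (n m : ℤ) : phase θ (2 * n + m) = (root16 ^ 3) ^ n * phase θ m := by
  have h1 : (2 * n + m) % 2 = m % 2 := by omega
  have h2 : (2 * n + m) / 2 = n + m / 2 := by omega
  simp only [phase, h1, h2, zpow_add₀ (pow_ne_zero 3 root16_ne)]
  split_ifs <;> ring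

theorem num_O_ne_zero {θ : ℝ} (h : den θ ≠ 0) : RState.num root16 (unitPhase θ) .O ≠ 0 := by
  rw [← den_eq]
  have := unitPhase_ne θ
  have := root16_ne
  have : (den θ : ℂ) ≠ 0 := by exact_mod_cast h
  simp_all

theorem root16_inv : ((root16 ^ 3)⁻¹ = -root16 ^ 5) ∧ (((root16 ^ 3) ^ 2)⁻¹ = -root16 ^ 2) ∧
    ((root16 ^ 3) ^ (2 : ℤ) = root16 ^ 6) := by
  have hk := root16_pow
  have hk0 := root16_ne
  refine ⟨?_, ?_, ?_⟩
  · field_simp; grind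
  · field_simp; grind
  · rw [zpow_ofNat]; ring

/-- A linear relation between the weights follows from the relation between their numerators, which are
polynomials in `root16` and `unitPhase θ`. -/
theorem wt_identity {θ : ℝ} (h : den θ ≠ 0) (p₀ p₁ p₂ p₃ p₄ p₅ : ℂ)
    (hp : ∀ k z, k = root16 → z = unitPhase θ → p₀ * RState.num k z .O + p₁ * RState.num k z .wn +
      p₂ * RState.num k z .ws + p₃ * RState.num k z .we + p₄ * RState.num k z .wnse +
        p₅ * RState.num k z .wsne = 0) :
    p₀ + p₁ * u₁ θ + p₂ * u₂ θ + p₃ * v θ + p₄ * w₁ θ + p₅ * w₂ θ = 0 := by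
  have h1 : (u₁ θ : ℂ) * _ = _ := RState.wt_mul_num θ h .wn
  have h2 : (u₂ θ : ℂ) * _ = _ := RState.wt_mul_num θ h .ws
  have h3 : (v θ : ℂ) * _ = _ := RState.wt_mul_num θ h .we
  have h4 : (w₁ θ : ℂ) * _ = _ := RState.wt_mul_num θ h .wnse
  have h5 : (w₂ θ : ℂ) * _ = _ := RState.wt_mul_num θ h .wsne
  refine (mul_eq_zero.1 ?_).resolve_right (num_O_ne_zero h)
  linear_combination hp _ _ rfl rfl + p₁ * h1 + p₂ * h2 + p₃ * h3 + p₄ * h4 + p₅ * h5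

/-- A walk that enters a rhombus for the first time, with heading `d`, is balanced by its three
continuations. -/
theorem arc_identity {θ : ℝ} (h : den θ ≠ 0) (d : ℤ) :
    phase θ d = arcWt θ d (-1) * phase θ (d + -1) + arcWt θ d 0 * phase θ (d + 0) +
      arcWt θ d 1 * phase θ (d + 1) := by
  have hk := root16_pow
  obtain ⟨n, rfl | rfl⟩ : ∃ n, d = 2 * n ∨ d = 2 * n + 1 := ⟨d / 2, by omega⟩
  · have e0 : phase θ (2 * n) = (root16 ^ 3) ^ n * phase θ 0 := by rw [← phase_add, add_zero]
    have e1 : (2 * n) % 2 = 0 := by omega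
    have := wt_identity h (-1) (unitPhase θ) (-root16 ^ 5 * unitPhase θ) 1 0 0
      (by rintro k z rfl rfl; simp only [RState.num]; grind)
    simp only [e0, phase_add, arcWt, e1]
    norm_num [phase, root16_inv, -inv_pow]
    linear_combination -(root16 ^ 3) ^ n * this
  · have e1 : (2 * n + 1) % 2 = 1 := by omega
    have := wt_identity h (-unitPhase θ) 1 (root16 ^ 3) (unitPhase θ) 0 0
      (by rintro k z rfl rfl; simp only [RState.num]; grind)
    simp only [add_assoc, phase_add, arcWt, e1]
    norm_num [phase, root16_inv, -inv_pow]
    linear_combination -(root16 ^ 3) ^ n * this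

/-- A walk that comes back to a rhombus for the first time, together with its continuation through the
fourth side, is balanced by the walk that follows the loop in the opposite direction and its
continuation. -/
theorem loop_identity {θ : ℝ} (h : den θ ≠ 0) (d : ℤ) {t₁ t₂ : ℤ} (h₁ : t₁ = -1 ∨ t₁ = 0 ∨ t₁ = 1)
    (h₂ : t₂ = -1 ∨ t₂ = 0 ∨ t₂ = 1) (hne : t₁ ≠ t₂) :
    (arcWt θ d t₁ * phase θ (d + loopHeading t₁ t₂) -
      pairWt θ d t₁ * phase θ (d + (loopHeading t₁ t₂ + loopTurn t₁ t₂))) +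
    (arcWt θ d t₂ * phase θ (d + loopHeading t₂ t₁) -
      pairWt θ d t₂ * phase θ (d + (loopHeading t₂ t₁ + loopTurn t₂ t₁))) = 0 := by
  have hk := root16_pow
  wlog hlt : t₁ < t₂ generalizing t₁ t₂
  · rw [add_comm]
    exact this h₂ h₁ hne.symm (by omega)
  obtain ⟨n, rfl | rfl⟩ : ∃ n, d = 2 * n ∨ d = 2 * n + 1 := ⟨d / 2, by omega⟩
  · have e1 : (2 * n) % 2 = 0 := by omega
    rcases h₁ with rfl | rfl | rfl <;> rcases h₂ with rfl | rfl | rfl <;> try omega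
    · have := wt_identity h 0 0 (root16 ^ 3) (-root16 ^ 2 * unitPhase θ) 0 (-unitPhase θ)
        (by rintro k z rfl rfl; simp only [RState.num]; grind)
      simp only [phase_add, arcWt, pairWt, e1, loopHeading, loopTurn]
      norm_num [phase, root16_inv, -inv_pow]
      linear_combination (root16 ^ 3) ^ n * this
    · have := wt_identity h 0 (-root16 ^ 2 * unitPhase θ) (root16 ^ 3 * unitPhase θ) 0 (root16 ^ 2)
        (-root16 ^ 6) (by rintro k z rfl rfl; simp only [RState.num]; grind)
      simp only [phase_add, arcWt, pairWt, e1, loopHeading, loopTurn]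
      norm_num [phase, root16_inv, -inv_pow]
      linear_combination (root16 ^ 3) ^ n * this
    · have := wt_identity h 0 (-root16 ^ 5) 0 (root16 ^ 3 * unitPhase θ) (root16 ^ 5 * unitPhase θ) 0
        (by rintro k z rfl rfl; simp only [RState.num]; grind)
      simp only [phase_add, arcWt, pairWt, e1, loopHeading, loopTurn]
      norm_num [phase, root16_inv, -inv_pow]
      linear_combination (root16 ^ 3) ^ n * this
  · have e1 : (2 * n + 1) % 2 = 1 := by omega
    rcases h₁ with rfl | rfl | rfl <;> rcases h₂ with rfl | rfl | rfl <;> try omega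
    · have := wt_identity h 0 (root16 ^ 3 * unitPhase θ) 0 (-root16 ^ 5) (-root16 ^ 3) 0
        (by rintro k z rfl rfl; simp only [RState.num]; grind)
      simp only [add_assoc, phase_add, arcWt, pairWt, e1, loopHeading, loopTurn]
      norm_num [phase, root16_inv, -inv_pow]
      linear_combination (root16 ^ 3) ^ n * this
    · have := wt_identity h 0 (root16 ^ 6) (-root16 ^ 5) 0 (-root16 ^ 6 * unitPhase θ)
        (root16 ^ 2 * unitPhase θ) (by rintro k z rfl rfl; simp only [RState.num]; grind)
      simp only [add_assoc, phase_add, arcWt, pairWt, e1, loopHeading, loopTurn]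
      norm_num [phase, root16_inv, -inv_pow]
      linear_combination (root16 ^ 3) ^ n * this
    · have := wt_identity h 0 0 (-root16 ^ 5 * unitPhase θ) (root16 ^ 6) 0 (-1)
        (by rintro k z rfl rfl; simp only [RState.num]; grind)
      simp only [add_assoc, phase_add, arcWt, pairWt, e1, loopHeading, loopTurn]
      norm_num [phase, root16_inv, -inv_pow]
      linear_combination (root16 ^ 3) ^ n * this

/-! ### Walks that enter a rhombus -/

/-- The self-avoiding walks that start from the left boundary, in row `j`. -/
structure LeftSAW (j : ℤ) (γ : List (Edge T)) : Prop where
  saw : IsSAW γ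
  head : γ.head? = some (.vert 0 j)

/-- The walk passes the side `e` of the rhombus `r` and enters `r` there. -/
def Enters (γ : List (Edge T)) (e : Edge T) (r : Rhombus T) : Prop :=
  ∃ q ∈ darts γ, e.pos = q.pos ∧ q.ahead = center r

/-- The walk passes the side `e` of the rhombus `r` and leaves `r` there. -/
def Leaves (γ : List (Edge T)) (e : Edge T) (r : Rhombus T) : Prop :=
  ∃ q ∈ darts γ, e.pos = q.pos ∧ q.behind = center r

/-- The next step of the walk would be made in the rhombus `r`. -/
def HeadsInto (γ : List (Edge T)) (r : Rhombus T) : Prop :=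
  ∃ q, (darts γ).getLast? = some q ∧ q.ahead = center r

theorem exists_dart {γ : List (Edge T)} {e : Edge T} (he : e ∈ γ) : ∃ q ∈ darts γ, e.pos = q.pos := by
  have : e.pos ∈ (darts γ).map Dart.pos := by
    rw [map_pos_darts]; exact List.mem_map_of_mem he
  obtain ⟨q, hq, h⟩ := List.mem_map.1 this
  exact ⟨q, hq, h.symm⟩

theorem exists_edge {γ : List (Edge T)} {q : Dart} (hq : q ∈ darts γ) : ∃ e ∈ γ, e.pos = q.pos := by
  have : q.pos ∈ γ.map Edge.pos := by
    rw [← map_pos_darts]; exact List.mem_map_of_mem hq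
  obtain ⟨e, he, h⟩ := List.mem_map.1 this
  exact ⟨e, he, h⟩

theorem Enters.mem_sides {γ : List (Edge T)} {e : Edge T} {r : Rhombus T} (h : Enters γ e r) : e ∈ sides r := by
  obtain ⟨q, -, he, hr⟩ := h; exact mem_sides_of_ahead he hr

theorem Leaves.mem_sides {γ : List (Edge T)} {e : Edge T} {r : Rhombus T} (h : Leaves γ e r) : e ∈ sides r := by
  obtain ⟨q, -, he, hr⟩ := h; exact mem_sides_of_behind he hr

theorem getLast?_of_darts {γ : List (Edge T)} {q : Dart} {e : Edge T} (hq : (darts γ).getLast? = some q)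
    (h : e.pos = q.pos) : γ.getLast? = some e := by
  have := congrArg List.getLast? (map_pos_darts γ)
  rw [List.getLast?_map, List.getLast?_map, hq, Option.map_some, ← h] at this
  obtain ⟨e', he', h'⟩ := Option.map_eq_some_iff.1 this.symm
  rw [he', Edge.pos_injective h']

theorem Dart.ahead_ne_behind (q : Dart) : q.ahead ≠ q.behind := by
  intro h
  simp only [Dart.ahead, Dart.behind, Prod.mk.injEq] at h
  rcases chi_cases q.d with ⟨k0, k1, k2, -⟩ | ⟨k0, k1, k2, -⟩ | ⟨k0, k1, k2, -⟩ | ⟨k0, k1, k2, -⟩ <;>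
    rw [k1, k2] at h <;> omega

namespace LeftSAW

variable {j : ℤ} {γ : List (Edge T)} {e f : Edge T} {r : Rhombus T}

theorem dartWalk (h : LeftSAW j γ) : DartWalk (2 * j + 1) (darts γ) := h.saw.dartWalk h.head

theorem of_append {l l' : List (Edge T)} (h : LeftSAW j (l ++ l')) (hl : l ≠ []) : LeftSAW j l := by
  refine ⟨h.saw.of_append hl, ?_⟩
  obtain ⟨a, l, rfl⟩ := List.exists_cons_of_ne_nil hl
  simpa using h.head

theorem enters_or_leaves (h : LeftSAW j γ) (he : e ∈ γ) (hr : e ∈ sides r) : Enters γ e r ∨ Leaves γ e r := by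
  obtain ⟨q, hq, hp⟩ := exists_dart he
  rcases (h.dartWalk.even q hq).ahead_or_behind hr hp with h' | h'
  · exact .inl ⟨q, hq, hp, h'⟩
  · exact .inr ⟨q, hq, hp, h'⟩

theorem not_leaves (h : LeftSAW j γ) (he : Enters γ e r) : ¬ Leaves γ e r := by
  rintro ⟨q', hq', hp', hr'⟩
  obtain ⟨q, hq, hp, hr⟩ := he
  obtain rfl := h.dartWalk.eq_of_pos hq hq' (hp.symm.trans hp')
  exact q.ahead_ne_behind (hr.trans hr'.symm)

theorem next (h : LeftSAW j γ) (he : Enters γ e r) :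
    γ.getLast? = some e ∨ ∃ f, [e, f] <:+: γ ∧ Leaves γ f r := by
  obtain ⟨q, hq, hp, hr⟩ := he
  obtain ⟨p, hlast⟩ := exists_getLast?_darts h.saw.ne_nil
  rcases (h.dartWalk.linked hlast).last_or_next hq with ⟨h1, -⟩ | ⟨q', hqq⟩
  · exact .inl (getLast?_of_darts h1 hp)
  · obtain ⟨e', f, hi, he', hf⟩ := exists_infix_of_darts hqq
    obtain rfl : e' = e := Edge.pos_injective (he'.trans hp.symm)
    exact .inr ⟨f, hi, q', DartWalk.mem_right hqq, hf, (h.dartWalk.turn_of_infix hqq).2.trans hr⟩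

theorem prev (h : LeftSAW j γ) (hf : Leaves γ f r) : ∃ e, [e, f] <:+: γ ∧ Enters γ e r := by
  obtain ⟨q, hq, hp, hr⟩ := hf
  obtain ⟨p, hlast⟩ := exists_getLast?_darts h.saw.ne_nil
  rcases (h.dartWalk.linked hlast).first_or_prev hq with h1 | ⟨q', hqq⟩
  · rw [hr] at h1
    simp only [center, Prod.mk.injEq] at h1
    omega
  · obtain ⟨e, f', hi, he, hf'⟩ := exists_infix_of_darts hqq
    obtain rfl : f' = f := Edge.pos_injective (hf'.trans hp.symm)
    exact ⟨e, hi, q', DartWalk.mem_left hqq, he, (h.dartWalk.turn_of_infix hqq).2.symm.trans hr⟩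

theorem enters_of_infix (h : LeftSAW j γ) (hi : [e, f] <:+: γ) (he : e ∈ sides r) (hf : f ∈ sides r) :
    Enters γ e r ∧ Leaves γ f r := by
  have hef : e ≠ f := (Joins.ne h.saw.nodup (.inl hi))
  obtain ⟨q, q', hqq, hq, hq'⟩ := exists_infix_darts hi
  have hqm := DartWalk.mem_left hqq
  have hqm' := DartWalk.mem_right hqq
  have ht := (h.dartWalk.turn_of_infix hqq).2
  have key : q.ahead = center r := by
    refine ((h.dartWalk.even q hqm).ahead_or_behind he hq.symm).resolve_right fun hb => ?_
    rcases (h.dartWalk.even q' hqm').ahead_or_behind hf hq'.symm with h1 | h1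
    · refine hef (Edge.pos_injective ?_)
      rw [← hq, ← hq']
      have e1 := hb.trans h1.symm
      simp only [Dart.ahead, Dart.behind, Prod.mk.injEq, Dart.pos] at *
      omega
    · exact q.ahead_ne_behind (ht.symm.trans (h1.trans hb.symm))
  exact ⟨⟨q, hqm, hq.symm, key⟩, ⟨q', hqm', hq'.symm, ht.trans key⟩⟩

theorem enters_append {l l' : List (Edge T)} (h : LeftSAW j (l ++ l')) (he : e ∈ l) :
    Enters (l ++ l') e r ↔ Enters l e r := by
  have hsub := (darts_prefix l l').subset
  constructor
  · rintro ⟨q, hq, hp, hr⟩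
    obtain ⟨q', hq', hp'⟩ := exists_dart he
    obtain rfl := h.dartWalk.eq_of_pos hq (hsub hq') (hp.symm.trans hp')
    exact ⟨q, hq', hp, hr⟩
  · rintro ⟨q, hq, hp, hr⟩
    exact ⟨q, hsub hq, hp, hr⟩

theorem headsInto_iff (h : LeftSAW j γ) (he : γ.getLast? = some e) : HeadsInto γ r ↔ Enters γ e r := by
  obtain ⟨p, hlast⟩ := exists_getLast?_darts h.saw.ne_nil
  have hp := pos_last hlast he
  constructor
  · rintro ⟨q, hq, hr⟩
    obtain rfl : p = q := by simpa [hlast] using hq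
    exact ⟨p, List.mem_of_getLast? hq, hp.symm, hr⟩
  · rintro ⟨q, hq, hp', hr⟩
    obtain rfl := h.dartWalk.eq_of_pos hq (List.mem_of_getLast? hlast) (hp'.symm.trans hp.symm)
    exact ⟨q, hlast, hr⟩

end LeftSAW

/-- The heading with which a walk ends. -/
def heading (γ : List (Edge T)) : ℤ := ((darts γ).getLast?.map Dart.d).getD 0

/-- The side of the rhombus `r` in the direction `k`. -/
def sideAt (r : Rhombus T) (k : ℤ) : Edge T := side4 r (sideIdx k)

theorem sideIdx_eq_sideIdx {k l : ℤ} : sideIdx k = sideIdx l ↔ k % 4 = l % 4 := by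
  have h : k % 4 = 0 ∨ k % 4 = 1 ∨ k % 4 = 2 ∨ k % 4 = 3 := by omega
  have h' : l % 4 = 0 ∨ l % 4 = 1 ∨ l % 4 = 2 ∨ l % 4 = 3 := by omega
  rcases h with h | h | h | h <;> rcases h' with h' | h' | h' | h' <;> simp [sideIdx, h, h']

theorem sideAt_eq_iff {r : Rhombus T} {k l : ℤ} : sideAt r k = sideAt r l ↔ k % 4 = l % 4 := by
  rw [sideAt, sideAt, (side4_injective r).eq_iff, sideIdx_eq_sideIdx]

theorem sideAt_mem (r : Rhombus T) (k : ℤ) : sideAt r k ∈ sides r := side4_mem _ _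

theorem exists_sideAt {r : Rhombus T} {e : Edge T} (h : e ∈ sides r) (d : ℤ) :
    ∃ t, (t = -1 ∨ t = 0 ∨ t = 1 ∨ t = 2) ∧ e = sideAt r (d + t) := by
  obtain ⟨k, hk⟩ := mem_sides_iff_pos.1 h
  have hk : e = sideAt r k := Edge.pos_injective (hk.trans (pos_side4 r k).symm)
  have : (k - d) % 4 = 0 ∨ (k - d) % 4 = 1 ∨ (k - d) % 4 = 2 ∨ (k - d) % 4 = 3 := by omega
  rcases this with h | h | h | h
  · exact ⟨0, by simp, hk.trans (sideAt_eq_iff.2 (by omega))⟩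
  · exact ⟨1, by simp, hk.trans (sideAt_eq_iff.2 (by omega))⟩
  · exact ⟨2, by simp, hk.trans (sideAt_eq_iff.2 (by omega))⟩
  · exact ⟨-1, by simp, hk.trans (sideAt_eq_iff.2 (by omega))⟩

theorem HeadsInto.getLast? {γ : List (Edge T)} {r : Rhombus T} (h : HeadsInto γ r) :
    γ.getLast? = some (sideAt r (heading γ + 2)) := by
  obtain ⟨q, hq, hr⟩ := h
  refine getLast?_of_darts hq ?_
  rw [sideAt, pos_side4, heading, hq, ← hr, q.pos_ahead]
  simp [show q.d + 2 - 1 = q.d + 1 by ring]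

theorem HeadsInto.heading_concat {γ : List (Edge T)} {r : Rhombus T} (h : HeadsInto γ r) {t : ℤ}
    (ht : t = -1 ∨ t = 0 ∨ t = 1) : heading (γ ++ [sideAt r (heading γ + t)]) = heading γ + t := by
  obtain ⟨q, hq, hr⟩ := h
  have e1 : heading γ = q.d := by simp [heading, hq]
  have c1 : (sideAt r (q.d + t)).pos = (q.ahead.1 + chi (q.d + 1), q.ahead.2 + chi q.d) ↔
      (q.d + t) % 4 = (q.d + 1) % 4 := by
    rw [hr, sideAt, pos_side4, show chi q.d = chi (q.d + 1 - 1) by ring_nf]; exact pos_eq_iff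
  have c2 : (sideAt r (q.d + t)).pos = (q.ahead.1 + chi (q.d - 1), q.ahead.2 + chi (q.d - 2)) ↔
      (q.d + t) % 4 = (q.d - 1) % 4 := by
    rw [hr, sideAt, pos_side4, show chi (q.d - 2) = chi (q.d - 1 - 1) by ring_nf]; exact pos_eq_iff
  rw [e1, heading, darts_concat hq, List.getLast?_concat]
  simp only [nextDart, c1, c2, Option.map_some, Option.getD_some]
  rcases ht with rfl | rfl | rfl <;> split_ifs <;> omega

/-! ### Loops through a rhombus -/

theorem mem_four {r : Rhombus T} {a b c d x : Edge T} (ha : a ∈ sides r) (hb : b ∈ sides r)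
    (hc : c ∈ sides r) (hd : d ∈ sides r) (hx : x ∈ sides r) (hab : a ≠ b) (hac : a ≠ c) (had : a ≠ d)
    (hbc : b ≠ c) (hbd : b ≠ d) (hcd : c ≠ d) : x = a ∨ x = b ∨ x = c ∨ x = d := by
  have h1 : ({a, b, c, d} : Finset (Edge T)) ⊆ sides r := by
    intro e he
    simp only [Finset.mem_insert, Finset.mem_singleton] at he
    rcases he with rfl | rfl | rfl | rfl <;> assumption
  have h2 : (sides r).card ≤ ({a, b, c, d} : Finset (Edge T)).card := by
    rw [Finset.card_eq_of_equiv_fin (n := 4) (s := {a, b, c, d})]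
    · exact Finset.card_le_four
    · exact Fintype.equivFinOfCardEq (by simp [*])
  rw [← Finset.eq_of_subset_of_card_le h1 h2] at hx
  simpa using hx

theorem mem_of_pair_infix {t β : List (Edge T)} {e y : Edge T} (hn : (t ++ y :: β).Nodup)
    (h : [e, y] <:+: t ++ y :: β) : e ∈ t := by
  simp only [List.nodup_append, List.nodup_cons] at hn
  rcases (pair_infix_append _ _ _ _).1 h with h | h | ⟨h, -⟩
  · exact absurd rfl (hn.2.2 y (h.subset (by simp)) y (by simp))
  · rcases (pair_infix_cons _ _ _ _).1 h with ⟨-, h⟩ | h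
    · exact absurd (List.mem_of_head? h) hn.2.1.1
    · exact absurd (h.subset (by simp)) hn.2.1.1
  · exact List.mem_of_getLast? h

theorem joins_split {t β : List (Edge T)} {y z : Edge T} (hz : β.head? = some z) (e f : Edge T) :
    Joins (t ++ y :: β) e f ↔ Joins (t ++ [y]) e f ∨ (e = y ∧ f = z ∨ e = z ∧ f = y) ∨ Joins β e f := by
  obtain ⟨l, rfl⟩ : ∃ l, β = z :: l := by
    cases β with
    | nil => simp at hz
    | cons a l => exact ⟨l, by simpa using hz⟩
  rw [joins_append_cons, joins_cons_cons]

/-- The walk `t ++ y :: β` enters the rhombus `r` for the first time at `y`, leaves it at once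
at `z`, and comes back to it for the first time at its last mid-edge `x`. -/
structure Loop (j : ℤ) (r : Rhombus T) (t : List (Edge T)) (y : Edge T) (β : List (Edge T))
    (z x : Edge T) : Prop where
  saw : LeftSAW j (t ++ y :: β)
  out : ∀ e ∈ t, e ∉ sides r
  mem_y : y ∈ sides r
  first : β.head? = some z
  last : β.getLast? = some x
  into : HeadsInto (t ++ y :: β) r

/-- The first side of a rhombus that a walk meets is a side where it enters the rhombus. -/
theorem LeftSAW.enters_first {j : ℤ} {r : Rhombus T} {t β : List (Edge T)} {y : Edge T}
    (h : LeftSAW j (t ++ y :: β)) (ht : ∀ e ∈ t, e ∉ sides r) (hy : y ∈ sides r) :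
    Enters (t ++ y :: β) y r := by
  refine (h.enters_or_leaves (by simp) hy).resolve_right fun hl => ?_
  obtain ⟨e, he, hr⟩ := h.prev hl
  exact ht e (mem_of_pair_infix h.saw.nodup he) hr.mem_sides

theorem LeftSAW.not_joins_first {j : ℤ} {r : Rhombus T} {t : List (Edge T)} {y e f : Edge T}
    (h : LeftSAW j (t ++ [y])) (ht : ∀ e ∈ t, e ∉ sides r) (he : e ∈ sides r) (hf : f ∈ sides r) :
    ¬ Joins (t ++ [y]) e f := by
  intro hj
  have h1 : ∀ g ∈ sides r, g ∈ t ++ [y] → g = y := fun g hg hm => by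
    rcases List.mem_append.1 hm with hm | hm
    · exact absurd hg (ht g hm)
    · simpa using hm
  exact hj.ne h.saw.nodup ((h1 e he hj.mem_left).trans (h1 f hf hj.mem_right).symm)

theorem LeftSAW.prefix_first {j : ℤ} {t β : List (Edge T)} {y : Edge T} (h : LeftSAW j (t ++ y :: β)) :
    LeftSAW j (t ++ [y]) := by
  have : LeftSAW j ((t ++ [y]) ++ β) := by simpa using h
  exact this.of_append (by simp)

namespace Loop

variable {j : ℤ} {r : Rhombus T} {t β : List (Edge T)} {y z x : Edge T}

theorem infix_yz (h : Loop j r t y β z x) : [y, z] <:+: t ++ y :: β := by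
  have := h.first
  cases β with
  | nil => simp at this
  | cons a l =>
    obtain rfl : a = z := by simpa using this
    exact ⟨t, l, by simp⟩

theorem getLast? (h : Loop j r t y β z x) : (t ++ y :: β).getLast? = some x := by
  have := h.last
  cases β with
  | nil => simp at this
  | cons a l => rw [List.getLast?_append, List.getLast?_cons_cons, this]; rfl

theorem nodup (h : Loop j r t y β z x) : (t ++ y :: β).Nodup := h.saw.saw.nodup

theorem not_mem_β (h : Loop j r t y β z x) : y ∉ β := by
  have := h.nodup
  simp only [List.nodup_append, List.nodup_cons] at this
  exact this.2.1.1

theorem mem_x (h : Loop j r t y β z x) : x ∈ β := List.mem_of_getLast? h.last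
theorem mem_z (h : Loop j r t y β z x) : z ∈ β := List.mem_of_head? h.first

theorem enters_x (h : Loop j r t y β z x) : Enters (t ++ y :: β) x r :=
  (h.saw.headsInto_iff h.getLast?).1 h.into

theorem leaves_z (h : Loop j r t y β z x) : Leaves (t ++ y :: β) z r := by
  rcases h.saw.next (h.saw.enters_first h.out h.mem_y) with h1 | ⟨f, h1, h2⟩
  · rw [h.getLast?] at h1
    exact absurd (by simpa using h1) (fun hc : x = y => h.not_mem_β (hc ▸ h.mem_x))
  · have : f = z := by
      by_contra hne
      rcases infix_of_joins h.nodup (.inl h1) (.inl h.infix_yz) hne with h3 | h3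
      · have h4 := mem_of_pair_infix h.nodup (List.IsInfix.trans ⟨[], [z], rfl⟩ h3)
        exact h.out _ h4 h2.mem_sides
      · have h4 := mem_of_pair_infix h.nodup (List.IsInfix.trans ⟨[], [f], rfl⟩ h3)
        have := h.nodup
        simp only [List.nodup_append] at this
        exact this.2.2 z h4 z (by simp [h.mem_z]) rfl
    exact this ▸ h2

theorem x_ne_y (h : Loop j r t y β z x) : x ≠ y := fun hc => h.not_mem_β (hc ▸ h.mem_x)
theorem z_ne_y (h : Loop j r t y β z x) : z ≠ y := fun hc => h.not_mem_β (hc ▸ h.mem_z)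
theorem x_ne_z (h : Loop j r t y β z x) : x ≠ z := fun hc => h.saw.not_leaves h.enters_x (hc ▸ h.leaves_z)

theorem no_next (h : Loop j r t y β z x) (f : Edge T) : ¬ [x, f] <:+: t ++ y :: β := by
  rintro ⟨l, l', hl⟩
  have hn := h.nodup
  have h1 := h.getLast?
  rw [← hl] at hn h1
  rw [List.append_assoc, List.getLast?_append, List.cons_append, List.cons_append, List.getLast?_cons_cons,
    List.nil_append] at h1
  have h2 : x ∈ f :: l' := by
    rcases hh : (f :: l').getLast? with _ | b
    · simp at hh
    · rw [hh] at h1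
      obtain rfl : b = x := by simpa using h1
      exact List.mem_of_getLast? hh
  simp only [List.append_assoc, List.cons_append, List.nil_append, List.nodup_append, List.nodup_cons] at hn
  exact hn.2.1.1 h2

theorem infix_iff (h : Loop j r t y β z x) {e f : Edge T} (he : e ∈ sides r) (hf : f ∈ sides r)
    (hi : [e, f] <:+: t ++ y :: β) : e = y ∧ f = z := by
  have hz := h.leaves_z.mem_sides
  have hyz : Joins (t ++ y :: β) y z := .inl h.infix_yz
  obtain ⟨h1, h2⟩ := h.saw.enters_of_infix hi he hf
  by_cases hey : e = y
  · subst hey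
    exact ⟨rfl, h.saw.saw.partner_unique he hf hz (.inl hi) hyz⟩
  · by_cases hfz : f = z
    · subst hfz
      exact absurd (h.saw.saw.partner_unique hf he h.mem_y (.inr hi) hyz.symm) hey
    · have hez : e ≠ z := fun hc => h.saw.not_leaves h1 (hc ▸ h.leaves_z)
      have hfy : f ≠ y := fun hc => h.saw.not_leaves (h.saw.enters_first h.out h.mem_y) (hc ▸ h2)
      have hef : e ≠ f := Joins.ne h.nodup (.inl hi)
      rcases mem_four h.mem_y hz he hf h.enters_x.mem_sides h.z_ne_y.symm (Ne.symm hey) hfy.symm hez.symm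
        (Ne.symm hfz) hef with hc | hc | hc | hc
      · exact absurd hc h.x_ne_y
      · exact absurd hc h.x_ne_z
      · exact absurd (hc ▸ hi) (h.no_next f)
      · exact absurd (hc ▸ h2) (h.saw.not_leaves h.enters_x)

theorem joins_iff (h : Loop j r t y β z x) {e f : Edge T} (he : e ∈ sides r) (hf : f ∈ sides r) :
    Joins (t ++ y :: β) e f ↔ e = y ∧ f = z ∨ e = z ∧ f = y := by
  constructor
  · rintro (hi | hi)
    · exact .inl (h.infix_iff he hf hi)
    · exact .inr (h.infix_iff hf he hi).symm
  · rintro (⟨rfl, rfl⟩ | ⟨rfl, rfl⟩)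
    · exact .inl h.infix_yz
    · exact .inr h.infix_yz

theorem not_mem (h : Loop j r t y β z x) {f : Edge T} (hf : f ∈ sides r) (hy : f ≠ y) (hz : f ≠ z)
    (hx : f ≠ x) : f ∉ t ++ y :: β := by
  intro hm
  rcases h.saw.enters_or_leaves hm hf with he | he
  · rcases h.saw.next he with h1 | ⟨g, h1, h2⟩
    · rw [h.getLast?] at h1
      exact hx (by simpa using h1.symm)
    · exact hy (h.infix_iff hf h2.mem_sides h1).1
  · obtain ⟨g, h1, h2⟩ := h.saw.prev he
    exact hz (h.infix_iff h2.mem_sides hf h1).2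

theorem nodup_reverse (h : Loop j r t y β z x) : (t ++ y :: β.reverse).Nodup :=
  (List.Perm.nodup_iff (List.Perm.append_left t ((List.reverse_perm β).cons y))).2 h.nodup

theorem head_reverse (h : Loop j r t y β z x) : β.reverse.head? = some x := by
  rw [List.head?_reverse, h.last]

theorem not_joins_β (h : Loop j r t y β z x) {e f : Edge T} (he : e ∈ sides r) (hf : f ∈ sides r) :
    ¬ Joins β e f := by
  intro hj
  have : Joins (t ++ y :: β) e f := (joins_split h.first e f).2 (.inr (.inr hj))
  rcases (h.joins_iff he hf).1 this with ⟨rfl, -⟩ | ⟨-, rfl⟩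
  · exact h.not_mem_β hj.mem_left
  · exact h.not_mem_β hj.mem_right

theorem joins_reverse_iff (h : Loop j r t y β z x) {e f : Edge T} (he : e ∈ sides r) (hf : f ∈ sides r) :
    Joins (t ++ y :: β.reverse) e f ↔ e = y ∧ f = x ∨ e = x ∧ f = y := by
  rw [joins_split h.head_reverse, joins_reverse]
  have h1 := h.saw.prefix_first.not_joins_first h.out he hf
  have h2 := h.not_joins_β he hf
  tauto

/-- In the other rhombi the reversal of the loop makes no difference. -/
theorem joins_reverse_of_ne (h : Loop j r t y β z x) {r' : Rhombus T} (hr : r' ≠ r) {e f : Edge T}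
    (he : e ∈ sides r') (hf : f ∈ sides r') :
    Joins (t ++ y :: β.reverse) e f ↔ Joins (t ++ y :: β) e f := by
  rw [joins_split h.head_reverse, joins_split h.first, joins_reverse]
  have hz := h.leaves_z.mem_sides
  have hx := h.enters_x.mem_sides
  have h1 : ¬ (e = y ∧ f = x ∨ e = x ∧ f = y) := by
    rintro (⟨rfl, rfl⟩ | ⟨rfl, rfl⟩)
    · exact hr (rhombus_unique h.x_ne_y hf he hx h.mem_y)
    · exact hr (rhombus_unique h.x_ne_y he hf hx h.mem_y)
  have h2 : ¬ (e = y ∧ f = z ∨ e = z ∧ f = y) := by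
    rintro (⟨rfl, rfl⟩ | ⟨rfl, rfl⟩)
    · exact hr (rhombus_unique h.z_ne_y hf he hz h.mem_y)
    · exact hr (rhombus_unique h.z_ne_y he hf hz h.mem_y)
  rw [or_iff_right h1, or_iff_right h2]

theorem isSAW_reverse (h : Loop j r t y β z x) : IsSAW (t ++ y :: β.reverse) where
  ne_nil := by simp
  nodup := h.nodup_reverse
  step := by
    have hn := h.saw.saw.step
    rw [List.isChain_iff_forall_rel_of_append_cons_cons]
    intro e f l₁ l₂ hl
    have hj : Joins (t ++ y :: β.reverse) e f := .inl ⟨l₁, l₂, by simp [hl]⟩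
    have hstep : ∀ e f, Joins (t ++ y :: β) e f → ∃ r : Rhombus T, e ∈ sides r ∧ f ∈ sides r := by
      rw [List.isChain_iff_forall_rel_of_append_cons_cons] at hn
      rintro e f (⟨m, m', hm⟩ | ⟨m, m', hm⟩)
      · exact hn (l₁ := m) (l₂ := m') (by rw [← hm]; simp)
      · obtain ⟨r, h1, h2⟩ := hn (l₁ := m) (l₂ := m') (a := f) (b := e) (by rw [← hm]; simp)
        exact ⟨r, h2, h1⟩
    rw [joins_split h.head_reverse, joins_reverse] at hj
    rcases hj with hj | (⟨rfl, rfl⟩ | ⟨rfl, rfl⟩) | hj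
    · exact hstep e f ((joins_split h.first e f).2 (.inl hj))
    · exact ⟨r, h.mem_y, h.enters_x.mem_sides⟩
    · exact ⟨r, h.enters_x.mem_sides, h.mem_y⟩
    · exact hstep e f ((joins_split h.first e f).2 (.inr (.inr hj)))
  crosses := by
    rintro r' e f g hi ⟨he, hf, hg⟩
    have j1 : Joins (t ++ y :: β.reverse) f e := .inr (List.IsInfix.trans ⟨[], [g], rfl⟩ hi)
    have j2 : Joins (t ++ y :: β.reverse) f g := .inl (List.IsInfix.trans ⟨[e], [], rfl⟩ hi)
    have heg : e ≠ g := by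
      have := h.nodup_reverse.sublist hi.sublist
      simp at this; tauto
    by_cases hr : r' = r
    · subst hr
      have h1 := (h.joins_reverse_iff hf he).1 j1
      have h2 := (h.joins_reverse_iff hf hg).1 j2
      have := h.x_ne_y
      grind
    · exact heg (h.saw.saw.partner_unique hf he hg ((h.joins_reverse_of_ne hr hf he).1 j1)
        ((h.joins_reverse_of_ne hr hf hg).1 j2))
  noncrossing := by
    rintro r' ⟨h1, h2⟩
    by_cases hr : r' = r
    · subst hr
      have h1 := (h.joins_reverse_iff (side4_mem r' 0) (side4_mem r' 2)).1 h1
      have h2 := (h.joins_reverse_iff (side4_mem r' 3) (side4_mem r' 1)).1 h2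
      have n1 := (side4_injective r').ne (show (0 : Fin 4) ≠ 1 by decide)
      have n2 := (side4_injective r').ne (show (0 : Fin 4) ≠ 3 by decide)
      have n3 := (side4_injective r').ne (show (2 : Fin 4) ≠ 1 by decide)
      have n4 := (side4_injective r').ne (show (2 : Fin 4) ≠ 3 by decide)
      grind
    · exact h.saw.saw.noncrossing r' ⟨(h.joins_reverse_of_ne hr (side4_mem r' 0) (side4_mem r' 2)).1 h1,
        (h.joins_reverse_of_ne hr (side4_mem r' 3) (side4_mem r' 1)).1 h2⟩

/-- The walk that follows the loop in the opposite direction. -/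
theorem reverse (h : Loop j r t y β z x) : Loop j r t y β.reverse x z := by
  have hs : LeftSAW j (t ++ y :: β.reverse) := by
    refine ⟨h.isSAW_reverse, ?_⟩
    have := h.saw.head
    cases t <;> simpa using this
  have hlast : β.reverse.getLast? = some z := by rw [List.getLast?_reverse, h.first]
  have hl : (t ++ y :: β.reverse).getLast? = some z := by
    have h2 := hlast
    cases hb : β.reverse with
    | nil => simp [hb] at h2
    | cons a l => rw [hb] at h2; rw [List.getLast?_append, List.getLast?_cons_cons, h2]; rfl
  refine ⟨hs, h.out, h.mem_y, h.head_reverse, hlast, (hs.headsInto_iff hl).2 ?_⟩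
  refine (hs.enters_or_leaves (List.mem_of_getLast? hl) h.leaves_z.mem_sides).resolve_right fun hc => ?_
  obtain ⟨e, h1, h2⟩ := hs.prev hc
  rcases (h.joins_reverse_iff h2.mem_sides h.leaves_z.mem_sides).1 (.inl h1) with ⟨-, h3⟩ | ⟨-, h3⟩
  · exact h.x_ne_z h3.symm
  · exact h.z_ne_y h3

theorem stepsIn_reverse (h : Loop j r t y β z x) {S : Finset ℤ} (hS : StepsIn S (t ++ y :: β)) :
    StepsIn S (t ++ y :: β.reverse) := by
  have hz := h.leaves_z.mem_sides
  obtain ⟨r₀, hr₀, h1, h2⟩ := hS y z (.inl h.infix_yz)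
  obtain rfl : r₀ = r := rhombus_unique h.z_ne_y.symm h1 h2 h.mem_y hz
  intro e f hj
  rw [joins_split h.head_reverse, joins_reverse] at hj
  rcases hj with hj | (⟨rfl, rfl⟩ | ⟨rfl, rfl⟩) | hj
  · exact hS e f ((joins_split h.first e f).2 (.inl hj))
  · exact ⟨_, hr₀, h.mem_y, h.enters_x.mem_sides⟩
  · exact ⟨_, hr₀, h.enters_x.mem_sides, h.mem_y⟩
  · exact hS e f ((joins_split h.first e f).2 (.inr (.inr hj)))

/-- The heading after a loop. -/
theorem heading_eq (h : Loop j r t y β z x) {t₁ t₂ : ℤ} (ht₂ : t₂ = -1 ∨ t₂ = 0 ∨ t₂ = 1) (hne : t₁ ≠ t₂)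
    (ht₁ : t₁ = -1 ∨ t₁ = 0 ∨ t₁ = 1) (hz : z = sideAt r (heading (t ++ [y]) + t₁))
    (hx : x = sideAt r (heading (t ++ [y]) + t₂)) :
    heading (t ++ y :: β) = heading (t ++ [y]) + loopHeading t₁ t₂ := by
  obtain ⟨l, rfl⟩ : ∃ l, β = z :: l := by
    have := h.first
    cases β with
    | nil => simp at this
    | cons a l => exact ⟨l, by simpa using this⟩
  have hs := h.saw.prefix_first
  have hyr : HeadsInto (t ++ [y]) r := by
    rw [hs.headsInto_iff (e := y) (by simp)]
    have h1 := h.saw.enters_first h.out h.mem_y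
    rwa [show t ++ y :: z :: l = (t ++ [y]) ++ (z :: l) by simp, LeftSAW.enters_append (by simpa using h.saw) (by simp)] at h1
  have hh := hyr.heading_concat ht₁
  rw [← hz] at hh
  obtain ⟨q, hq, hqr⟩ := hyr
  obtain ⟨α, hα⟩ : ∃ α, darts (t ++ [y]) = α ++ [q] := by
    rcases List.eq_nil_or_concat' (darts (t ++ [y])) with h0 | ⟨α, b, hb⟩
    · simp [h0] at hq
    · refine ⟨α, ?_⟩
      rw [hb] at hq ⊢
      obtain rfl : b = q := by simpa using hq
      rfl
  obtain ⟨δ, hδ⟩ := darts_prefix (t ++ [y] ++ [z]) l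
  rw [darts_concat hq, hα] at hδ
  have e0 : t ++ [y] ++ [z] ++ l = t ++ y :: z :: l := by simp
  rw [e0] at hδ
  have hδ : darts (t ++ y :: z :: l) = α ++ q :: nextDart q z :: δ := by rw [← hδ]; simp
  have hd : heading (t ++ [y]) = q.d := by simp [heading, hq]
  have hd1 : (nextDart q z).d = q.d + t₁ := by
    rw [← hd, ← hh, heading, darts_concat hq]; simp
  obtain ⟨p, hp, hpr⟩ := h.into
  have hω := h.saw.dartWalk
  rw [hδ] at hω hp
  have hpx := pos_last (γ := t ++ y :: z :: l) (q := p) (by rw [hδ]; exact hp) h.getLast?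
  have := hω.heading_loop (x := p) (t₁ := t₁) (t₂ := t₂) ?_ (hpr.trans hqr.symm) ?_ hd1 ?_ ht₂ hne
  · have e : heading (t ++ y :: z :: l) = p.d := by rw [heading, hδ, hp]; rfl
    rw [e, hd, this, loopHeading]; ring
  · rw [List.getLast?_append, List.getLast?_cons_cons] at hp
    rcases hb : (nextDart q z :: δ).getLast? with _ | b
    · simp at hb
    · rw [hb] at hp; exact hp
  · intro u hu hur
    -- the darts before `y` are not on sides of `r`
    have hmap := map_pos_darts (t ++ [y])
    rw [hα] at hmap
    simp only [List.map_append, List.map_cons, List.map_nil] at hmap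
    have hmap := (List.append_inj' hmap rfl).1
    have : u.pos ∈ t.map Edge.pos := by rw [← hmap]; exact List.mem_map_of_mem hu
    obtain ⟨e, he, hep⟩ := List.mem_map.1 this
    exact h.out e he (mem_sides_of_ahead hep (hur.trans hqr))
  · rw [hpx, hx, sideAt, pos_side4, hqr, hd]

end Loop

/-! ### The weights of the continuations of a walk -/

open Classical in
/-- The weight that a walk gets from all the rhombi except `r`. -/
def restWeight (θ : Fin T → ℝ) (r : Rhombus T) (γ : List (Edge T)) : ℝ :=
  ∏ᶠ r' : Rhombus T, if r' = r then 1 else localWeight (θ r'.1) γ r'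

theorem weight_eq_mul_restWeight (θ : Fin T → ℝ) (r : Rhombus T) (γ : List (Edge T)) :
    weight θ γ = localWeight (θ r.1) γ r * restWeight θ r γ := by
  classical
  have hf := finite_mulSupport θ γ
  have e : ∀ r' : Rhombus T, localWeight (θ r'.1) γ r' =
      (if r' = r then localWeight (θ r'.1) γ r' else 1) *
        (if r' = r then 1 else localWeight (θ r'.1) γ r') := fun r' => by split_ifs <;> simp
  rw [weight, finprod_congr e, finprod_mul_distrib]
  · congr 1
    rw [finprod_eq_single _ r fun r' hr => if_neg hr, if_pos rfl]
  · refine hf.subset fun r' hr h => hr ?_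
    simp only at h
    simp [h]
  · refine hf.subset fun r' hr h => hr ?_
    simp only at h
    simp [h]

theorem localWeight_congr {θ : ℝ} {γ γ' : List (Edge T)} {r : Rhombus T}
    (h : ∀ e ∈ sides r, ∀ f ∈ sides r, Joins γ e f ↔ Joins γ' e f) :
    localWeight θ γ r = localWeight θ γ' r := by
  have h' : ∀ i k : Fin 4, Joins γ (side4 r i) (side4 r k) ↔ Joins γ' (side4 r i) (side4 r k) :=
    fun i k => h _ (side4_mem r i) _ (side4_mem r k)
  have h1 : Joins γ (west r) (north r) ↔ Joins γ' (west r) (north r) := h' 0 1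
  have h2 : Joins γ (south r) (east r) ↔ Joins γ' (south r) (east r) := h' 3 2
  have h3 : Joins γ (west r) (south r) ↔ Joins γ' (west r) (south r) := h' 0 3
  have h4 : Joins γ (north r) (east r) ↔ Joins γ' (north r) (east r) := h' 1 2
  have h5 : Joins γ (west r) (east r) ↔ Joins γ' (west r) (east r) := h' 0 2
  have h6 : Joins γ (south r) (north r) ↔ Joins γ' (south r) (north r) := h' 3 1
  rw [localWeight, localWeight, propext h1, propext h2, propext h3, propext h4, propext h5, propext h6]

theorem restWeight_congr {θ : Fin T → ℝ} {γ γ' : List (Edge T)} {r : Rhombus T}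
    (h : ∀ r' ≠ r, ∀ e ∈ sides r', ∀ f ∈ sides r', Joins γ e f ↔ Joins γ' e f) :
    restWeight θ r γ = restWeight θ r γ' := by
  classical
  refine finprod_congr fun r' => ?_
  split_ifs with hr
  · rfl
  · exact localWeight_congr (h r' hr)

theorem joins_concat {γ : List (Edge T)} {x : Edge T} (hx : γ.getLast? = some x) (z e f : Edge T) :
    Joins (γ ++ [z]) e f ↔ Joins γ e f ∨ (e = x ∧ f = z ∨ e = z ∧ f = x) := by
  obtain ⟨l, rfl⟩ : ∃ l, γ = l ++ [x] := by
    rcases List.eq_nil_or_concat' γ with rfl | ⟨l, b, rfl⟩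
    · simp at hx
    · obtain rfl : b = x := by simpa using hx
      exact ⟨l, rfl⟩
  rw [List.append_assoc, List.singleton_append, joins_append_cons, joins_cons_cons]
  simp

theorem restWeight_concat {θ : Fin T → ℝ} {γ : List (Edge T)} {x z : Edge T} {r : Rhombus T}
    (hx : γ.getLast? = some x) (hxr : x ∈ sides r) (hzr : z ∈ sides r) (hne : x ≠ z) :
    restWeight θ r (γ ++ [z]) = restWeight θ r γ := by
  refine restWeight_congr fun r' hr e he f hf => ?_
  rw [joins_concat hx, or_iff_left]
  rintro (⟨rfl, rfl⟩ | ⟨rfl, rfl⟩)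
  · exact hr (rhombus_unique hne he hf hxr hzr)
  · exact hr (rhombus_unique hne hf he hxr hzr)

theorem localWeight_none {θ : ℝ} {γ : List (Edge T)} {r : Rhombus T}
    (h : ∀ e ∈ sides r, ∀ f ∈ sides r, ¬ Joins γ e f) : localWeight θ γ r = 1 := by
  have : Meets γ r .O := fun i k =>
    iff_of_false (h _ (side4_mem r i) _ (side4_mem r k)) (by simp [RState.pairs])
  rw [this.localWeight, RState.wt_O]

theorem sideIdx_values (d : ℤ) : (d % 4 = 0 ∧ sideIdx d = 2 ∧ sideIdx (d + 1) = 1 ∧ sideIdx (d + 2) = 0 ∧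
      sideIdx (d + -1) = 3) ∨
    (d % 4 = 1 ∧ sideIdx d = 1 ∧ sideIdx (d + 1) = 0 ∧ sideIdx (d + 2) = 3 ∧ sideIdx (d + -1) = 2) ∨
    (d % 4 = 2 ∧ sideIdx d = 0 ∧ sideIdx (d + 1) = 3 ∧ sideIdx (d + 2) = 2 ∧ sideIdx (d + -1) = 1) ∨
    (d % 4 = 3 ∧ sideIdx d = 3 ∧ sideIdx (d + 1) = 2 ∧ sideIdx (d + 2) = 1 ∧ sideIdx (d + -1) = 0) := by
  have h : d % 4 = 0 ∨ d % 4 = 1 ∨ d % 4 = 2 ∨ d % 4 = 3 := by omega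
  rcases h with h | h | h | h
  · have h1 : (d + 1) % 4 = 1 := by omega
    have h2 : (d + 2) % 4 = 2 := by omega
    have h3 : (d + -1) % 4 = 3 := by omega
    simp [sideIdx, h, h1, h2, h3]
  · have h1 : (d + 1) % 4 = 2 := by omega
    have h2 : (d + 2) % 4 = 3 := by omega
    have h3 : (d + -1) % 4 = 0 := by omega
    simp [sideIdx, h, h1, h2, h3]
  · have h1 : (d + 1) % 4 = 3 := by omega
    have h2 : (d + 2) % 4 = 0 := by omega
    have h3 : (d + -1) % 4 = 1 := by omega
    simp [sideIdx, h, h1, h2, h3]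
  · have h1 : (d + 1) % 4 = 0 := by omega
    have h2 : (d + 2) % 4 = 1 := by omega
    have h3 : (d + -1) % 4 = 2 := by omega
    simp [sideIdx, h, h1, h2, h3]

theorem localWeight_arc {θ : ℝ} {γ : List (Edge T)} {r : Rhombus T} {d t : ℤ} (ht : t = -1 ∨ t = 0 ∨ t = 1)
    (h : ∀ e ∈ sides r, ∀ f ∈ sides r, Joins γ e f ↔
      e = sideAt r (d + 2) ∧ f = sideAt r (d + t) ∨ e = sideAt r (d + t) ∧ f = sideAt r (d + 2)) :
    localWeight θ γ r = arcWt θ d t := by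
  have h' : ∀ i k : Fin 4, Joins γ (side4 r i) (side4 r k) ↔
      i = sideIdx (d + 2) ∧ k = sideIdx (d + t) ∨ i = sideIdx (d + t) ∧ k = sideIdx (d + 2) := fun i k => by
    rw [h _ (side4_mem r i) _ (side4_mem r k)]
    simp only [sideAt, (side4_injective r).eq_iff]
  have h1 : Joins γ (west r) (north r) ↔ _ := h' 0 1
  have h2 : Joins γ (south r) (east r) ↔ _ := h' 3 2
  have h3 : Joins γ (west r) (south r) ↔ _ := h' 0 3
  have h4 : Joins γ (north r) (east r) ↔ _ := h' 1 2
  have h5 : Joins γ (west r) (east r) ↔ _ := h' 0 2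
  have h6 : Joins γ (south r) (north r) ↔ _ := h' 3 1
  rw [localWeight]
  simp only [h1, h2, h3, h4, h5, h6]
  rcases sideIdx_values d with ⟨k0, k1, k2, k3, k4⟩ | ⟨k0, k1, k2, k3, k4⟩ | ⟨k0, k1, k2, k3, k4⟩ |
    ⟨k0, k1, k2, k3, k4⟩ <;> rcases ht with rfl | rfl | rfl <;>
    simp [arcWt, k1, k2, k3, k4, show d % 2 = d % 4 % 2 by omega, k0]

theorem localWeight_pair {θ : ℝ} {γ : List (Edge T)} {r : Rhombus T} {d t t' t'' : ℤ} (ht : t = -1 ∨ t = 1)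
    (ht' : t' = 0 ∧ t'' = -t ∨ t' = -t ∧ t'' = 0)
    (h : ∀ e ∈ sides r, ∀ f ∈ sides r, Joins γ e f ↔
      (e = sideAt r (d + 2) ∧ f = sideAt r (d + t) ∨ e = sideAt r (d + t) ∧ f = sideAt r (d + 2)) ∨
      (e = sideAt r (d + t') ∧ f = sideAt r (d + t'') ∨ e = sideAt r (d + t'') ∧ f = sideAt r (d + t'))) :
    localWeight θ γ r = pairWt θ d t ∧ ¬ (Joins γ (west r) (east r) ∧ Joins γ (south r) (north r)) := by
  have h' : ∀ i k : Fin 4, Joins γ (side4 r i) (side4 r k) ↔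
      (i = sideIdx (d + 2) ∧ k = sideIdx (d + t) ∨ i = sideIdx (d + t) ∧ k = sideIdx (d + 2)) ∨
      (i = sideIdx (d + t') ∧ k = sideIdx (d + t'') ∨ i = sideIdx (d + t'') ∧ k = sideIdx (d + t')) :=
    fun i k => by
      rw [h _ (side4_mem r i) _ (side4_mem r k)]
      simp only [sideAt, (side4_injective r).eq_iff]
  have h1 : Joins γ (west r) (north r) ↔ _ := h' 0 1
  have h2 : Joins γ (south r) (east r) ↔ _ := h' 3 2
  have h3 : Joins γ (west r) (south r) ↔ _ := h' 0 3
  have h4 : Joins γ (north r) (east r) ↔ _ := h' 1 2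
  have h5 : Joins γ (west r) (east r) ↔ _ := h' 0 2
  have h6 : Joins γ (south r) (north r) ↔ _ := h' 3 1
  rw [localWeight]
  simp only [h1, h2, h3, h4, h5, h6]
  rcases sideIdx_values d with ⟨k0, k1, k2, k3, k4⟩ | ⟨k0, k1, k2, k3, k4⟩ | ⟨k0, k1, k2, k3, k4⟩ |
    ⟨k0, k1, k2, k3, k4⟩ <;> rcases ht with rfl | rfl <;> rcases ht' with ⟨rfl, rfl⟩ | ⟨rfl, rfl⟩ <;>
    simp [pairWt, k1, k2, k3, k4, show d % 2 = d % 4 % 2 by omega, k0]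

theorem crossing_of_straight {γ : List (Edge T)} {r : Rhombus T} {d t : ℤ} (ht : t = -1 ∨ t = 1)
    (h1 : Joins γ (sideAt r (d + 2)) (sideAt r (d + 0))) (h2 : Joins γ (sideAt r (d + t)) (sideAt r (d + -t))) :
    Joins γ (west r) (east r) ∧ Joins γ (south r) (north r) := by
  have h2 : Joins γ (sideAt r (d + 1)) (sideAt r (d + -1)) := by
    rcases ht with rfl | rfl
    · exact h2.symm
    · exact h2
  simp only [sideAt, add_zero] at h1 h2
  rcases sideIdx_values d with ⟨k0, k1, k2, k3, k4⟩ | ⟨k0, k1, k2, k3, k4⟩ | ⟨k0, k1, k2, k3, k4⟩ |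
    ⟨k0, k1, k2, k3, k4⟩ <;> rw [k1, k3] at h1 <;> rw [k2, k4] at h2
  · exact ⟨h1, h2.symm⟩
  · exact ⟨h2, h1⟩
  · exact ⟨h1.symm, h2⟩
  · exact ⟨h2.symm, h1.symm⟩

/-- A walk can be continued through the rhombus that it heads into, if it does not meet or cross
itself. -/
theorem LeftSAW.concat {j : ℤ} {γ : List (Edge T)} {r : Rhombus T} {z : Edge T} (h : LeftSAW j γ)
    (hr : HeadsInto γ r) (hz : z ∈ sides r) (hzγ : z ∉ γ)
    (hc : ¬ (Joins (γ ++ [z]) (west r) (east r) ∧ Joins (γ ++ [z]) (south r) (north r))) :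
    LeftSAW j (γ ++ [z]) := by
  obtain ⟨l, x, rfl⟩ := (List.eq_nil_or_concat' γ).resolve_left h.saw.ne_nil
  have hx := (h.headsInto_iff (r := r) (e := x) (by simp)).1 hr
  have hxz : x ≠ z := fun hc => hzγ (by simp [hc])
  refine ⟨⟨by simp, ?_, ?_, ?_, ?_⟩, ?_⟩
  · rw [List.nodup_append]
    exact ⟨h.saw.nodup, by simp, fun a ha b hb => by
      obtain rfl : b = z := by simpa using hb
      exact fun hab => hzγ (hab ▸ ha)⟩
  · rw [List.isChain_append]
    refine ⟨h.saw.step, by simp, fun e he f hf => ?_⟩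
    obtain rfl : x = e := by simpa using he
    obtain rfl : z = f := by simpa using hf
    exact ⟨r, hx.mem_sides, hz⟩
  · rintro r' e f g ⟨m, m', hm⟩ ⟨he, hf, hg⟩
    rcases List.eq_nil_or_concat' m' with rfl | ⟨m', b, rfl⟩
    · -- the last step, from `f = x` to `g = z`
      have e1 : (m ++ [e]) ++ [f] ++ [g] = l ++ [x] ++ [z] := by simpa using hm
      obtain ⟨e2, e3⟩ := List.append_inj' e1 rfl
      obtain rfl : g = z := by simpa using e3
      obtain ⟨e4, e5⟩ := List.append_inj' e2 rfl
      obtain rfl : f = x := by simpa using e5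
      obtain rfl := rhombus_unique hxz hf hg hx.mem_sides hz
      exact h.not_leaves hx (h.enters_of_infix (e := e) ⟨m, [], by rw [← e4]; simp⟩ he hf).2
    · have e1 : (m ++ [e, f, g] ++ m') ++ [b] = l ++ [x] ++ [z] := by simpa using hm
      exact h.saw.crosses r' e f g ⟨m, m', (List.append_inj' e1 rfl).1⟩ ⟨he, hf, hg⟩
  · intro r' hr'
    by_cases hrr : r' = r
    · exact hc (hrr ▸ hr')
    · have hj : ∀ e ∈ sides r', ∀ f ∈ sides r', Joins (l ++ [x] ++ [z]) e f → Joins (l ++ [x]) e f := by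
        intro e he f hf hj
        refine ((joins_concat (x := x) (by simp) z e f).1 hj).resolve_right ?_
        rintro (⟨rfl, rfl⟩ | ⟨rfl, rfl⟩)
        · exact hrr (rhombus_unique hxz he hf hx.mem_sides hz)
        · exact hrr (rhombus_unique hxz hf he hx.mem_sides hz)
      exact h.saw.noncrossing r' ⟨hj _ (side4_mem r' 0) _ (side4_mem r' 2) hr'.1,
        hj _ (side4_mem r' 3) _ (side4_mem r' 1) hr'.2⟩
  · rw [List.head?_append, h.head]; rfl

/-! ### Conservation of the observable -/

/-- The angle of the column of a horizontal edge. -/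
def Edge.angle (θ : Fin T → ℝ) : Edge T → ℝ
  | .vert _ _ => 0
  | .horiz k _ => θ k

/-- The contribution of a walk to the observable: its weight, times the phase of its winding. -/
def obs (θ : Fin T → ℝ) (γ : List (Edge T)) : ℂ :=
  match γ.getLast? with
  | none => 0
  | some e => weight θ γ * phase (e.angle θ) (heading γ)

open Classical in
/-- The contribution of the continuations of a walk by one step through the rhombus `r`. -/
def contSum (θ : Fin T → ℝ) (r : Rhombus T) (γ : List (Edge T)) : ℂ :=
  ∑ z ∈ sides r, if IsSAW (γ ++ [z]) then obs θ (γ ++ [z]) else 0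

theorem sum_sides (r : Rhombus T) (d : ℤ) (g : Edge T → ℂ) :
    ∑ z ∈ sides r, g z = g (sideAt r (d + 2)) + g (sideAt r (d + -1)) + g (sideAt r (d + 0)) +
      g (sideAt r (d + 1)) := by
  have h : sides r = {sideAt r (d + 2), sideAt r (d + -1), sideAt r (d + 0), sideAt r (d + 1)} := by
    ext e
    constructor
    · intro he
      obtain ⟨t, ht, rfl⟩ := exists_sideAt he d
      rcases ht with rfl | rfl | rfl | rfl <;> simp
    · intro he
      simp only [Finset.mem_insert, Finset.mem_singleton] at he
      rcases he with rfl | rfl | rfl | rfl <;> exact sideAt_mem _ _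
  rw [h, Finset.sum_insert, Finset.sum_insert, Finset.sum_insert, Finset.sum_singleton]
  · ring
  all_goals
    simp only [Finset.mem_insert, Finset.mem_singleton, sideAt_eq_iff]
    omega

theorem phase_angle (θ : Fin T → ℝ) (r : Rhombus T) {k d : ℤ} (h : k % 2 = d % 2) :
    phase ((sideAt r k).angle θ) d = phase (θ r.1) d := by
  have hk : k % 4 = 0 ∨ k % 4 = 1 ∨ k % 4 = 2 ∨ k % 4 = 3 := by omega
  rcases hk with hk | hk | hk | hk
  · have : d % 2 = 0 := by omega
    simp [phase, this]
  · simp [sideAt, sideIdx, hk, side4, north, Edge.angle]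
  · have : d % 2 = 0 := by omega
    simp [phase, this]
  · simp [sideAt, sideIdx, hk, side4, south, Edge.angle]

theorem obs_eq {θ : Fin T → ℝ} {γ : List (Edge T)} {r : Rhombus T} {k : ℤ}
    (h : γ.getLast? = some (sideAt r k)) (hk : k % 2 = heading γ % 2) :
    obs θ γ = weight θ γ * phase (θ r.1) (heading γ) := by
  rw [obs, h]
  simp only [phase_angle θ r hk]

variable {j : ℤ} {r : Rhombus T}

/-- The walks that enter a rhombus for the first time are balanced by their continuations. -/
theorem obs_first {θ : Fin T → ℝ} (hd : den (θ r.1) ≠ 0) {t : List (Edge T)} {y : Edge T}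
    (h : LeftSAW j (t ++ [y])) (ht : ∀ e ∈ t, e ∉ sides r) (hr : HeadsInto (t ++ [y]) r) :
    obs θ (t ++ [y]) = contSum θ r (t ++ [y]) := by
  classical
  obtain ⟨d, hd'⟩ : ∃ d, d = heading (t ++ [y]) := ⟨_, rfl⟩
  have hy : (t ++ [y]).getLast? = some (sideAt r (d + 2)) := hd' ▸ hr.getLast?
  obtain rfl : y = sideAt r (d + 2) := by simpa using hy
  have hno : ∀ e ∈ sides r, ∀ f ∈ sides r, ¬ Joins (t ++ [sideAt r (d + 2)]) e f :=
    fun e he f hf => h.not_joins_first ht he hf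
  have hout : ∀ s, (s = -1 ∨ s = 0 ∨ s = 1) → sideAt r (d + s) ∉ t ++ [sideAt r (d + 2)] := by
    intro s hs hm
    rcases List.mem_append.1 hm with hm | hm
    · exact ht _ hm (sideAt_mem _ _)
    · rw [List.mem_singleton, sideAt_eq_iff] at hm
      omega
  have hj : ∀ s, ∀ e ∈ sides r, ∀ f ∈ sides r,
      Joins (t ++ [sideAt r (d + 2)] ++ [sideAt r (d + s)]) e f ↔
        e = sideAt r (d + 2) ∧ f = sideAt r (d + s) ∨ e = sideAt r (d + s) ∧ f = sideAt r (d + 2) := by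
    intro s e he f hf
    rw [joins_concat hy, or_iff_right (hno e he f hf)]
  have hS : ∀ s, (s = -1 ∨ s = 0 ∨ s = 1) → IsSAW (t ++ [sideAt r (d + 2)] ++ [sideAt r (d + s)]) := by
    intro s hs
    refine (h.concat hr (sideAt_mem _ _) (hout s hs) ?_).saw
    rintro ⟨h1, h2⟩
    have h1 := (hj s _ (side4_mem r 0) _ (side4_mem r 2)).1 h1
    have h2 := (hj s _ (side4_mem r 3) _ (side4_mem r 1)).1 h2
    simp only [side4, Matrix.cons_val] at h1 h2
    have n1 := (side4_injective r).ne (show (0 : Fin 4) ≠ 1 by decide)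
    have n2 := (side4_injective r).ne (show (0 : Fin 4) ≠ 3 by decide)
    have n3 := (side4_injective r).ne (show (2 : Fin 4) ≠ 1 by decide)
    have n4 := (side4_injective r).ne (show (2 : Fin 4) ≠ 3 by decide)
    simp only [side4, Matrix.cons_val] at n1 n2 n3 n4
    grind
  have hO : ∀ s, (s = -1 ∨ s = 0 ∨ s = 1) → obs θ (t ++ [sideAt r (d + 2)] ++ [sideAt r (d + s)]) =
      arcWt (θ r.1) d s * restWeight θ r (t ++ [sideAt r (d + 2)]) * phase (θ r.1) (d + s) := by
    intro s hs
    have hh := hr.heading_concat hs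
    rw [← hd'] at hh
    rw [obs_eq (r := r) (k := d + s) (by simp) (by rw [hh]), hh, weight_eq_mul_restWeight θ r,
      restWeight_concat hy (sideAt_mem _ _) (sideAt_mem _ _) (by rw [ne_eq, sideAt_eq_iff]; omega),
      localWeight_arc hs (hj s)]
    push_cast
    ring
  have hfirst : obs θ (t ++ [sideAt r (d + 2)]) =
      restWeight θ r (t ++ [sideAt r (d + 2)]) * phase (θ r.1) d := by
    rw [obs_eq hy (by omega), weight_eq_mul_restWeight θ r, localWeight_none hno, one_mul, ← hd']
  have hnot : ¬ IsSAW (t ++ [sideAt r (d + 2)] ++ [sideAt r (d + 2)]) := fun hc => by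
    have := hc.nodup
    simp [List.nodup_append] at this
  rw [contSum, sum_sides r d, if_neg hnot, if_pos (hS _ (by simp)), if_pos (hS _ (by simp)),
    if_pos (hS _ (by simp)), hO _ (by simp), hO _ (by simp), hO _ (by simp), hfirst, arc_identity hd d]
  ring

/-- The contribution of a loop and of its continuation. -/
theorem Loop.obs_sub {θ : Fin T → ℝ} {t β : List (Edge T)} {y z x : Edge T} (h : Loop j r t y β z x)
    {t₁ t₂ : ℤ} (h₁ : t₁ = -1 ∨ t₁ = 0 ∨ t₁ = 1) (h₂ : t₂ = -1 ∨ t₂ = 0 ∨ t₂ = 1) (hne : t₁ ≠ t₂)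
    (hy : y = sideAt r (heading (t ++ [y]) + 2)) (hz : z = sideAt r (heading (t ++ [y]) + t₁))
    (hx : x = sideAt r (heading (t ++ [y]) + t₂)) :
    obs θ (t ++ y :: β) - contSum θ r (t ++ y :: β) = restWeight θ r (t ++ y :: β) *
      (arcWt (θ r.1) (heading (t ++ [y])) t₁ * phase (θ r.1) (heading (t ++ [y]) + loopHeading t₁ t₂) -
        pairWt (θ r.1) (heading (t ++ [y])) t₁ *
          phase (θ r.1) (heading (t ++ [y]) + (loopHeading t₁ t₂ + loopTurn t₁ t₂))) := by
  classical
  have hh := h.heading_eq h₂ hne h₁ hz hx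
  have hlast := h.getLast?
  set d := heading (t ++ [y]) with hd
  have hj : ∀ e ∈ sides r, ∀ f ∈ sides r, Joins (t ++ y :: β) e f ↔
      e = sideAt r (d + 2) ∧ f = sideAt r (d + t₁) ∨ e = sideAt r (d + t₁) ∧ f = sideAt r (d + 2) := by
    intro e he f hf
    rw [h.joins_iff he hf, ← hy, ← hz]
  have hobs : obs θ (t ++ y :: β) = arcWt (θ r.1) d t₁ * restWeight θ r (t ++ y :: β) *
      phase (θ r.1) (d + loopHeading t₁ t₂) := by
    rw [obs_eq (r := r) (k := d + t₂) (by rw [hlast, hx]) (by rw [hh, loopHeading]; split_ifs <;> omega),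
      weight_eq_mul_restWeight θ r, localWeight_arc h₁ hj, hh]
    push_cast
    ring
  -- the fourth side
  obtain ⟨t₃, h₃, h₁₃, h₂₃, hsum⟩ : ∃ t₃ : ℤ, (t₃ = -1 ∨ t₃ = 0 ∨ t₃ = 1) ∧ t₁ ≠ t₃ ∧ t₂ ≠ t₃ ∧
      t₁ + t₂ + t₃ = 0 := ⟨-t₁ - t₂, by omega, by omega, by omega, by ring⟩
  have hf : sideAt r (d + t₃) ∉ t ++ y :: β := by
    refine h.not_mem (sideAt_mem _ _) ?_ ?_ ?_
    · rw [hy, ne_eq, sideAt_eq_iff]; omega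
    · rw [hz, ne_eq, sideAt_eq_iff]; omega
    · rw [hx, ne_eq, sideAt_eq_iff]; omega
  have hnot : ∀ e ∈ t ++ y :: β, ¬ IsSAW (t ++ y :: β ++ [e]) := fun e he hc => by
    have := hc.nodup
    rw [List.nodup_append] at this
    exact this.2.2 e he e (by simp) rfl
  have n2 := hnot (sideAt r (d + 2)) (by rw [← hy]; simp)
  have n1 := hnot (sideAt r (d + t₁)) (by rw [← hz]; simp [h.mem_z])
  have n3 := hnot (sideAt r (d + t₂)) (by rw [← hx]; simp [h.mem_x])
  have hcont : contSum θ r (t ++ y :: β) = if IsSAW (t ++ y :: β ++ [sideAt r (d + t₃)]) then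
      obs θ (t ++ y :: β ++ [sideAt r (d + t₃)]) else 0 := by
    rw [contSum, sum_sides r d, if_neg n2]
    rcases h₁ with rfl | rfl | rfl <;> rcases h₂ with rfl | rfl | rfl <;> rcases h₃ with rfl | rfl | rfl <;>
      first | omega | (rw [if_neg n1, if_neg n3]; ring)
  have hjc : ∀ e ∈ sides r, ∀ f ∈ sides r, Joins (t ++ y :: β ++ [sideAt r (d + t₃)]) e f ↔
      (e = sideAt r (d + 2) ∧ f = sideAt r (d + t₁) ∨ e = sideAt r (d + t₁) ∧ f = sideAt r (d + 2)) ∨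
      (e = sideAt r (d + t₂) ∧ f = sideAt r (d + t₃) ∨ e = sideAt r (d + t₃) ∧ f = sideAt r (d + t₂)) := by
    intro e he f hf
    rw [joins_concat hlast, hj e he f hf, ← hx]
  rw [hcont, hobs]
  by_cases h0 : t₁ = 0
  · -- the walk would cross itself
    subst h0
    rw [if_neg]
    · simp [pairWt]
      ring
    · intro hc
      refine hc.noncrossing r (crossing_of_straight (d := d) (t := t₂) (by omega) ?_ ?_)
      · exact (hjc _ (sideAt_mem _ _) _ (sideAt_mem _ _)).2 (.inl (.inl ⟨rfl, rfl⟩))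
      · obtain rfl : t₃ = -t₂ := by omega
        exact (hjc _ (sideAt_mem _ _) _ (sideAt_mem _ _)).2 (.inr (.inl ⟨rfl, rfl⟩))
  · obtain ⟨hw, hc⟩ := localWeight_pair (θ := θ r.1) (d := d) (t := t₁) (t' := t₂) (t'' := t₃) (by omega)
      (by omega) hjc
    have hsaw := h.saw.concat h.into (sideAt_mem _ _) hf hc
    have hlt : loopTurn t₁ t₂ = -1 ∨ loopTurn t₁ t₂ = 0 ∨ loopTurn t₁ t₂ = 1 := by
      rw [loopTurn]; split_ifs <;> omega
    have hhc := h.into.heading_concat hlt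
    have hside : sideAt r (heading (t ++ y :: β) + loopTurn t₁ t₂) = sideAt r (d + t₃) := by
      rw [sideAt_eq_iff, hh, loopHeading, loopTurn]
      split_ifs <;> omega
    rw [hside, hh] at hhc
    rw [if_pos hsaw.saw, obs_eq (r := r) (k := d + t₃) List.getLast?_concat
      (by rw [hhc, loopHeading, loopTurn]; split_ifs <;> omega), hhc, weight_eq_mul_restWeight θ r,
      restWeight_concat hlast (hx ▸ sideAt_mem _ _) (sideAt_mem _ _)
        (by rw [hx, ne_eq, sideAt_eq_iff]; omega), hw, add_assoc]
    push_cast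
    ring

/-- The two directions of a loop balance each other. -/
theorem Loop.obs_add {θ : Fin T → ℝ} (hd : den (θ r.1) ≠ 0) {t β : List (Edge T)} {y z x : Edge T}
    (h : Loop j r t y β z x) :
    (obs θ (t ++ y :: β) - contSum θ r (t ++ y :: β)) +
      (obs θ (t ++ y :: β.reverse) - contSum θ r (t ++ y :: β.reverse)) = 0 := by
  have hs := h.saw.prefix_first
  have hyr : HeadsInto (t ++ [y]) r := by
    rw [hs.headsInto_iff (e := y) (by simp)]
    have := hs.enters_first (β := []) h.out h.mem_y
    simpa using this
  have hy : y = sideAt r (heading (t ++ [y]) + 2) := by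
    have := hyr.getLast?
    simpa using this
  have key : ∀ e ∈ sides r, e ≠ y → ∃ s, (s = -1 ∨ s = 0 ∨ s = 1) ∧ e = sideAt r (heading (t ++ [y]) + s) := by
    intro e he hne
    obtain ⟨s, hs, rfl⟩ := exists_sideAt he (heading (t ++ [y]))
    refine ⟨s, ?_, rfl⟩
    rcases hs with hs | hs | hs | rfl
    · exact .inl hs
    · exact .inr (.inl hs)
    · exact .inr (.inr hs)
    · exact absurd hy.symm hne
  obtain ⟨t₁, h₁, hz⟩ := key z h.leaves_z.mem_sides h.z_ne_y
  obtain ⟨t₂, h₂, hx⟩ := key x h.enters_x.mem_sides h.x_ne_y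
  have hne : t₁ ≠ t₂ := fun hc => h.x_ne_z (by rw [hz, hx, hc])
  have hrest : restWeight θ r (t ++ y :: β.reverse) = restWeight θ r (t ++ y :: β) :=
    restWeight_congr fun r' hr e he f hf => h.joins_reverse_of_ne hr he hf
  rw [h.obs_sub h₁ h₂ hne hy hz hx, h.reverse.obs_sub h₂ h₁ hne.symm hy hx hz, hrest, ← mul_add,
    loop_identity hd _ h₁ h₂ hne, mul_zero]

/-! ### Summation of the observable over the walks in finitely many rows -/

/-- The self-avoiding walks in the rows in `S` that start from the left boundary, in row `j`. -/
def leftWalks (T : ℕ) (S : Finset ℤ) (j : ℤ) : Set (List (Edge T)) := {γ | LeftSAW j γ ∧ StepsIn S γ}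

variable {S : Finset ℤ} {j : ℤ}

theorem LeftSAW.eq_singleton_or {γ : List (Edge T)} (h : LeftSAW j γ) :
    γ = [.vert 0 j] ∨ ∃ m x z, γ = m ++ [x] ++ [z] := by
  rcases List.eq_nil_or_concat' γ with rfl | ⟨l, z, rfl⟩
  · exact absurd rfl h.saw.ne_nil
  · rcases List.eq_nil_or_concat' l with rfl | ⟨m, x, rfl⟩
    · left
      have := h.head
      simp at this
      simp [this]
    · exact .inr ⟨m, x, z, rfl⟩

theorem leftWalks_finite (T : ℕ) (S : Finset ℤ) (j : ℤ) : (leftWalks T S j).Finite := by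
  refine (((rowsPartFun_eq (fun _ => 0) S (.vert 0 j) (.vert 0 j)).1).union
    ((Finset.univ ×ˢ S : Finset (Rhombus T)).finite_toSet.biUnion fun r _ =>
      (sides r).finite_toSet.biUnion fun b _ =>
        (rowsPartFun_eq (fun _ => 0) S (.vert 0 j) b).1)).subset ?_
  rintro γ ⟨h, hS⟩
  rcases h.eq_singleton_or with rfl | ⟨m, x, z, rfl⟩
  · exact .inl ⟨h.saw, rfl, rfl, hS⟩
  · obtain ⟨r, hr, -, hz⟩ := hS x z (.inl ⟨m, [], by simp⟩)
    right
    simp only [Set.mem_iUnion]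
    exact ⟨r, by simpa using hr, z, hz, h.saw, h.head, by simp, hS⟩

/-- The walk with the part after its first visit to the rhombus `r` reversed. -/
def reverseAfter (r : Rhombus T) : List (Edge T) → List (Edge T)
  | [] => []
  | e :: l => if e ∈ sides r then e :: l.reverse else e :: reverseAfter r l

theorem reverseAfter_append {r : Rhombus T} {t : List (Edge T)} (ht : ∀ e ∈ t, e ∉ sides r) {y : Edge T}
    (hy : y ∈ sides r) (β : List (Edge T)) : reverseAfter r (t ++ y :: β) = t ++ y :: β.reverse := by
  induction t with
  | nil => simp [reverseAfter, hy]
  | cons a t ih =>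
    simp only [List.mem_cons, forall_eq_or_imp] at ht
    simp [reverseAfter, ht.1, ih ht.2]

theorem exists_first_visit {r : Rhombus T} {γ : List (Edge T)} {x : Edge T} (hx : x ∈ γ) (hr : x ∈ sides r) :
    ∃ t y β, γ = t ++ y :: β ∧ (∀ e ∈ t, e ∉ sides r) ∧ y ∈ sides r := by
  induction γ with
  | nil => simp at hx
  | cons a γ ih =>
    by_cases ha : a ∈ sides r
    · exact ⟨[], a, γ, rfl, by simp, ha⟩
    · have hx' : x ∈ γ := (List.mem_cons.1 hx).resolve_left fun hc => ha (hc ▸ hr)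
      obtain ⟨t, y, β, rfl, ht, hy⟩ := ih hx'
      refine ⟨a :: t, y, β, rfl, ?_, hy⟩
      simp only [List.mem_cons, forall_eq_or_imp]
      exact ⟨ha, ht⟩

/-- A walk that heads into a rhombus enters it for the first time, or makes a loop from it. -/
theorem LeftSAW.first_or_loop {γ : List (Edge T)} {r : Rhombus T} (h : LeftSAW j γ) (hr : HeadsInto γ r) :
    ∃ t y β, γ = t ++ y :: β ∧ (∀ e ∈ t, e ∉ sides r) ∧ y ∈ sides r ∧
      (β = [] ∨ ∃ z x, Loop j r t y β z x) := by
  have hl := hr.getLast?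
  obtain ⟨t, y, β, rfl, ht, hy⟩ := exists_first_visit (List.mem_of_getLast? hl) (sideAt_mem _ _)
  refine ⟨t, y, β, rfl, ht, hy, ?_⟩
  rcases β with _ | ⟨z, l⟩
  · exact .inl rfl
  · exact .inr ⟨z, (z :: l).getLast (by simp), h, ht, hy, rfl, List.getLast?_eq_some_getLast _, hr⟩

open Classical in
/-- The observable is conserved in every rhombus. -/
theorem sum_obs_sub_contSum {θ : Fin T → ℝ} {r : Rhombus T} (hd : den (θ r.1) ≠ 0) :
    ∑ γ ∈ (leftWalks_finite T S j).toFinset with HeadsInto γ r, (obs θ γ - contSum θ r γ) = 0 := by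
  refine Finset.sum_involution (fun γ _ => reverseAfter r γ) ?_ ?_ ?_ ?_
  · intro γ hγ
    simp only [Finset.mem_filter, Set.Finite.mem_toFinset] at hγ
    obtain ⟨⟨h, -⟩, hr⟩ := hγ
    obtain ⟨t, y, β, rfl, ht, hy, rfl | ⟨z, x, hL⟩⟩ := h.first_or_loop hr
    · rw [reverseAfter_append ht hy, List.reverse_nil, obs_first hd h ht hr]; ring
    · rw [reverseAfter_append ht hy, hL.obs_add hd]
  · intro γ hγ hne
    simp only [Finset.mem_filter, Set.Finite.mem_toFinset] at hγ
    obtain ⟨⟨h, -⟩, hr⟩ := hγ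
    obtain ⟨t, y, β, rfl, ht, hy, rfl | ⟨z, x, hL⟩⟩ := h.first_or_loop hr
    · exact absurd (by rw [obs_first hd h ht hr, sub_self]) hne
    · rw [reverseAfter_append ht hy]
      intro hc
      have hc : β.reverse = β := by simpa using hc
      have := hL.head_reverse
      rw [hc, hL.first] at this
      exact hL.x_ne_z (by simpa using this.symm)
  · intro γ hγ
    simp only [Finset.mem_filter, Set.Finite.mem_toFinset] at hγ ⊢
    obtain ⟨⟨h, hS⟩, hr⟩ := hγ
    obtain ⟨t, y, β, rfl, ht, hy, rfl | ⟨z, x, hL⟩⟩ := h.first_or_loop hr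
    · rw [reverseAfter_append ht hy]; exact ⟨⟨h, hS⟩, hr⟩
    · rw [reverseAfter_append ht hy]
      exact ⟨⟨hL.reverse.saw, hL.stepsIn_reverse hS⟩, hL.reverse.into⟩
  · intro γ hγ
    simp only [Finset.mem_filter, Set.Finite.mem_toFinset] at hγ
    obtain ⟨⟨h, -⟩, hr⟩ := hγ
    obtain ⟨t, y, β, rfl, ht, hy, -⟩ := h.first_or_loop hr
    rw [reverseAfter_append ht hy, reverseAfter_append ht hy, List.reverse_reverse]

theorem HeadsInto.unique {γ : List (Edge T)} {r r' : Rhombus T} (h : HeadsInto γ r) (h' : HeadsInto γ r') :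
    r = r' := by
  obtain ⟨q, hq, hr⟩ := h
  obtain ⟨q', hq', hr'⟩ := h'
  obtain rfl : q = q' := by simpa [hq] using hq'
  exact center_injective (hr.symm.trans hr')

/-- The last step of a walk is made in the rhombus into which the walk headed before this step. -/
theorem LeftSAW.last_step {m : List (Edge T)} {x z : Edge T} (h : LeftSAW j (m ++ [x] ++ [z]))
    (hS : StepsIn S (m ++ [x] ++ [z])) :
    LeftSAW j (m ++ [x]) ∧ StepsIn S (m ++ [x]) ∧ ∃ r : Rhombus T, r.2 ∈ S ∧ z ∈ sides r ∧
      HeadsInto (m ++ [x]) r := by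
  have h1 : LeftSAW j (m ++ [x]) := h.of_append (by simp)
  have hi : [x, z] <:+: m ++ [x] ++ [z] := ⟨m, [], by simp⟩
  obtain ⟨r, hr, hx, hz⟩ := hS x z (.inl hi)
  refine ⟨h1, fun e f hj => hS e f (joins_append_left _ hj), r, hr, hz, ?_⟩
  exact (h1.headsInto_iff (by simp)).2
    ((LeftSAW.enters_append h (by simp)).1 (h.enters_of_infix hi hx hz).1)

open Classical in
/-- Every walk but the trivial one is the continuation, by one step, of a walk that heads into a
rhombus. -/
theorem sum_contSum (θ : Fin T → ℝ) :
    ∑ r ∈ (Finset.univ ×ˢ S : Finset (Rhombus T)),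
        ∑ γ ∈ (leftWalks_finite T S j).toFinset with HeadsInto γ r, contSum θ r γ =
      ∑ γ ∈ (leftWalks_finite T S j).toFinset.erase [.vert 0 j], obs θ γ := by
  simp only [contSum, ← Finset.sum_filter (p := fun z => IsSAW (_ ++ [z]))]
  simp only [Finset.sum_sigma']
  refine Finset.sum_bij (fun p _ => p.2.1 ++ [p.2.2]) ?_ ?_ ?_ ?_
  · rintro ⟨r, γ, z⟩ hp
    simp only [Finset.mem_sigma, Finset.mem_filter, Finset.mem_product, Finset.mem_univ, true_and,
      Set.Finite.mem_toFinset, Finset.mem_erase] at hp ⊢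
    obtain ⟨hr, ⟨⟨h, hS⟩, hi⟩, hz, hsaw⟩ := hp
    refine ⟨?_, ⟨hsaw, ?_⟩, ?_⟩
    · intro hc
      have := List.append_inj' (show γ ++ [z] = [] ++ [_] from hc) rfl
      exact h.saw.ne_nil this.1
    · rw [List.head?_append, h.head]; rfl
    · intro e f hj
      have hx := hi.getLast?
      rcases (joins_concat hx z e f).1 hj with hj | ⟨rfl, rfl⟩ | ⟨rfl, rfl⟩
      · exact hS e f hj
      · exact ⟨r, hr, sideAt_mem _ _, hz⟩
      · exact ⟨r, hr, hz, sideAt_mem _ _⟩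
  · rintro ⟨r, γ, z⟩ hp ⟨r', γ', z'⟩ hp' he
    simp only [Finset.mem_sigma, Finset.mem_filter] at hp hp'
    obtain ⟨h1, h2⟩ := List.append_inj' he rfl
    simp only at h1
    subst h1
    obtain rfl : z = z' := by simpa using h2
    obtain rfl := hp.2.1.2.unique hp'.2.1.2
    rfl
  · intro γ hγ
    simp only [Finset.mem_erase, Set.Finite.mem_toFinset] at hγ
    obtain ⟨hne, h, hS⟩ := hγ
    rcases h.eq_singleton_or with rfl | ⟨m, x, z, rfl⟩
    · exact absurd rfl hne
    · obtain ⟨h1, h2, r, hr, hz, hi⟩ := h.last_step hS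
      refine ⟨⟨r, m ++ [x], z⟩, ?_, rfl⟩
      simp only [Finset.mem_sigma, Finset.mem_filter, Finset.mem_product, Finset.mem_univ, true_and,
        Set.Finite.mem_toFinset]
      exact ⟨hr, ⟨⟨h1, h2⟩, hi⟩, hz, h.saw⟩
  · intro p _
    rfl

theorem isSAW_singleton (e : Edge T) : IsSAW [e] where
  ne_nil := by simp
  nodup := by simp
  step := by simp
  crosses := by
    rintro r a b c h
    have := h.length_le
    simp at this
  noncrossing := by
    rintro r ⟨h | h, -⟩ <;> simpa using h.length_le

theorem weight_singleton (θ : Fin T → ℝ) (e : Edge T) : weight θ [e] = 1 := by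
  rw [weight, ← finprod_one (α := Rhombus T)]
  exact finprod_congr fun r => localWeight_none fun _ _ _ _ => not_joins_singleton _ _ _

theorem obs_singleton (θ : Fin T → ℝ) (j : ℤ) : obs θ [.vert 0 j] = 1 := by
  simp [obs, weight_singleton, heading, darts, trail, phase]

theorem singleton_mem_leftWalks (S : Finset ℤ) (j : ℤ) : ([.vert 0 j] : List (Edge T)) ∈ leftWalks T S j :=
  ⟨⟨isSAW_singleton _, rfl⟩, fun _ _ h => absurd h (not_joins_singleton _ _ _)⟩

/-- The walks that have just left the rows in `S`, or the strip. -/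
def Exits (S : Finset ℤ) (γ : List (Edge T)) : Prop := ∀ r : Rhombus T, r.2 ∈ S → ¬ HeadsInto γ r

open Classical in
/-- The total flux of the observable through the boundary. -/
theorem sum_obs_exits {θ : Fin T → ℝ} (hd : ∀ k, den (θ k) ≠ 0) :
    ∑ γ ∈ (leftWalks_finite T S j).toFinset with Exits S γ, obs θ γ = 1 := by
  set W := (leftWalks_finite T S j).toFinset with hW
  have h1 : ∑ r ∈ (Finset.univ ×ˢ S : Finset (Rhombus T)), ∑ γ ∈ W with HeadsInto γ r, obs θ γ =
      ∑ γ ∈ W with ¬ Exits S γ, obs θ γ := by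
    rw [← Finset.sum_biUnion]
    · refine Finset.sum_congr ?_ fun _ _ => rfl
      ext γ
      simp only [Finset.mem_biUnion, Finset.mem_product, Finset.mem_univ, true_and, Finset.mem_filter, Exits,
        not_forall, not_not]
      constructor
      · rintro ⟨r, hr, h, hi⟩; exact ⟨h, r, hr, hi⟩
      · rintro ⟨h, r, hr, hi⟩; exact ⟨r, hr, h, hi⟩
    · intro r _ r' _ hne
      refine Finset.disjoint_left.2 fun γ h h' => hne ?_
      exact (Finset.mem_filter.1 h).2.unique (Finset.mem_filter.1 h').2
  have h2 : ∑ r ∈ (Finset.univ ×ˢ S : Finset (Rhombus T)),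
      ∑ γ ∈ W with HeadsInto γ r, (obs θ γ - contSum θ r γ) = 0 :=
    Finset.sum_eq_zero fun r _ => sum_obs_sub_contSum (hd r.1)
  simp only [Finset.sum_sub_distrib] at h2
  rw [h1, sum_contSum, ← hW] at h2
  have h3 := Finset.sum_filter_add_sum_filter_not W (Exits S) (obs θ)
  have h4 := Finset.add_sum_erase W (obs θ) (a := [.vert 0 j])
    ((leftWalks_finite T S j).mem_toFinset.2 (singleton_mem_leftWalks S j))
  rw [obs_singleton] at h4
  linear_combination h3 - h4 - h2

/-! ### The partition functions are bounded -/

variable {S : Finset ℤ} {j : ℤ} {γ : List (Edge T)}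

theorem localWeight_nonneg {θ : ℝ} (hθ : θ ∈ Set.Icc (π / 3) (2 * π / 3)) (hγ : IsSAW γ) (r : Rhombus T) :
    0 ≤ localWeight θ γ r := by
  obtain ⟨s, hs⟩ := hγ.exists_meets r
  rw [hs.localWeight]
  exact s.wt_nonneg hθ

theorem weight_nonneg {θ : Fin T → ℝ} (hθ : ∀ k, θ k ∈ Set.Icc (π / 3) (2 * π / 3)) (hγ : IsSAW γ) :
    0 ≤ weight θ γ :=
  finprod_nonneg fun r => localWeight_nonneg (hθ r.1) hγ r

/-- A dart leaves a rhombus, unless it is the first one. -/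
theorem LeftSAW.behind_eq (h : LeftSAW j γ) (hS : StepsIn S γ) {u : Dart} (hu : u ∈ darts γ) :
    u.behind = (-1, 2 * j + 1) ∨ ∃ r : Rhombus T, r.2 ∈ S ∧ u.behind = center r := by
  obtain ⟨p, hlast⟩ := exists_getLast?_darts h.saw.ne_nil
  rcases (h.dartWalk.linked hlast).first_or_prev hu with h1 | ⟨u', hi⟩
  · exact .inl h1
  · right
    obtain ⟨e, f, hef, he, hf⟩ := exists_infix_of_darts hi
    obtain ⟨r, hr, h1, h2⟩ := hS e f (.inl hef)
    obtain ⟨-, q, hq, hp, hb⟩ := h.enters_of_infix hef h1 h2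
    obtain rfl := h.dartWalk.eq_of_pos hq (DartWalk.mem_right hi) (hp.symm.trans hf)
    exact ⟨r, hr, hb⟩

/-- A dart enters a rhombus, unless it is the last one. -/
theorem LeftSAW.ahead_eq (h : LeftSAW j γ) (hS : StepsIn S γ) {u : Dart} (hu : u ∈ darts γ) :
    (darts γ).getLast? = some u ∨ ∃ r : Rhombus T, r.2 ∈ S ∧ u.ahead = center r := by
  obtain ⟨p, hlast⟩ := exists_getLast?_darts h.saw.ne_nil
  rcases (h.dartWalk.linked hlast).last_or_next hu with h1 | ⟨u', hi⟩
  · exact .inl h1.1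
  · right
    obtain ⟨e, f, hef, he, hf⟩ := exists_infix_of_darts hi
    obtain ⟨r, hr, h1, h2⟩ := hS e f (.inl hef)
    obtain ⟨⟨q, hq, hp, hb⟩, -⟩ := h.enters_of_infix hef h1 h2
    obtain rfl := h.dartWalk.eq_of_pos hq (DartWalk.mem_left hi) (hp.symm.trans he)
    exact ⟨r, hr, hb⟩

/-- The headings with which a walk can leave the rows `-M, …, M - 1` of the strip: `0` to the right,
`2` or `-2` to the left, `1` at the top, `-1` at the bottom. (If there are no columns, the trivial walk
leaves with its heading `0`.) -/
theorem LeftSAW.exits {M : ℕ} (h : LeftSAW j γ) (hj : j ∈ box M) (hS : StepsIn (box M) γ)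
    (hx : Exits (box M) γ) : heading γ = 0 ∨ heading γ = 2 ∨ heading γ = -2 ∨ heading γ = 1 ∨ heading γ = -1 := by
  obtain ⟨q, hq⟩ := exists_getLast?_darts h.saw.ne_nil
  have hω := h.dartWalk
  have hqm := List.mem_of_getLast? hq
  have hh : heading γ = q.d := by simp [heading, hq]
  rw [hh]
  have hev := hω.even
  simp only [box, Finset.mem_Ico] at hj
  rcases h.behind_eq hS hqm with hb | ⟨r, hr, hb⟩
  · -- only the first dart is at the left of the strip
    have h0 : (⟨0, 2 * j + 1, 0⟩ : Dart) ∈ darts γ := List.mem_of_head? hω.head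
    have hn := hω.nonneg q hqm
    have hpos : q.pos = (⟨0, 2 * j + 1, 0⟩ : Dart).pos := by
      simp only [Dart.behind, Prod.mk.injEq] at hb
      simp only [Dart.pos, Prod.mk.injEq]
      rcases chi_cases q.d with ⟨k0, k1, k2, -⟩ | ⟨k0, k1, k2, -⟩ | ⟨k0, k1, k2, -⟩ | ⟨k0, k1, k2, -⟩ <;>
        rw [k1, k2] at hb <;> omega
    rw [hω.eq_of_pos hqm h0 hpos]
    simp
  · have hnot : ∀ r' : Rhombus T, r'.2 ∈ box M → q.ahead ≠ center r' := fun r' h1 h2 => hx r' h1 ⟨q, hq, h2⟩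
    have hr1 := r.1.isLt
    have hr2 := hr
    simp only [box, Finset.mem_Ico] at hr2
    rw [Dart.behind, center, Prod.mk.injEq] at hb
    obtain ⟨hb1, hb2⟩ := hb
    -- the other darts are not on the horizontal line of the last one, if this is above or below the rows
    have hline : (q.d % 4 = 1 ∧ q.y = 2 * M ∨ q.d % 4 = 3 ∧ q.y = -2 * M) →
        ∀ u ∈ darts γ, u ≠ q → u.y ≠ q.y := by
      intro hy u hu huq hc
      have hue := (hev u hu).2
      have h1 := h.behind_eq hS hu
      have h2 := (h.ahead_eq hS hu).resolve_left fun hc => huq (by simpa [hq] using hc.symm)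
      obtain ⟨r₂, hr₂, h2⟩ := h2
      simp only [box, Finset.mem_Ico] at hr₂
      simp only [Dart.ahead, center, Prod.mk.injEq] at h2
      have h1 : (u.y - chi (u.d - 1) = 2 * j + 1) ∨ ∃ i : ℤ, -(M : ℤ) ≤ i ∧ i < M ∧ u.y - chi (u.d - 1) = 2 * i + 1 := by
        rcases h1 with h1 | ⟨r₁, hr₁, h1⟩
        · exact .inl (congrArg Prod.snd h1)
        · simp only [box, Finset.mem_Ico] at hr₁
          exact .inr ⟨r₁.2, hr₁.1, hr₁.2, congrArg Prod.snd h1⟩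
      rcases chi_cases u.d with ⟨k0, k1, k2, -⟩ | ⟨k0, k1, k2, -⟩ | ⟨k0, k1, k2, -⟩ | ⟨k0, k1, k2, -⟩ <;>
        rw [k2] at h1 h2 <;> omega
    have hH := fun hy => hω.heading_horizontal hq (hline hy)
    rcases chi_cases q.d with ⟨k0, k1, k2, -⟩ | ⟨k0, k1, k2, -⟩ | ⟨k0, k1, k2, -⟩ | ⟨k0, k1, k2, -⟩ <;>
      rw [k1] at hb1 <;> rw [k2] at hb2
    · left
      have hT : r.1.val + 1 = T := by
        by_contra hne
        refine hnot ⟨⟨r.1.val + 1, by omega⟩, r.2⟩ hr ?_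
        rw [Dart.ahead, center, k1, k2, Prod.mk.injEq]
        push_cast
        omega
      refine hω.heading_right hq (fun u hu => ?_) k0
      obtain ⟨e, -, he⟩ := exists_edge hu
      have he := congrArg Prod.fst he
      simp only [Dart.pos] at he
      rw [← he]
      rcases e with ⟨k, i⟩ | ⟨k, i⟩ <;> simp only [Edge.pos] <;> have := k.isLt <;> omega
    · have hM : q.y = 2 * M := by
        by_contra hne
        refine hnot ⟨r.1, r.2 + 1⟩ (by simp only [box, Finset.mem_Ico]; omega) ?_
        rw [Dart.ahead, center, k1, k2, Prod.mk.injEq]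
        dsimp only
        omega
      have := (hH (.inl ⟨k0, hM⟩)).1 k0 (by omega)
      omega
    · have h0 : r.1.val = 0 := by
        by_contra hne
        refine hnot ⟨⟨r.1.val - 1, by omega⟩, r.2⟩ hr ?_
        rw [Dart.ahead, center, k1, k2, Prod.mk.injEq]
        push_cast [show 1 ≤ r.1.val by omega]
        omega
      have := hω.heading_left hq (by omega) k0
      omega
    · have hM : q.y = -2 * M := by
        by_contra hne
        refine hnot ⟨r.1, r.2 - 1⟩ (by simp only [box, Finset.mem_Ico]; omega) ?_
        rw [Dart.ahead, center, k1, k2, Prod.mk.injEq]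
        dsimp only
        omega
      have := (hH (.inr ⟨k0, hM⟩)).2 k0 (by omega)
      omega

theorem root16_cubed : root16 ^ 3 = Complex.exp ((3 * π / 8 : ℝ) * Complex.I) := by
  rw [root16, ← Complex.exp_nat_mul]
  congr 1
  push_cast
  ring

theorem re_phase {θ : ℝ} : (phase θ 0).re = 1 ∧ (phase θ 2).re = Real.cos (3 * π / 8) ∧
    (phase θ (-2)).re = Real.cos (3 * π / 8) ∧ (phase θ 1).re = Real.cos (3 * θ / 8) ∧
    (phase θ (-1)).re = Real.cos (3 * θ / 8 - 3 * π / 8) := by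
  have hu : unitPhase θ = Complex.exp ((3 * θ / 8 : ℝ) * Complex.I) := by rw [unitPhase]; push_cast; rfl
  refine ⟨by simp [phase], ?_, ?_, ?_, ?_⟩
  · simp only [phase, root16_cubed]
    norm_num [Complex.exp_ofReal_mul_I_re]
    simpa using Complex.exp_ofReal_mul_I_re (3 * π / 8)
  · simp only [phase, root16_cubed]
    norm_num [← Complex.exp_neg, ← neg_mul]
    have := Complex.exp_ofReal_mul_I_re (-(3 * π / 8))
    rw [Real.cos_neg] at this
    simpa using this
  · simp only [phase, hu]
    norm_num
    simpa using Complex.exp_ofReal_mul_I_re (3 * θ / 8)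
  · simp only [phase, root16_cubed, hu]
    norm_num [← Complex.exp_neg, ← Complex.exp_add, ← neg_mul, ← add_mul]
    have := Complex.exp_ofReal_mul_I_re (3 * θ / 8 - 3 * π / 8)
    push_cast at this
    rw [← this]
    ring_nf

/-- The phases with which walks leave a rectangle have real parts at least `cos (3π / 8)`. -/
theorem LeftSAW.re_obs_ge {θ : Fin T → ℝ} (hθ : ∀ k, θ k ∈ Set.Icc (π / 3) (2 * π / 3)) {M : ℕ}
    (h : LeftSAW j γ) (hj : j ∈ box M) (hS : StepsIn (box M) γ) (hx : Exits (box M) γ) :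
    Real.cos (3 * π / 8) * weight θ γ ≤ (obs θ γ).re := by
  have hpi := Real.pi_pos
  obtain ⟨l, e, rfl⟩ := (List.eq_nil_or_concat' γ).resolve_left h.saw.ne_nil
  have ha : 0 ≤ e.angle θ ∧ e.angle θ ≤ 2 * π / 3 := by
    rcases e with ⟨k, i⟩ | ⟨k, i⟩
    · exact ⟨le_rfl, by simp only [Edge.angle]; positivity⟩
    · exact ⟨by have := (hθ k).1; simp only [Edge.angle]; linarith, (hθ k).2⟩
  have hcos : ∀ x : ℝ, |x| ≤ 3 * π / 8 → Real.cos (3 * π / 8) ≤ Real.cos x := fun x hx => by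
    rw [← Real.cos_abs x]
    exact Real.cos_le_cos_of_nonneg_of_le_pi (abs_nonneg x) (by linarith) hx
  have key : Real.cos (3 * π / 8) ≤ (phase (e.angle θ) (heading (l ++ [e]))).re := by
    obtain ⟨h0, h2, h2', h1, h1'⟩ := re_phase (θ := e.angle θ)
    rcases h.exits hj hS hx with hh | hh | hh | hh | hh <;> rw [hh]
    · rw [h0]; exact Real.cos_le_one _
    · rw [h2]
    · rw [h2']
    · rw [h1]; exact hcos _ (abs_le.2 ⟨by linarith, by linarith⟩)
    · rw [h1']; exact hcos _ (abs_le.2 ⟨by linarith, by linarith⟩)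
  rw [obs, List.getLast?_concat]
  simp only [Complex.re_ofReal_mul]
  rw [mul_comm]
  exact mul_le_mul_of_nonneg_left key (weight_nonneg hθ h.saw)

/-- A walk that comes to the boundary of the strip leaves it. -/
theorem LeftSAW.exits_of_boundary (h : LeftSAW j γ) (hS : StepsIn S γ) (hne : γ ≠ [.vert 0 j])
    {k : Fin (T + 1)} {i : ℤ} (hk : k = 0 ∨ k = Fin.last T) (hl : γ.getLast? = some (.vert k i)) :
    Exits S γ := by
  intro r _ hr
  obtain ⟨m, x, z, rfl⟩ := h.eq_singleton_or.resolve_left hne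
  obtain rfl : z = .vert k i := by simpa using hl
  have hi : [x, .vert k i] <:+: m ++ [x] ++ [.vert k i] := ⟨m, [], by simp⟩
  obtain ⟨r', -, hx, hz⟩ := hS _ _ (.inl hi)
  have h1 := (h.headsInto_iff hl).1 hr
  have h2 := (h.enters_of_infix hi hx hz).2
  have h3 := vert_mem_sides.1 h1.mem_sides
  have h4 := vert_mem_sides.1 hz
  have hrr : r = r' := by
    have := r.1.isLt
    have := r'.1.isLt
    ext <;> rcases hk with rfl | rfl <;> simp only [Fin.val_zero, Fin.val_last] at h3 h4 <;> omega
  exact h.not_leaves h1 (hrr ▸ h2)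

/-- The bound given by the total flux of the observable. -/
theorem rowsPartFun_left_le {θ : Fin T → ℝ} (hθ : ∀ k, θ k ∈ Set.Icc (π / 3) (2 * π / 3)) {M : ℕ}
    (hj : j ∈ box M) {k : Fin (T + 1)} (hk : k = 0 ∨ k = Fin.last T) (i : ℤ) :
    rowsPartFun θ (box M) (.vert 0 j) (.vert k i) ≤ 1 + (Real.cos (3 * π / 8))⁻¹ := by
  classical
  have hpi := Real.pi_pos
  have hc : 0 < Real.cos (3 * π / 8) := Real.cos_pos_of_mem_Ioo ⟨by linarith, by linarith⟩
  have hd : ∀ k, den (θ k) ≠ 0 := fun k =>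
    (den_neg (by linarith [(hθ k).1]) (by linarith [(hθ k).2])).ne
  obtain ⟨hf, he⟩ := rowsPartFun_eq θ (box M) (.vert 0 j) (.vert k i)
  set W := (leftWalks_finite T (box M) j).toFinset with hW
  have hmem : ∀ γ ∈ W.filter (Exits (box M)), LeftSAW j γ ∧ StepsIn (box M) γ ∧ Exits (box M) γ := by
    intro γ hγ
    simp only [hW, Finset.mem_filter, Set.Finite.mem_toFinset] at hγ
    exact ⟨hγ.1.1, hγ.1.2, hγ.2⟩
  have h1 : Real.cos (3 * π / 8) * ∑ γ ∈ W with Exits (box M) γ, weight θ γ ≤ 1 := by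
    have := congrArg Complex.re (sum_obs_exits (S := box M) (j := j) hd)
    rw [Complex.re_sum, Complex.one_re] at this
    rw [← this, Finset.mul_sum]
    exact Finset.sum_le_sum fun γ hγ => (hmem γ hγ).1.re_obs_ge hθ hj (hmem γ hγ).2.1 (hmem γ hγ).2.2
  have hsub : hf.toFinset ⊆ insert [.vert 0 j] (W.filter (Exits (box M))) := by
    intro γ hγ
    obtain ⟨h, hh, hl, hS⟩ := hf.mem_toFinset.1 hγ
    by_cases hne : γ = [.vert 0 j]
    · simp [hne]
    · refine Finset.mem_insert_of_mem (Finset.mem_filter.2 ⟨?_, ?_⟩)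
      · exact (leftWalks_finite T (box M) j).mem_toFinset.2 ⟨⟨h, hh⟩, hS⟩
      · exact LeftSAW.exits_of_boundary ⟨h, hh⟩ hS hne hk hl
  have hnn : ∀ γ ∈ insert [.vert 0 j] (W.filter (Exits (box M))), 0 ≤ weight θ γ := by
    intro γ hγ
    rcases Finset.mem_insert.1 hγ with rfl | hγ
    · rw [weight_singleton]; exact zero_le_one
    · exact weight_nonneg hθ (hmem γ hγ).1.saw
  calc rowsPartFun θ (box M) (.vert 0 j) (.vert k i) = _ := he
    _ ≤ ∑ γ ∈ insert [.vert 0 j] (W.filter (Exits (box M))), weight θ γ :=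
      Finset.sum_le_sum_of_subset_of_nonneg hsub fun γ hγ _ => hnn γ hγ
    _ ≤ weight θ [.vert 0 j] + ∑ γ ∈ W with Exits (box M) γ, weight θ γ := by
      by_cases hm : [.vert 0 j] ∈ W.filter (Exits (box M))
      · rw [Finset.insert_eq_of_mem hm, weight_singleton]; linarith
      · rw [Finset.sum_insert hm]
    _ ≤ 1 + (Real.cos (3 * π / 8))⁻¹ := by
      rw [weight_singleton]
      gcongr
      rw [← one_div, le_div_iff₀' hc]
      exact h1

/-- The rotation of the strip by half a turn, which reverses the order of the columns. -/
def halfTurn : Edge T ≃ Edge T where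
  toFun
    | .vert k j => .vert k.rev (-1 - j)
    | .horiz k j => .horiz k.rev (-j)
  invFun
    | .vert k j => .vert k.rev (-1 - j)
    | .horiz k j => .horiz k.rev (-j)
  left_inv e := by cases e <;> simp
  right_inv e := by cases e <;> simp

theorem halfTurn_side4 (r : Rhombus T) (s : Fin 4) :
    halfTurn (side4 r s) = side4 (r.1.rev, -1 - r.2) (s + 2) := by
  fin_cases s <;> simp [side4, halfTurn, west, north, east, south, Fin.rev_castSucc, Fin.rev_succ] <;> ring

/-- The half-turn preserves the rows `-M, …, M - 1` and the weights of the states. -/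
theorem rowsPartFun_halfTurn (θ : Fin T → ℝ) (M : ℕ) (a b : Edge T) :
    rowsPartFun (θ ∘ Fin.rev) (box M) (halfTurn a) (halfTurn b) = rowsPartFun θ (box M) a b := by
  let φ : Fin T × box M ≃ Fin T × box M := Equiv.prodCongr Fin.revPerm
    ⟨fun j => ⟨-1 - j.1, by have := j.2; simp only [box, Finset.mem_Ico] at *; omega⟩,
      fun j => ⟨-1 - j.1, by have := j.2; simp only [box, Finset.mem_Ico] at *; omega⟩,
      fun j => by simp, fun j => by simp⟩
  rw [rowsPartFun, rowsPartFun, ← partFun_relabel halfTurn, ← partFun_rot _ _ fun _ _ => RState.wt_rot _ _,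
    ← partFun_reindex φ]
  have h2 : ∀ s : Fin 4, s + 2 + 2 = s := by decide
  congr 1
  · funext i s
    simp [φ, halfTurn_side4, h2]
  · funext i s
    simp [φ]
  · exact halfTurn.left_inv a
  · exact halfTurn.left_inv b

theorem exists_mem_box (j : ℤ) : ∃ M, j ∈ box M :=
  ⟨j.natAbs + 1, by simp only [box, Finset.mem_Ico]; omega⟩

/-- The partition functions of the strip between boundary points are bounded. -/
theorem exists_rowsPartFun_le {θ : Fin T → ℝ} (hθ : ∀ k, θ k ∈ Set.Icc (π / 3) (2 * π / 3))
    {k l : Fin (T + 1)} (hk : k = 0 ∨ k = Fin.last T) (hl : l = 0 ∨ l = Fin.last T) (i j : ℤ) :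
    ∃ C, ∀ M, rowsPartFun θ (box M) (.vert k i) (.vert l j) ≤ C := by
  have hleft : ∀ {θ : Fin T → ℝ}, (∀ k, θ k ∈ Set.Icc (π / 3) (2 * π / 3)) → ∀ {l : Fin (T + 1)},
      (l = 0 ∨ l = Fin.last T) → ∀ i j : ℤ,
        ∃ C, ∀ M, rowsPartFun θ (box M) (.vert 0 i) (.vert l j) ≤ C := by
    intro θ hθ l hl i j
    obtain ⟨N, hN⟩ := exists_mem_box i
    refine ⟨1 + (Real.cos (3 * π / 8))⁻¹, fun M => ?_⟩
    refine (rowsPartFun_box_mono hθ _ _ (le_max_left M N)).trans (rowsPartFun_left_le hθ ?_ hl j)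
    simp only [box, Finset.mem_Ico] at hN ⊢
    omega
  rcases hk with rfl | rfl
  · exact hleft hθ hl i j
  · obtain ⟨C, hC⟩ := hleft (θ := θ ∘ Fin.rev) (fun k => hθ _) (l := l.rev)
      (by rcases hl with rfl | rfl <;> simp) (-1 - i) (-1 - j)
    refine ⟨C, fun M => ?_⟩
    rw [← rowsPartFun_halfTurn]
    simpa [halfTurn] using hC M

/-! ### The 2-point function as a limit -/

theorem IsSAW.exists_rhombus {γ : List (Edge T)} (h : IsSAW γ) {e f : Edge T} (hj : Joins γ e f) :
    ∃ r : Rhombus T, e ∈ sides r ∧ f ∈ sides r := by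
  have hn := h.step
  rw [List.isChain_iff_forall_rel_of_append_cons_cons] at hn
  rcases hj with ⟨m, m', hm⟩ | ⟨m, m', hm⟩
  · exact hn (l₁ := m) (l₂ := m') (by rw [← hm]; simp)
  · obtain ⟨r, h1, h2⟩ := hn (l₁ := m) (l₂ := m') (a := f) (b := e) (by rw [← hm]; simp)
    exact ⟨r, h2, h1⟩

theorem box_mono {M N : ℕ} (h : M ≤ N) : box M ⊆ box N := by
  intro i hi
  simp only [box, Finset.mem_Ico] at *
  omega

theorem exists_rows_mem_box (γ : List (Edge T)) : ∃ M, ∀ e ∈ γ, ∀ r : Rhombus T, e ∈ sides r → r.2 ∈ box M := by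
  induction γ with
  | nil => exact ⟨0, by simp⟩
  | cons a γ ih =>
    obtain ⟨M, hM⟩ := ih
    obtain ⟨N, hN⟩ : ∃ N, ∀ r : Rhombus T, a ∈ sides r → r.2 ∈ box N := by
      rcases a with ⟨k, j⟩ | ⟨k, j⟩
      · refine ⟨j.natAbs + 2, fun r hr => ?_⟩
        have := vert_mem_sides.1 hr
        simp only [box, Finset.mem_Ico]
        omega
      · refine ⟨j.natAbs + 2, fun r hr => ?_⟩
        have := horiz_mem_sides.1 hr
        simp only [box, Finset.mem_Ico]
        omega
    refine ⟨max M N, ?_⟩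
    simp only [List.mem_cons, forall_eq_or_imp]
    exact ⟨fun r hr => box_mono (le_max_right M N) (hN r hr),
      fun e he r hr => box_mono (le_max_left M N) (hM e he r hr)⟩

theorem IsSAW.exists_stepsIn {γ : List (Edge T)} (h : IsSAW γ) : ∃ M, ∀ N, M ≤ N → StepsIn (box N) γ := by
  obtain ⟨M, hM⟩ := exists_rows_mem_box γ
  refine ⟨M, fun N hN e f hj => ?_⟩
  obtain ⟨r, he, hf⟩ := h.exists_rhombus hj
  exact ⟨r, box_mono hN (hM e hj.mem_left r he), he, hf⟩

/-- The self-avoiding walks from `a` to `b`. -/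
def edgeWalks (a b : Edge T) : Set (List (Edge T)) := {γ | IsSAW γ ∧ γ.head? = some a ∧ γ.getLast? = some b}

/-- Bounded partition functions of rectangles converge to the 2-point function. -/
theorem hasSum_of_bounded {θ : Fin T → ℝ} (hθ : ∀ k, θ k ∈ Set.Icc (π / 3) (2 * π / 3)) {a b : Edge T}
    (hC : ∃ C, ∀ M, rowsPartFun θ (box M) a b ≤ C) :
    ∃ A, HasSum (fun γ : edgeWalks a b => weight θ γ.1) A ∧
      Tendsto (fun M => rowsPartFun θ (box M) a b) atTop (𝓝 A) := by
  classical
  obtain ⟨C, hC⟩ := hC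
  have hbdd : BddAbove (Set.range fun M => rowsPartFun θ (box M) a b) := ⟨C, by rintro _ ⟨M, rfl⟩; exact hC M⟩
  refine ⟨_, ?_, tendsto_atTop_ciSup (rowsPartFun_box_mono hθ a b) hbdd⟩
  refine hasSum_of_isLUB_of_nonneg _ (fun γ => weight_nonneg hθ γ.2.1) ⟨?_, ?_⟩
  · rintro _ ⟨s, rfl⟩
    -- finitely many walks are in a common rectangle
    obtain ⟨M, hM⟩ : ∃ M, ∀ γ ∈ s, StepsIn (box M) γ.1 := by
      choose M hM using fun γ : edgeWalks a b => γ.2.1.exists_stepsIn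
      exact ⟨s.sup M, fun γ hγ => hM γ _ (Finset.le_sup hγ)⟩
    refine le_trans ?_ (le_ciSup hbdd M)
    obtain ⟨hf, he⟩ := rowsPartFun_eq θ (box M) a b
    dsimp only
    rw [he, ← Finset.sum_image (s := s) (g := Subtype.val) (f := fun γ => weight θ γ)
      (fun _ _ _ _ h => Subtype.ext h)]
    refine Finset.sum_le_sum_of_subset_of_nonneg ?_ fun γ hγ _ => weight_nonneg hθ (hf.mem_toFinset.1 hγ).1
    intro γ hγ
    obtain ⟨γ, hs, rfl⟩ := Finset.mem_image.1 hγ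
    exact hf.mem_toFinset.2 ⟨γ.2.1, γ.2.2.1, γ.2.2.2, hM γ hs⟩
  · intro B hB
    refine ciSup_le fun M => ?_
    obtain ⟨hf, he⟩ := rowsPartFun_eq θ (box M) a b
    rw [he]
    have hmem : ∀ γ ∈ hf.toFinset, γ ∈ edgeWalks a b := fun γ hγ => by
      have := hf.mem_toFinset.1 hγ
      exact ⟨this.1, this.2.1, this.2.2.1⟩
    refine le_trans (le_of_eq ?_) (hB ⟨hf.toFinset.subtype (· ∈ edgeWalks a b), rfl⟩)
    exact (Finset.sum_subtype_of_mem (fun γ => weight θ γ) hmem).symm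

/-- The `k`-th vertical line is on the boundary of the strip. -/
def OnBoundary (k : Fin (T + 1)) : Prop := k = 0 ∨ k = Fin.last T

theorem hasSum_edgeWalks {θ : Fin T → ℝ} (hθ : ∀ k, θ k ∈ Set.Icc (π / 3) (2 * π / 3)) {k l : Fin (T + 1)}
    (hk : OnBoundary k) (hl : OnBoundary l) (i j : ℤ) :
    ∃ A, HasSum (fun γ : edgeWalks (.vert k i) (.vert l j) => weight θ γ.1) A ∧
      Tendsto (fun M => rowsPartFun θ (box M) (.vert k i) (.vert l j)) atTop (𝓝 A) :=
  hasSum_of_bounded hθ (exists_rowsPartFun_le hθ hk hl i j)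

/-! ### Permutations of the columns -/

theorem tsum_edgeWalks_swap {θ : Fin T → ℝ} (hθ : ∀ k, θ k ∈ Set.Icc (π / 3) (2 * π / 3)) {k l : Fin (T + 1)}
    (hk : OnBoundary k) (hl : OnBoundary l) (i j : ℤ) {p q : Fin T} (hpq : p.succ = q.castSucc) :
    ∑' γ : edgeWalks (.vert k i) (.vert l j), weight (θ ∘ Equiv.swap p q) γ.1 =
      ∑' γ : edgeWalks (.vert k i) (.vert l j), weight θ γ.1 := by
  have hne : ∀ {k : Fin (T + 1)}, OnBoundary k → ∀ i j, Edge.vert k i ≠ .vert p.succ j := by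
    rintro k (rfl | rfl) i j h
    · exact p.succ_ne_zero (Edge.vert.inj h).1.symm
    · exact q.castSucc_ne_last (hpq ▸ (Edge.vert.inj h).1.symm)
  obtain ⟨A, h1, h2⟩ := hasSum_edgeWalks hθ hk hl i j
  obtain ⟨A', h1', h2'⟩ := hasSum_edgeWalks (θ := θ ∘ Equiv.swap p q) (fun _ => hθ _) hk hl i j
  rw [h1.tsum_eq, h1'.tsum_eq]
  exact (limit_rowsPartFun_swap hθ hpq (hne hk i) (hne hl j) (by simp) (by simp) h2 h2').symm

theorem tsum_edgeWalks_perm {θ : Fin T → ℝ} (hθ : ∀ k, θ k ∈ Set.Icc (π / 3) (2 * π / 3)) {k l : Fin (T + 1)}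
    (hk : OnBoundary k) (hl : OnBoundary l) (i j : ℤ) (σ : Equiv.Perm (Fin T)) :
    ∑' γ : edgeWalks (.vert k i) (.vert l j), weight (θ ∘ σ) γ.1 =
      ∑' γ : edgeWalks (.vert k i) (.vert l j), weight θ γ.1 := by
  cases T with
  | zero => rw [Subsingleton.elim (θ ∘ σ) θ]
  | succ n =>
    have hσ : σ ∈ Submonoid.closure (Set.range fun i : Fin n => Equiv.swap i.castSucc i.succ) := by
      rw [Equiv.Perm.mclosure_swap_castSucc_succ]; trivial
    induction hσ using Submonoid.closure_induction generalizing θ with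
    | mem σ hσ =>
      obtain ⟨m, rfl⟩ := hσ
      exact tsum_edgeWalks_swap hθ hk hl i j (Fin.succ_castSucc m)
    | one => rfl
    | mul σ τ _ _ h1 h2 => exact (h2 (θ := θ ∘ σ) fun _ => hθ _).trans (h1 hθ)

/-! ### Boundary points -/

theorem sideVec_re (θ : ℝ) : (sideVec θ).re = Real.sin θ := by
  have h1 := Complex.exp_ofReal_mul_I_re θ
  have h2 := Complex.exp_ofReal_mul_I_im θ
  simp [sideVec, h2]

theorem lineOrigin_zero (θ : Fin T → ℝ) : lineOrigin θ 0 = 0 := by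
  simp [lineOrigin]

theorem lineOrigin_last (θ : Fin T → ℝ) : lineOrigin θ (Fin.last T) = ∑ l, sideVec (θ l) := by
  simp [lineOrigin, Fin.castSucc_lt_last]

theorem lineOrigin_succ (θ : Fin T → ℝ) (k : Fin T) :
    lineOrigin θ k.succ = lineOrigin θ k.castSucc + sideVec (θ k) := by
  classical
  have hk : k ∉ Finset.univ.filter fun l : Fin T => l.castSucc < k.castSucc := by simp
  rw [lineOrigin, lineOrigin, add_comm _ (sideVec (θ k)), ← Finset.sum_insert (f := fun l => sideVec (θ l)) hk]
  refine Finset.sum_congr ?_ fun _ _ => rfl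
  ext l
  simp only [Finset.mem_filter, Finset.mem_univ, true_and, Finset.mem_insert, Fin.castSucc_lt_succ_iff,
    Fin.castSucc_lt_castSucc_iff]
  exact le_iff_eq_or_lt

theorem lineOrigin_re_strictMono {θ : Fin T → ℝ} (hθ : ∀ k, θ k ∈ Set.Icc (π / 3) (2 * π / 3)) :
    StrictMono fun k => (lineOrigin θ k).re := by
  refine Fin.strictMono_iff_lt_succ.2 fun k => ?_
  rw [lineOrigin_succ, Complex.add_re, sideVec_re]
  have := Real.pi_pos
  have := Real.sin_pos_of_pos_of_lt_pi (x := θ k) (by linarith [(hθ k).1]) (by linarith [(hθ k).2])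
  linarith

/-- A boundary point is the midpoint of only one edge. -/
theorem midpt_eq_iff {θ : Fin T → ℝ} (hθ : ∀ k, θ k ∈ Set.Icc (π / 3) (2 * π / 3)) {k : Fin (T + 1)}
    (hk : OnBoundary k) (i : ℤ) (e : Edge T) : midpt θ e = midpt θ (.vert k i) ↔ e = .vert k i := by
  refine ⟨fun h => ?_, fun h => by rw [h]⟩
  have hm := lineOrigin_re_strictMono hθ
  have hre := congrArg Complex.re h
  rcases e with ⟨l, j⟩ | ⟨l, j⟩
  · simp only [midpt, Complex.add_re, Complex.mul_re, Complex.I_re, Complex.I_im, Complex.intCast_re,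
      Complex.intCast_im] at hre
    obtain rfl : l = k := hm.injective (by simpa using hre)
    simp only [midpt, add_right_inj, mul_eq_mul_right_iff, Complex.I_ne_zero, or_false, Int.cast_inj] at h
    rw [h]
  · exfalso
    have h1 : (lineOrigin θ l.succ).re = (lineOrigin θ l.castSucc).re + (sideVec (θ l)).re := by
      rw [lineOrigin_succ, Complex.add_re]
    have h2 : (lineOrigin θ l.castSucc).re < (lineOrigin θ l.succ).re := hm (Fin.castSucc_lt_succ)
    have h3 : (midpt θ (.horiz l j)).re = (lineOrigin θ l.castSucc).re + (sideVec (θ l)).re / 2 := by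
      simp [midpt, show sideVec (θ l) / 2 = ((1 / 2 : ℝ) : ℂ) * sideVec (θ l) by push_cast; ring]
      ring
    have h4 : (midpt θ (.vert k i)).re = (lineOrigin θ k).re := by simp [midpt]
    rw [h3, h4] at hre
    rcases hk with rfl | rfl
    · have : (lineOrigin θ 0).re ≤ (lineOrigin θ l.castSucc).re := hm.monotone (Fin.zero_le _)
      linarith
    · have : (lineOrigin θ l.succ).re ≤ (lineOrigin θ (Fin.last T)).re := hm.monotone (Fin.le_last _)
      linarith

theorem walks_eq {θ : Fin T → ℝ} (hθ : ∀ k, θ k ∈ Set.Icc (π / 3) (2 * π / 3)) {k l : Fin (T + 1)}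
    (hk : OnBoundary k) (hl : OnBoundary l) (i j : ℤ) :
    walks θ (midpt θ (.vert k i)) (midpt θ (.vert l j)) = edgeWalks (.vert k i) (.vert l j) := by
  ext γ
  simp only [walks, edgeWalks, midpt_eq_iff hθ hk, midpt_eq_iff hθ hl, Set.mem_ofPred_eq,
    exists_eq_right]

theorem midpt_perm (θ : Fin T → ℝ) (σ : Equiv.Perm (Fin T)) {k : Fin (T + 1)} (hk : OnBoundary k) (i : ℤ) :
    midpt (θ ∘ σ) (.vert k i) = midpt θ (.vert k i) := by
  have : lineOrigin (θ ∘ σ) k = lineOrigin θ k := by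
    rcases hk with rfl | rfl
    · rw [lineOrigin_zero, lineOrigin_zero]
    · rw [lineOrigin_last, lineOrigin_last]
      exact Equiv.sum_comp σ fun l => sideVec (θ l)
  rw [midpt, midpt, this]

theorem boundaryPoints_perm (θ : Fin T → ℝ) (σ : Equiv.Perm (Fin T)) :
    boundaryPoints (θ ∘ σ) = boundaryPoints θ := by
  simp only [boundaryPoints, midpt_perm θ σ (.inl rfl), midpt_perm θ σ (.inr rfl)]

theorem exists_of_mem_boundaryPoints {θ : Fin T → ℝ} {a : ℂ} (ha : a ∈ boundaryPoints θ) :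
    ∃ k i, OnBoundary k ∧ a = midpt θ (.vert k i) := by
  obtain ⟨i, h | h⟩ := ha
  · exact ⟨0, i, .inl rfl, h⟩
  · exact ⟨Fin.last T, i, .inr rfl, h⟩

end RhombicSAW

end

theorem mainTheorem6 (T : ℕ) (θ : Fin T → ℝ) (hθ : ∀ k, θ k ∈ Set.Icc (π / 3) (2 * π / 3))
    (σ : Equiv.Perm (Fin T)) (a b : ℂ)
    (ha : a ∈ RhombicSAW.boundaryPoints θ) (hb : b ∈ RhombicSAW.boundaryPoints θ) :
    RhombicSAW.boundaryPoints (θ ∘ σ) = RhombicSAW.boundaryPoints θ ∧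
    Summable (fun γ : RhombicSAW.walks θ a b => RhombicSAW.weight θ γ.1) ∧
    Summable (fun γ : RhombicSAW.walks (θ ∘ σ) a b => RhombicSAW.weight (θ ∘ σ) γ.1) ∧
    RhombicSAW.twoPoint (θ ∘ σ) a b = RhombicSAW.twoPoint θ a b := by
  obtain ⟨k, i, hk, rfl⟩ := RhombicSAW.exists_of_mem_boundaryPoints ha
  obtain ⟨l, j, hl, rfl⟩ := RhombicSAW.exists_of_mem_boundaryPoints hb
  have hθ' : ∀ k, (θ ∘ σ) k ∈ Set.Icc (π / 3) (2 * π / 3) := fun _ => hθ _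
  have h := RhombicSAW.walks_eq hθ hk hl i j
  have h' := RhombicSAW.walks_eq hθ' hk hl i j
  rw [RhombicSAW.midpt_perm θ σ hk, RhombicSAW.midpt_perm θ σ hl] at h'
  obtain ⟨A, hA, -⟩ := RhombicSAW.hasSum_edgeWalks hθ hk hl i j
  obtain ⟨A', hA', -⟩ := RhombicSAW.hasSum_edgeWalks hθ' hk hl i j
  refine ⟨RhombicSAW.boundaryPoints_perm θ σ, ?_, ?_, ?_⟩
  · rw [h]; exact hA.summable
  · rw [h']; exact hA'.summable
  · rw [RhombicSAW.twoPoint, RhombicSAW.twoPoint, h, h']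
    exact RhombicSAW.tsum_edgeWalks_perm hθ hk hl i j σ
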